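/- Let $\gamma$ be a (closed, filled) regular dodecagon in the plane. The outer billiard map $T$ outside $\gamma$ is defined as follows: for a point $p\notin\gamma$ draw the right tangent line to $\gamma$ as seen from $p$ (so that $\gamma$ lies to the left of the ray from $p$ through the point of tangency), and let $T(p)$ be the point symmetric to $p$ with respect to the point of tangency; $T(p)$ is undefined if this tangent line contains a side of $\gamma$. A point $p\notin\gamma$ is periodic if $T^n(p)$ is defined and equal to $p$ for some integer $n\ge 1$; the least such $n$ is the period of $p$. Let $$M_{68}=\begin{pmatrix}1&0&0&0&0&0&0&0\\0&1&0&0&0&0&0&0\\0&0&1&0&0&0&0&0\\0&0&0&1&8&18&13&24\\0&0&0&0&2&7&14&29\\0&0&0&0&0&0&0&0\end{pmatrix},\qquad M_{66}=\begin{pmatrix}0&0&0&0&0&0\\0&0&0&0&0&0\\0&0&0&0&0&0\\0&0&0&0&0&0\\5&4&3&2&1&0\\1&1&1&1&1&1\end{pmatrix},$$ $$M_{88}=\begin{pmatrix}2&2&2&2&20&50&26&50\\2&2&2&2&20&50&26&50\\4&4&4&4&42&107&74&145\\2&2&2&2&20&50&48&94\\0&1&0&0&0&0&0&0\\1&0&0&0&0&0&0&0\\0&0&0&1&8&18&13&24\\0&0&1&0&0&0&0&0\end{pmatrix}.$$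 Let $F$ be the set of the thirteen column vectors $$(0,1,0,0,0,0,0,0)^T,\ (0,0,1,0,0,0,0,0)^T,\ (9,2,5,2,0,0,0,0)^T,\ (6,4,10,4,0,0,0,0)^T,\ (0,0,2,3,0,0,1,0)^T,$$ $$(24,24,120,102,0,0,18,0)^T,\ (48,48,156,108,0,0,24,0)^T,\ (4,4,9,4,0,0,1,0)^T,\ (1,0,0,0,0,0,0,0)^T,$$ $$(0,0,1,1,0,0,0,0)^T,\ (2,2,4,2,0,0,1,0)^T,\ (0,0,7,8,0,0,1,0)^T,\ (6,6,13,6,0,0,2,0)^T,$$ and let $G$ be the set of the eight column vectors $$(0,0,0,0,1,0)^T,\ (0,0,0,1,0,0)^T,\ (0,0,0,24,36,0)^T,\ (0,0,0,18,36,0)^T,$$ $$(0,0,0,1,2,0)^T,\ (0,0,0,1,1,0)^T,\ (0,0,0,2,1,0)^T,\ (0,0,0,1,3,0)^T.$$ Put $$H=\{M_{66}^kM_{68}M_{88}^nf \mid f\in F,\ k,n\in\mathbb Z_{\ge 0}\}\cup\{M_{66}^kg\mid g\in G,\ k\in\mathbb Z_{\ge 0}\},$$ $$B=\left\{12\cdot\frac{(1,1,1,1,1,1)\,h}{\gcd\bigl(12,\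 (1,2,3,4,5,6)\,h\bigr)}\ \middle|\ h\in H\right\}.$$ Theorem. The set of the periods of all periodic points of the outer billiard outside the regular dodecagon $\gamma$ is equal to $B\cup\{2b\mid b\in B,\ b\text{ odd}\}$. -/

import Mathlib

open scoped Matrix

namespace OuterBilliard

/-- The closed (filled) regular `n`-gon in the plane `ℂ` with centre `c` and vertices
`c + a * exp (2πik/n)`, `k = 0, …, n - 1`. -/
noncomputable def regularPolygon (n : ℕ) (c a : ℂ) : Set ℂ :=
  convexHull ℝ
    (Set.range fun k : Fin n =>
      c + a * Complex.exp (2 * Real.pi * Complex.I * ((k : ℕ) : ℂ) / (n : ℂ)))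

/-- The signed area of the parallelogram spanned by `u` and `w`; it is positive iff the rotation
from `u` to `w` through an angle less than `π` is counterclockwise. -/
def cross (u w : ℂ) : ℝ := u.re * w.im - u.im * w.re

/-- `v` is the point of tangency of the right (as seen from `p`) tangent line from `p` to `γ`:
the figure `γ` meets the line through `p` and `v` only at `v`, and the rest of `γ` lies strictly
to the left of the direction from `p` to `v`. If the right tangent line contains a whole side
of `γ`, there is no such `v`. -/
def IsRightTangencyPoint (γ : Set ℂ) (p v : ℂ) : Prop :=
  v ∈ γ ∧ ∀ w ∈ γ, w ≠ v → 0 < cross (v - p) (w - p)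

/-- The outer billiard map with table `γ`, a partial map of the plane: a point `p` outside `γ` is
sent to its reflection in the point of tangency of the right tangent line from `p` to `γ`. -/
noncomputable def outerBilliard (γ : Set ℂ) : ℂ →. ℂ := fun p =>
  ⟨p ∉ γ ∧ ∃ v, IsRightTangencyPoint γ p v, fun h => 2 * h.2.choose - p⟩

theorem IsRightTangencyPoint.unique {γ : Set ℂ} {p v w : ℂ}
    (hv : IsRightTangencyPoint γ p v) (hw : IsRightTangencyPoint γ p w) : v = w := by
  by_contra hne
  have h1 := hv.2 w hw.1 (Ne.symm hne)
  have h2 := hw.2 v hv.1 hne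
  unfold cross at h1 h2
  linarith

theorem mem_outerBilliard {γ : Set ℂ} {p q : ℂ} :
    q ∈ outerBilliard γ p ↔ p ∉ γ ∧ ∃ v, IsRightTangencyPoint γ p v ∧ q = 2 * v - p := by
  constructor
  · rintro ⟨h, rfl⟩
    exact ⟨h.1, _, h.2.choose_spec, rfl⟩
  · rintro ⟨hp, v, hv, rfl⟩
    refine ⟨⟨hp, v, hv⟩, ?_⟩
    have hex : ∃ v, IsRightTangencyPoint γ p v := ⟨v, hv⟩
    have h : hex.choose = v := hex.choose_spec.unique hv
    change 2 * hex.choose - p = 2 * v - p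
    rw [h]

/-- The `m`-th iterate of a partial map; it is defined at `p` iff all `m` steps are defined. -/
def iter {α : Type*} (T : α →. α) : ℕ → α →. α
  | 0 => fun p => Part.some p
  | m + 1 => fun p => (iter T m p).bind T

/-- `n` is the period of `p`: the least positive integer such that `T^n p` is defined and
equal to `p`. -/
def IsPeriod {α : Type*} (T : α →. α) (p : α) (n : ℕ) : Prop :=
  IsLeast {m : ℕ | 0 < m ∧ p ∈ iter T m p} n

/-- The set of the periods of all periodic points of the outer billiard outside `γ`. -/
def periods (γ : Set ℂ) : Set ℕ :=
  {n | ∃ p : ℂ, p ∉ γ ∧ IsPeriod (outerBilliard γ) p n}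

def M68 : Matrix (Fin 6) (Fin 8) ℕ :=
  !![1, 0, 0, 0, 0, 0, 0, 0;
     0, 1, 0, 0, 0, 0, 0, 0;
     0, 0, 1, 0, 0, 0, 0, 0;
     0, 0, 0, 1, 8, 18, 13, 24;
     0, 0, 0, 0, 2, 7, 14, 29;
     0, 0, 0, 0, 0, 0, 0, 0]

def M66 : Matrix (Fin 6) (Fin 6) ℕ :=
  !![0, 0, 0, 0, 0, 0;
     0, 0, 0, 0, 0, 0;
     0, 0, 0, 0, 0, 0;
     0, 0, 0, 0, 0, 0;
     5, 4, 3, 2, 1, 0;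
     1, 1, 1, 1, 1, 1]

def M88 : Matrix (Fin 8) (Fin 8) ℕ :=
  !![2, 2, 2, 2, 20, 50, 26, 50;
     2, 2, 2, 2, 20, 50, 26, 50;
     4, 4, 4, 4, 42, 107, 74, 145;
     2, 2, 2, 2, 20, 50, 48, 94;
     0, 1, 0, 0, 0, 0, 0, 0;
     1, 0, 0, 0, 0, 0, 0, 0;
     0, 0, 0, 1, 8, 18, 13, 24;
     0, 0, 1, 0, 0, 0, 0, 0]

def F : Set (Fin 8 → ℕ) :=
  {![0, 1, 0, 0, 0, 0, 0, 0],
   ![0, 0, 1, 0, 0, 0, 0, 0],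
   ![9, 2, 5, 2, 0, 0, 0, 0],
   ![6, 4, 10, 4, 0, 0, 0, 0],
   ![0, 0, 2, 3, 0, 0, 1, 0],
   ![24, 24, 120, 102, 0, 0, 18, 0],
   ![48, 48, 156, 108, 0, 0, 24, 0],
   ![4, 4, 9, 4, 0, 0, 1, 0],
   ![1, 0, 0, 0, 0, 0, 0, 0],
   ![0, 0, 1, 1, 0, 0, 0, 0],
   ![2, 2, 4, 2, 0, 0, 1, 0],
   ![0, 0, 7, 8, 0, 0, 1, 0],
   ![6, 6, 13, 6, 0, 0, 2, 0]}

def G : Set (Fin 6 → ℕ) :=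
  {![0, 0, 0, 0, 1, 0],
   ![0, 0, 0, 1, 0, 0],
   ![0, 0, 0, 24, 36, 0],
   ![0, 0, 0, 18, 36, 0],
   ![0, 0, 0, 1, 2, 0],
   ![0, 0, 0, 1, 1, 0],
   ![0, 0, 0, 2, 1, 0],
   ![0, 0, 0, 1, 3, 0]}

def H : Set (Fin 6 → ℕ) :=
  {h | ∃ f ∈ F, ∃ k n : ℕ, h = (M66 ^ k * M68 * M88 ^ n) *ᵥ f} ∪
  {h | ∃ g ∈ G, ∃ k : ℕ, h = (M66 ^ k) *ᵥ g}

/-- The division is exact, because the greatest common divisor divides `12`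
and is therefore also nonzero. -/
def B : Set ℕ :=
  {b | ∃ h ∈ H,
    b = 12 * (![1, 1, 1, 1, 1, 1] ⬝ᵥ h) / Nat.gcd 12 (![1, 2, 3, 4, 5, 6] ⬝ᵥ h)}

end OuterBilliard

/-! The twelvefold symmetry reduces the billiard to one wedge. The points whose right tangency point
is a given vertex form a wedge at that vertex, and the billiard takes position y at vertex k to
position `sector.step i y` at vertex k + i, where i ∈ {1, …, 6} is the number of the cell of y. If w
is the word of cell numbers of a periodic orbit of `sector`, read once, then the billiard period is
|w| · `ord w.sum`: the orbit has to close up both in the wedge and among the vertices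
(`mem_periods_iff`). This depends only on the letter counts of w, so the task is to find all
possible vectors of counts.

Two self-similarities produce them. Cell 6 is a translate of the wedge, and the first return map to
it is `sector` again, with letter k replaced by one 6 and 6 - k letters 5 (`six_induced`). This
gives `M66`; undoing it shortens words, so every word comes from one without the letter 6
(`exists_prim_without_six`). An orbit without 6 may use 4 and 5 only; then it runs into one of
finitely many islands, with the counts in `G` (`sector_cover`). Otherwise it meets `nearDomain`,
which is made up of the cells 1, 2, 3. The first return map `near` to it is self-similar with the
ratio 7 - 4√3 (`shrink_induced`), which gives `M88`, while `M68` counts the letters of `sector` in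
those of `near`. Every generic point of `nearDomain` runs into one of thirteen islands, with the
weights in `F`, or into the shrunken domain (`near_cover`). Rescaling a periodic orbit shortens its
word, so an island is reached in the end (`near_reach`).

An island is a polygon that the motion of its word maps into itself. If this motion turns by a
nonzero angle, it has just one fixed point, and the other periodic points with the same itinerary
have the word repeated as often as the order of the rotation says (`eq_or_isPower`). This repetition
leaves an even period unchanged and doubles an odd one (`value_order_smul`), whence the numbers 2b.
No tabulated word is itself a repetition that would conceal an odd period (`isPower_false`).

The claims about cells, returns and islands are finite computations with polygons that have sides in
twelve directions and bounds in ℤ[√3]/36. Polygons enter only as upper bounds, so outer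
approximations suffice. Points on cell walls are avoided by means of generic points: having a given
word is an open condition, so a periodic point has generic neighbours with the same itinerary. -/

namespace OuterBilliard

/-! ### Symbolic dynamics: words of orbits, primitive words, induced maps -/

/-- A partially defined map that is given by labelled pieces: `step k` is applied to the points
`x` with `At x k`. -/
structure PMap (α : Type*) where
  At : α → ℕ → Prop
  step : ℕ → α → α

namespace PMap

variable {α : Type*} {S : PMap α}

/-- The labels along an orbit segment from `x` to `y` form the word `w`. -/
def Run (S : PMap α) : α → List ℕ → α → Prop
  | x, [], y => x = y
  | x, k :: w, y => S.At x k ∧ Run S (S.step k x) w y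

/-- The pieces are disjoint. -/
def Det (S : PMap α) : Prop := ∀ x k l, S.At x k → S.At x l → k = l

/-- `w` is the word of the periodic orbit of `x`, read once. -/
def Prim (S : PMap α) (x : α) (w : List ℕ) : Prop :=
  w ≠ [] ∧ S.Run x w x ∧ ∀ u, u ≠ [] → S.Run x u x → w.length ≤ u.length

def SameItinerary (S : PMap α) (x y : α) : Prop :=
  ∀ u, (∃ z, S.Run x u z) ↔ ∃ z, S.Run y u z

theorem run_nil {x y : α} : S.Run x [] y ↔ x = y := Iff.rfl

theorem run_cons {x y : α} {k : ℕ} {w : List ℕ} :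
    S.Run x (k :: w) y ↔ S.At x k ∧ S.Run (S.step k x) w y := Iff.rfl

theorem run_append {x y : α} {u v : List ℕ} :
    S.Run x (u ++ v) y ↔ ∃ z, S.Run x u z ∧ S.Run z v y := by
  induction u generalizing x with
  | nil => simp [run_nil]
  | cons k u ih => simp [run_cons, ih, and_assoc]

theorem run_singleton {x y : α} {k : ℕ} : S.Run x [k] y ↔ S.At x k ∧ S.step k x = y := Iff.rfl

theorem Run.unique {x y z : α} {u : List ℕ} (h : S.Run x u y) (h' : S.Run x u z) : y = z := by
  induction u generalizing x with
  | nil => rw [run_nil] at h h'; rw [← h, ← h']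
  | cons k u ih => exact ih h.2 h'.2

theorem Run.split (hS : S.Det) {x y z : α} {u v : List ℕ} (h : S.Run x u y) (h' : S.Run x v z)
    (hl : u.length ≤ v.length) : ∃ t, v = u ++ t ∧ S.Run y t z := by
  induction u generalizing x v with
  | nil => rw [run_nil] at h; subst h; exact ⟨v, rfl, h'⟩
  | cons k u ih =>
    cases v with
    | nil => simp at hl
    | cons l v =>
      obtain rfl := hS x k l h.1 h'.1
      obtain ⟨t, rfl, ht⟩ := ih h.2 h'.2 (by simpa using hl)
      exact ⟨t, rfl, ht⟩

theorem Run.eq_of_length (hS : S.Det) {x y z : α} {u v : List ℕ} (h : S.Run x u y)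
    (h' : S.Run x v z) (hl : u.length = v.length) : u = v ∧ y = z := by
  obtain ⟨t, rfl, ht⟩ := h.split hS h' hl.le
  have : t = [] := by simpa using hl
  subst this
  exact ⟨by simp, ht⟩

theorem Run.rep {x : α} {w : List ℕ} (h : S.Run x w x) (m : ℕ) :
    S.Run x (List.replicate m w).flatten x := by
  induction m with
  | zero => rfl
  | succ m ih => rw [List.replicate_succ, List.flatten_cons]; exact run_append.2 ⟨x, h, ih⟩

/-- Since w is a shortest return word, it can be split off the front of any return word, and what
remains is again a return word. -/
theorem Prim.exists_rep (hS : S.Det) {x : α} {w u : List ℕ} (hw : S.Prim x w)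
    (hu : S.Run x u x) : ∃ m, u = (List.replicate m w).flatten := by
  induction hn : u.length using Nat.strong_induction_on generalizing u with
  | _ n ih =>
    by_cases h0 : u = []
    · exact ⟨0, by simp [h0]⟩
    obtain ⟨t, rfl, ht⟩ := hw.2.1.split hS hu (hw.2.2 u h0 hu)
    have hpos : 0 < w.length := List.length_pos_iff.2 hw.1
    obtain ⟨m, rfl⟩ := ih t.length (by simp at hn; omega) ht rfl
    exact ⟨m + 1, by rw [List.replicate_succ, List.flatten_cons]⟩

theorem exists_prim {x : α} {u : List ℕ} (hu : u ≠ []) (h : S.Run x u x) :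
    ∃ w, S.Prim x w := by
  classical
  have hex : ∃ n, ∃ w : List ℕ, w.length = n ∧ w ≠ [] ∧ S.Run x w x := ⟨_, u, rfl, hu, h⟩
  obtain ⟨w, hl, hw, hr⟩ := Nat.find_spec hex
  exact ⟨w, hw, hr, fun v hv hv' => hl ▸ Nat.find_min' hex ⟨v, rfl, hv, hv'⟩⟩

theorem Prim.rotate (hS : S.Det) {x y : α} {u v : List ℕ} (h : S.Prim x (u ++ v))
    (hu : S.Run x u y) : S.Prim y (v ++ u) := by
  obtain ⟨z, hz, hv⟩ := run_append.1 h.2.1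
  obtain rfl := hu.unique hz
  refine ⟨fun h0 => h.1 ?_, run_append.2 ⟨x, hv, hu⟩, fun s hs hr => ?_⟩
  · simp only [List.append_eq_nil_iff] at h0 ⊢
    exact h0.symm
  · by_contra hlt
    push Not at hlt
    -- The length of this return word lies strictly between one and two times that of u ++ v, so it
    -- is not a multiple.
    have h1 : S.Run x (u ++ s ++ v) x := run_append.2 ⟨y, run_append.2 ⟨y, hu, hr⟩, hv⟩
    obtain ⟨m, hm⟩ := h.exists_rep hS h1
    have hl := congrArg List.length hm
    simp only [List.length_append, List.length_flatten, List.map_replicate, List.sum_replicate,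
      smul_eq_mul] at hl hlt
    have hspos : 0 < s.length := List.length_pos_iff.2 hs
    rcases m with _ | _ | m
    · omega
    · omega
    · nlinarith

/-- Every word that occurs from either point is a prefix of a power of u. -/
theorem sameItinerary_of_run (hS : S.Det) {x y : α} {u : List ℕ} (hu : u ≠ [])
    (hx : S.Run x u x) (hy : S.Run y u y) : S.SameItinerary x y := by
  have key : ∀ {x y : α}, S.Run x u x → S.Run y u y → ∀ v, (∃ z, S.Run x v z) →
      ∃ z, S.Run y v z := by
    intro x y hx hy v ⟨z, hz⟩
    have hpos : 0 < u.length := List.length_pos_iff.2 hu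
    have h1 := hx.rep v.length
    have hle : v.length ≤ (List.replicate v.length u).flatten.length := by
      simp only [List.length_flatten, List.map_replicate, List.sum_replicate, smul_eq_mul]
      nlinarith
    obtain ⟨t, ht, -⟩ := hz.split hS h1 hle
    have h2 := hy.rep v.length
    rw [ht] at h2
    obtain ⟨z', hz', -⟩ := run_append.1 h2
    exact ⟨z', hz'⟩
  exact fun v => ⟨key hx hy v, key hy hx v⟩

theorem SameItinerary.symm {x y : α} (h : S.SameItinerary x y) : S.SameItinerary y x :=
  fun u => (h u).symm

theorem SameItinerary.trans {x y z : α} (h : S.SameItinerary x y) (h' : S.SameItinerary y z) :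
    S.SameItinerary x z :=
  fun u => (h u).trans (h' u)

theorem SameItinerary.run {x y x' y' : α} {u : List ℕ} (h : S.SameItinerary x y)
    (hx : S.Run x u x') (hy : S.Run y u y') : S.SameItinerary x' y' := by
  have key : ∀ {x y x' y' : α}, S.SameItinerary x y → S.Run x u x' → S.Run y u y' →
      ∀ v, (∃ z, S.Run x' v z) → ∃ z, S.Run y' v z := by
    intro x y x' y' h hx hy v ⟨z, hz⟩
    obtain ⟨z', hz'⟩ := (h (u ++ v)).1 ⟨z, run_append.2 ⟨x', hx, hz⟩⟩
    obtain ⟨y'', h1, h2⟩ := run_append.1 hz'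
    obtain rfl := hy.unique h1
    exact ⟨z', h2⟩
  exact fun v => ⟨key h hx hy v, key h.symm hy hx v⟩

/-- The map `S'`, transported by `e`, is the first return map of `S` to `D`, at least where `S'`
is defined; a step of `S'` with label `k` is a segment of an orbit of `S` with the word `σ k`. -/
structure Induced (S S' : PMap α) (e : α → α) (σ : ℕ → List ℕ) (D : Set α) : Prop where
  inj : Function.Injective e
  run : ∀ x k, S'.At x k → S.Run (e x) (σ k) (e (S'.step k x))
  ne_nil : ∀ x k, S'.At x k → σ k ≠ []
  mem : ∀ x k, S'.At x k → e x ∈ D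
  first : ∀ x k u v y, S'.At x k → σ k = u ++ v → u ≠ [] → v ≠ [] → S.Run (e x) u y → y ∉ D

namespace Induced

variable {S' : PMap α} {e : α → α} {σ : ℕ → List ℕ} {D : Set α}

theorem lift (hI : Induced S S' e σ D) {x y : α} {w : List ℕ} (h : S'.Run x w y) :
    S.Run (e x) (w.flatMap σ) (e y) := by
  induction w generalizing x with
  | nil => rw [run_nil] at h; subst h; rfl
  | cons k w ih =>
    rw [List.flatMap_cons]
    exact run_append.2 ⟨_, hI.run x k h.1, ih h.2⟩

/-- The words σ k are split off one after another; `first` excludes that the run ends inside one of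
them. The invariant condition Q guarantees that the induced map does not get stuck on a wall between
its pieces. -/
theorem decode (hI : Induced S S' e σ D) (hS : S.Det) {Q : α → Prop}
    (hQ : ∀ x, Q x → ∃ k, S'.At x k) (hstep : ∀ x k, Q x → S'.At x k → Q (S'.step k x))
    {x d : α} {u : List ℕ} (hx : Q x) (hu : S.Run (e x) u d) (hd : d ∈ D) :
    ∃ w y, S'.Run x w y ∧ u = w.flatMap σ ∧ d = e y := by
  induction hn : u.length using Nat.strong_induction_on generalizing x u with
  | _ n ih =>
    by_cases h0 : u = []
    · subst h0
      exact ⟨[], x, rfl, rfl, hu.symm⟩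
    obtain ⟨k, hk⟩ := hQ x hx
    have hr := hI.run x k hk
    have hne := hI.ne_nil x k hk
    have hpos : 0 < (σ k).length := List.length_pos_iff.2 hne
    by_cases hl : (σ k).length ≤ u.length
    · obtain ⟨t, rfl, ht⟩ := hr.split hS hu hl
      obtain ⟨w, y, hw, rfl, rfl⟩ := ih t.length (by simp at hn; omega)
        (hstep x k hx hk) ht rfl
      exact ⟨k :: w, y, ⟨hk, hw⟩, by rw [List.flatMap_cons], rfl⟩
    · exfalso
      push Not at hl
      obtain ⟨t, ht, -⟩ := hu.split hS hr hl.le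
      refine hI.first x k u t d hk ht h0 ?_ hu hd
      rintro rfl
      rw [ht] at hl
      simp at hl

theorem prim (hI : Induced S S' e σ D) (hS : S.Det) (hS' : S'.Det) {x : α} {w : List ℕ}
    (h : S'.Prim x w) : S.Prim (e x) (w.flatMap σ) := by
  have hlast : ∃ k, S'.At x k := by
    obtain ⟨h1, h2, -⟩ := h
    cases w with
    | nil => exact absurd rfl h1
    | cons k w => exact ⟨k, h2.1⟩
  obtain ⟨k, hk⟩ := hlast
  refine ⟨?_, hI.lift h.2.1, ?_⟩
  · cases w with
    | nil => exact absurd rfl h.1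
    | cons l w =>
      rw [List.flatMap_cons]
      simp [hI.ne_nil x l h.2.1.1]
  · intro u hu hr
    -- Here Q says that the point is periodic under the induced map.
    obtain ⟨v, y, hv, rfl, hy⟩ := hI.decode hS (Q := fun y => ∃ u, u ≠ [] ∧ S'.Run y u y)
      (by
        rintro y ⟨u, hu, hr⟩
        cases u with
        | nil => exact absurd rfl hu
        | cons l u => exact ⟨l, hr.1⟩)
      (by
        rintro y l ⟨u, hu, hr⟩ hl
        cases u with
        | nil => exact absurd rfl hu
        | cons l' u =>
          obtain rfl := hS' y l l' hl hr.1
          exact ⟨u ++ [l], by simp, run_append.2 ⟨y, hr.2, hl, rfl⟩⟩)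
      ⟨w, h.1, h.2.1⟩ hr (hI.mem x k hk)
    obtain rfl := hI.inj hy
    have hv0 : v ≠ [] := by
      rintro rfl
      exact hu rfl
    obtain ⟨m, rfl⟩ := h.exists_rep hS' hv
    obtain ⟨m, rfl⟩ : ∃ m', m = m' + 1 := Nat.exists_eq_succ_of_ne_zero (by
      rintro rfl
      exact hv0 rfl)
    rw [List.replicate_succ, List.flatten_cons, List.flatMap_append, List.length_append]
    omega

end Induced

end PMap

/-! ### Exact computation with polygons and motions over ℤ[√3] -/

/-- The pair `(a, b)` stands for the real number `(a + b√3) / 36`. -/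
abbrev Surd := ℤ × ℤ

namespace Surd

/-- Decides `a + b√3 ≤ 0`. -/
def nonpos : ℤ → ℤ → Bool
  | .ofNat a, .ofNat b => Nat.beq (a + b) 0
  | .ofNat a, .negSucc b => Nat.ble (a * a) (3 * ((b + 1) * (b + 1)))
  | .negSucc a, .ofNat b => Nat.ble (3 * (b * b)) ((a + 1) * (a + 1))
  | .negSucc _, .negSucc _ => true

def le (x y : Surd) : Bool := nonpos (x.1 - y.1) (x.2 - y.2)

def add (x y : Surd) : Surd := (x.1 + y.1, x.2 + y.2)

def neg (x : Surd) : Surd := (-x.1, -x.2)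

/-- The minimum with respect to the order of the real values. -/
def min (x y : Surd) : Surd := bif le x y then x else y

/-- Multiplication by `2 sin (30° n)`. -/
def mulSin (n : ℕ) (x : Surd) : Surd :=
  match n with
  | 1 | 5 => x
  | 2 | 4 => (3 * x.2, x.1)
  | 3 => (2 * x.1, 2 * x.2)
  | _ => (0, 0)

/-- Division by `2 sin (30° n)`, where it is exact. -/
def divSin (n : ℕ) (x : Surd) : Option Surd :=
  match n with
  | 1 | 5 => some x
  | 2 | 4 => bif x.1 % 3 == 0 then some (x.2, x.1 / 3) else none
  | 3 => bif x.1 % 2 == 0 && x.2 % 2 == 0 then some (x.1 / 2, x.2 / 2) else none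
  | _ => none

/-- Multiplication by `7 - 4√3`. -/
def scale (x : Surd) : Surd := (7 * x.1 - 12 * x.2, 7 * x.2 - 4 * x.1)

/-- Computes the components before they are passed on, so that unevaluated terms do not pile up. -/
def force {β : Type} (x : Surd) (k : Surd → β) : β :=
  forceInt x.1 fun a => forceInt x.2 fun b => k (a, b)
where
  forceNat {β : Type} (n : ℕ) (k : ℕ → β) : β :=
    match n with
    | 0 => k 0
    | m + 1 => k (Nat.succ m)
  forceInt {β : Type} (n : ℤ) (k : ℤ → β) : β :=
    match n with
    | .ofNat m => forceNat m fun m => k (.ofNat m)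
    | .negSucc m => forceNat m fun m => k (.negSucc m)

end Surd

/-- `(r, t₀, t₁)` stands for the motion `x ↦ turn^r x + t`, and for the point `t`. -/
abbrev Move := ℕ × Surd × Surd

/-- The upper bounds for the twelve linear forms `form 0, …, form 11`. -/
abbrev Poly := List Surd

namespace Poly

def get (Q : Poly) (i : ℕ) : Surd := Q.getD (i % 12) (0, 0)

def force {β : Type} : Poly → (Poly → β) → β
  | [], k => k []
  | q :: Q, k => q.force fun q => Poly.force Q fun Q => k (q :: Q)

/-- The values of `n` consecutive forms, the first two of which are `a` and `b`. -/
def ofPoint : ℕ → Surd → Surd → Poly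
  | 0, _, _ => []
  | n + 1, a, b => a :: ofPoint n b (3 * b.2 - a.1, b.1 - a.2)

/-- The image of a polygon under a motion. -/
def move (m : Move) (Q : Poly) : Poly :=
  List.zipWith Surd.add (Q.drop m.1 ++ Q.take m.1) (ofPoint 12 m.2.1 m.2.2)

/-- The bound for form `i + m` that follows from the bound `c` for form `i` and the bounds of `Q`
on the same side. -/
def clipLeft (Q : Poly) (i : ℕ) (c : Surd) (m : ℕ) : Surd :=
  (List.range' 1 (5 - m)).foldl (fun acc b =>
    match Surd.divSin (m + b) ((c.mulSin b).add ((Q.get (i + m + b)).mulSin m)) with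
    | some v => Surd.min v acc
    | none => acc) (Q.get (i + m))

def clipRight (Q : Poly) (i : ℕ) (c : Surd) (m : ℕ) : Surd :=
  (List.range' 1 (5 - m)).foldl (fun acc b =>
    match Surd.divSin (m + b) ((c.mulSin b).add ((Q.get (i + (24 - (m + b)))).mulSin m)) with
    | some v => Surd.min v acc
    | none => acc) (Q.get (i + (12 - m)))

/-- The intersection with the half-plane `form i < c`. -/
def clip (i : ℕ) (c : Surd) (Q : Poly) : Poly :=
  (List.range 12).map fun k =>
    let m := (k + 12 - i % 12) % 12
    if m = 0 then Surd.min c (Q.get k)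
    else if m < 6 then clipLeft Q i c m
    else if m = 6 then Q.get k
    else clipRight Q i c (12 - m)

def sub (Q K : Poly) : Bool := (List.zipWith Surd.le Q K).all id

def scale (Q : Poly) : Poly := Q.map Surd.scale

end Poly

namespace Move

/-- The motion `m` followed by the motion `l`. -/
def comp (l m : Move) : Move :=
  let t := Poly.ofPoint 13 m.2.1 m.2.2
  ((l.1 + m.1) % 12, (t.getD l.1 (0, 0)).add l.2.1, (t.getD (l.1 + 1) (0, 0)).add l.2.2)

def force {β : Type} (m : Move) (k : Move → β) : β :=
  Surd.force.forceNat m.1 fun r => m.2.1.force fun a => m.2.2.force fun b => k (r, a, b)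

end Move

/-- A binary tree of half-planes with labelled leaves. -/
inductive Tree
  | leaf (k : ℕ) : Tree
  | node (i : ℕ) (c : Surd) (l r : Tree) : Tree

namespace Tree

/-- Checks a property of the parts into which the tree cuts a polygon. -/
def all (f : ℕ → Poly → Bool) : Tree → Poly → Bool
  | leaf k, Q => f k Q
  | node i c l r, Q =>
    bif (Q.get i).le c then l.all f Q
    else bif c.le (Q.get (i + 6)).neg then r.all f Q
    else (Q.clip i c).force (fun P => l.all f P) && (Q.clip (i + 6) c.neg).force fun P => r.all f P

/-- The leaf that contains the polygon. -/
def locate : Tree → Poly → Option ℕ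
  | leaf k, _ => some k
  | node i c l r, Q =>
    bif (Q.get i).le c then l.locate Q
    else bif c.le (Q.get (i + 6)).neg then r.locate Q
    else none

end Tree

def moveAt (maps : List Move) (k : ℕ) : Move := maps.getD k (0, (0, 0), (0, 0))

/-- Every generic point of `Q` reaches one of the polygons in `goal` or a leaf accepted by
`halt`. The goals are labelled with the leaves that contain them. -/
def explore (T : Tree) (maps : List Move) (halt : ℕ → Bool) (goal : List (ℕ × Poly)) :
    ℕ → Poly → Bool
  | 0, _ => false
  | n + 1, Q => T.all (fun k P => halt k || (goal.any fun g => Nat.beq g.1 k && P.sub g.2) ||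
      (P.move (moveAt maps k)).force fun P => explore T maps halt goal n P) Q

/-- Explores the polygons of a list, each of which may then serve as a goal for the next ones. -/
def exploreAll (T : Tree) (maps : List Move) (halt : ℕ → Bool) (fuel : ℕ) :
    List (ℕ × Poly) → List (ℕ × Poly) → Bool
  | _, [] => true
  | goal, Q :: Qs => explore T maps halt goal fuel Q.2 &&
      exploreAll T maps halt fuel (Q :: goal) Qs

/-- Follows the undivided polygon `Q` until `halt`; returns the word and the composed motion. -/
def trace (T : Tree) (maps : List Move) (out halt : Move → Poly → Bool) :
    ℕ → Move → Poly → Option (List ℕ × Move × Poly)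
  | 0, _, _ => none
  | n + 1, m, Q =>
    match T.locate Q with
    | none => none
    | some k => ((moveAt maps k).comp m).force fun l => (Q.move (moveAt maps k)).force fun P =>
        bif halt l P then some ([k], l, P)
        else bif out l P then
          match trace T maps out halt n l P with
          | none => none
          | some (w, p) => some (k :: w, p)
        else none

/-- Every `s`-th polygon on the way of `Q`, the last one first. -/
def waypoints (T : Tree) (maps : List Move) (s : ℕ) : ℕ → ℕ → Poly → List (ℕ × Poly)
  | 0, _, _ => []
  | n + 1, j, Q =>
    match T.locate Q with
    | none => []
    | some k => (Q.move (moveAt maps k)).force fun P =>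
        match j with
        | 0 => waypoints T maps s n s P ++ [(k, Q)]
        | j + 1 => waypoints T maps s n j P

/-! ### Soundness of the arithmetic and of the operations on polygons -/

/-- Points of the plane, given by the values of the forms number 0 and 1. -/
abbrev Pt := ℝ × ℝ

namespace Surd

noncomputable def val (x : Surd) : ℝ := (x.1 + x.2 * √3) / 36

theorem sqrt3_sq : √3 * √3 = 3 := Real.mul_self_sqrt (by norm_num)

theorem nonpos_sound {a b : ℤ} (h : nonpos a b = true) : (a : ℝ) + b * √3 ≤ 0 := by
  have hs : 0 ≤ √3 := Real.sqrt_nonneg 3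
  have h3 := sqrt3_sq
  match a, b with
  | .ofNat a, .ofNat b =>
    have h' : a + b = 0 := Nat.eq_of_beq_eq_true h
    obtain ⟨rfl, rfl⟩ : a = 0 ∧ b = 0 := by omega
    simp
  | .ofNat a, .negSucc b =>
    have h' : a * a ≤ 3 * ((b + 1) * (b + 1)) := Nat.le_of_ble_eq_true h
    have h2 : (a : ℝ) * a ≤ 3 * ((b + 1) * (b + 1)) := by exact_mod_cast h'
    have h4 : (a : ℝ) ≤ (b + 1) * √3 := by
      apply le_of_sq_le_sq _ (by positivity)
      nlinarith
    simp only [Int.ofNat_eq_natCast, Int.cast_natCast, Int.cast_negSucc]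
    push_cast
    linarith
  | .negSucc a, .ofNat b =>
    have h' : 3 * (b * b) ≤ (a + 1) * (a + 1) := Nat.le_of_ble_eq_true h
    have h2 : 3 * ((b : ℝ) * b) ≤ (a + 1) * (a + 1) := by exact_mod_cast h'
    have h4 : (b : ℝ) * √3 ≤ a + 1 := by
      apply le_of_sq_le_sq _ (by positivity)
      nlinarith
    simp only [Int.ofNat_eq_natCast, Int.cast_natCast, Int.cast_negSucc]
    push_cast
    linarith
  | .negSucc a, .negSucc b =>
    simp only [Int.cast_negSucc]
    push_cast
    nlinarith [Nat.cast_nonneg (α := ℝ) a, Nat.cast_nonneg (α := ℝ) b,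
      mul_nonneg (Nat.cast_nonneg (α := ℝ) b) hs]
where
  le_of_sq_le_sq {x y : ℝ} (h : x * x ≤ y * y) (hy : 0 ≤ y) : x ≤ y :=
    abs_le_of_sq_le_sq' (by nlinarith) hy |>.2

theorem val_le {x y : Surd} (h : le x y = true) : val x ≤ val y := by
  have := nonpos_sound h
  push_cast at this
  simp only [val]
  linarith

@[simp] theorem val_add (x y : Surd) : val (add x y) = val x + val y := by
  simp only [val, add]; push_cast; ring

@[simp] theorem val_neg (x : Surd) : val (neg x) = -val x := by
  simp only [val, neg]; push_cast; ring

theorem val_mul_sqrt3 (x : Surd) : val (3 * x.2, x.1) = √3 * val x := by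
  have := sqrt3_sq
  simp only [val]; push_cast; linear_combination (-(x.2 : ℝ) / 36) * this

theorem val_scale (x : Surd) : val (scale x) = (7 - 4 * √3) * val x := by
  have := sqrt3_sq
  simp only [val, scale]; push_cast; linear_combination ((x.2 : ℝ) / 9) * this

theorem lt_val_min {x y : Surd} {t : ℝ} (hx : t < val x) (hy : t < val y) :
    t < val (min x y) := by
  unfold min
  cases le x y <;> assumption

/-- `2 sin (30° n)`. -/
noncomputable def sinWeight : ℕ → ℝ
  | 1 | 5 => 1
  | 2 | 4 => √3
  | 3 => 2
  | _ => 0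

theorem val_mulSin (n : ℕ) (x : Surd) : val (mulSin n x) = sinWeight n * val x := by
  unfold mulSin sinWeight
  split
  · simp
  · simp
  · exact val_mul_sqrt3 x
  · exact val_mul_sqrt3 x
  · simp only [val]; push_cast; ring
  · simp [val]

theorem val_divSin {n : ℕ} {x v : Surd} (h : divSin n x = some v) :
    val x = sinWeight n * val v := by
  unfold divSin at h
  unfold sinWeight
  split at h
  · simp_all
  · simp_all
  · cases hb : x.1 % 3 == 0 <;> simp [hb] at h
    subst h
    change x.val = √3 * val (x.2, x.1 / 3)
    rw [← val_mul_sqrt3]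
    have : 3 * (x.1 / 3) = x.1 := Int.mul_ediv_cancel' (Int.dvd_of_emod_eq_zero (by simpa using hb))
    simp [this]
  · cases hb : x.1 % 3 == 0 <;> simp [hb] at h
    subst h
    change x.val = √3 * val (x.2, x.1 / 3)
    rw [← val_mul_sqrt3]
    have : 3 * (x.1 / 3) = x.1 := Int.mul_ediv_cancel' (Int.dvd_of_emod_eq_zero (by simpa using hb))
    simp [this]
  · cases hb : (x.1 % 2 == 0 && x.2 % 2 == 0) <;> (rw [hb] at h; simp at h)
    simp only [Bool.and_eq_true, beq_iff_eq] at hb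
    subst h
    have h1 : 2 * (x.1 / 2) = x.1 := Int.mul_ediv_cancel' (Int.dvd_of_emod_eq_zero hb.1)
    have h2 : 2 * (x.2 / 2) = x.2 := Int.mul_ediv_cancel' (Int.dvd_of_emod_eq_zero hb.2)
    have h1' : 2 * ((x.1 / 2 : ℤ) : ℝ) = x.1 := by exact_mod_cast h1
    have h2' : 2 * ((x.2 / 2 : ℤ) : ℝ) = x.2 := by exact_mod_cast h2
    simp only [val]
    linear_combination (-1 / 36) * h1' - (√3 / 36) * h2'
  · simp at h

theorem sinWeight_pos {n : ℕ} (h1 : 1 ≤ n) (h2 : n ≤ 5) : 0 < sinWeight n := by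
  have : 0 < √3 := by positivity
  interval_cases n <;> simp [sinWeight, this]

@[simp] theorem force.forceNat_eq {β : Type} (n : ℕ) (k : ℕ → β) : forceNat n k = k n := by
  cases n <;> rfl

@[simp] theorem force.forceInt_eq {β : Type} (n : ℤ) (k : ℤ → β) : forceInt n k = k n := by
  cases n <;> simp [forceInt]

@[simp] theorem force_eq {β : Type} (x : Surd) (k : Surd → β) : force x k = k x := by
  simp [force]

end Surd

@[simp] theorem Poly.force_eq {β : Type} (Q : Poly) (k : Poly → β) : Poly.force Q k = k Q := by
  induction Q generalizing k with
  | nil => rfl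
  | cons q Q ih => simp [Poly.force, ih]

@[simp] theorem Move.force_eq {β : Type} (m : Move) (k : Move → β) : Move.force m k = k m := by
  simp [Move.force]

/-- The rotation by `-30°`. -/
noncomputable def turn (x : Pt) : Pt := (x.2, √3 * x.2 - x.1)

/-- The twelve linear forms whose gradients are normal to the sides of the dodecagon. -/
noncomputable def form (i : ℕ) (x : Pt) : ℝ := (turn^[i] x).1

theorem turn_add (x y : Pt) : turn (x + y) = turn x + turn y := by
  ext <;> simp [turn]; ring

theorem turn_smul (c : ℝ) (x : Pt) : turn (c • x) = c • turn x := by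
  ext <;> simp [turn]; ring

theorem turn_iterate_add (n : ℕ) (x y : Pt) : turn^[n] (x + y) = turn^[n] x + turn^[n] y := by
  induction n generalizing x y with
  | zero => rfl
  | succ n ih => simp [Function.iterate_succ_apply, turn_add, ih]

theorem turn_iterate_smul (n : ℕ) (c : ℝ) (x : Pt) : turn^[n] (c • x) = c • turn^[n] x := by
  induction n generalizing x with
  | zero => rfl
  | succ n ih => simp [Function.iterate_succ_apply, turn_smul, ih]

theorem turn_six (x : Pt) : turn^[6] x = -x := by
  have := Surd.sqrt3_sq
  ext
  · simp only [Function.iterate_succ_apply, Function.iterate_zero_apply, turn, Prod.fst_neg]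
    linear_combination (√3 * x.2 * (√3 * √3 - 1) - x.1 * √3 * √3) * this
  · simp only [Function.iterate_succ_apply, Function.iterate_zero_apply, turn, Prod.snd_neg]
    linear_combination (-√3 * x.1 * (√3 * √3 - 1) + x.2 * (√3 * √3 * √3 * √3 - 2 * √3 * √3)) * this

theorem turn_twelve (x : Pt) : turn^[12] x = x := by
  rw [show 12 = 6 + 6 from rfl, Function.iterate_add_apply, turn_six, turn_six, neg_neg]

theorem turn_iterate_mod (n : ℕ) (x : Pt) : turn^[n % 12] x = turn^[n] x := by
  conv_rhs => rw [← Nat.mod_add_div n 12, Function.iterate_add_apply, Function.iterate_mul]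
  congr 1
  have : turn^[12] = id := funext turn_twelve
  rw [this, Function.iterate_id, id]

theorem form_mod (i : ℕ) (x : Pt) : form (i % 12) x = form i x := by
  simp only [form, turn_iterate_mod]

theorem form_add_six (i : ℕ) (x : Pt) : form (i + 6) x = -form i x := by
  simp only [form, add_comm i 6, Function.iterate_add_apply, turn_six, Prod.fst_neg]

theorem form_add_two (i : ℕ) (x : Pt) : form (i + 2) x = √3 * form (i + 1) x - form i x := by
  simp only [form, Function.iterate_succ_apply', turn]

theorem form_add (i : ℕ) (x y : Pt) : form i (x + y) = form i x + form i y := by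
  simp only [form, turn_iterate_add, Prod.fst_add]

theorem form_smul (i : ℕ) (c : ℝ) (x : Pt) : form i (c • x) = c * form i x := by
  simp only [form, turn_iterate_smul, Prod.smul_fst, smul_eq_mul]

theorem form_turn (i n : ℕ) (x : Pt) : form i (turn^[n] x) = form (i + n) x := by
  simp only [form, Function.iterate_add_apply]

theorem form_zero (x : Pt) : form 0 x = x.1 := rfl

/-- The linear relation between three unit normals at angles 0, 30°m and 30°(m + b), with sines as
coefficients. All coefficients are positive, so bounds for the two outer forms bound the middle one.
-/
theorem form_sin {m b : ℕ} (hm : 1 ≤ m) (hb : 1 ≤ b) (h : m + b ≤ 5) (i : ℕ) (x : Pt) :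
    Surd.sinWeight (m + b) * form (i + m) x =
      Surd.sinWeight b * form i x + Surd.sinWeight m * form (i + m + b) x := by
  have h3 := Surd.sqrt3_sq
  have e2 := form_add_two i x
  have e3 := form_add_two (i + 1) x
  have e4 := form_add_two (i + 2) x
  have e5 := form_add_two (i + 3) x
  simp only [add_assoc, Nat.reduceAdd] at e2 e3 e4 e5
  have e3' : form (i + 3) x = 2 * form (i + 1) x - √3 * form i x := by
    rw [e3, e2]; linear_combination form (i + 1) x * h3
  have e4' : form (i + 4) x = √3 * form (i + 1) x - 2 * form i x := by
    rw [e4, e3', e2]; linear_combination - form i x * h3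
  have e5' : form (i + 5) x = form (i + 1) x - √3 * form i x := by
    rw [e5, e4', e3']; linear_combination form (i + 1) x * h3
  have hm' : m ≤ 4 := by omega
  have hb' : b ≤ 4 := by omega
  interval_cases m <;> interval_cases b <;> first | omega | skip
  all_goals
    simp only [Surd.sinWeight, add_assoc, Nat.reduceAdd]
    try rw [e5']
    try rw [e4']
    try rw [e3']
    try rw [e2]
  all_goals
    first
    | ring1
    | linear_combination form i x * h3
    | linear_combination - form i x * h3

namespace Poly

/-- The point lies in the open polygon. -/
def Mem (x : Pt) (Q : Poly) : Prop :=
  Q.length = 12 ∧ ∀ i < 12, form i x < (Q.getD i (0, 0)).val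

theorem Mem.lt {x : Pt} {Q : Poly} (h : Mem x Q) (i : ℕ) : form i x < (Q.get i).val := by
  rw [← form_mod]
  exact h.2 _ (Nat.mod_lt _ (by norm_num))

theorem lt_foldl {f : ℕ → Option Surd} {t : ℝ} (l : List ℕ) (init : Surd) (h0 : t < init.val)
    (h : ∀ b ∈ l, ∀ v, f b = some v → t < v.val) :
    t < (l.foldl (fun acc b => match f b with
      | some v => Surd.min v acc
      | none => acc) init).val := by
  induction l generalizing init with
  | nil => exact h0
  | cons b l ih =>
    refine ih _ ?_ fun b hb => h b (List.mem_cons_of_mem _ hb)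
    dsimp only
    split
    · next v hv => exact Surd.lt_val_min (h b (List.mem_cons_self) v hv) h0
    · exact h0

/-- An application of `form_sin`. Where the division is not exact, the old bound is kept; the
polygon is then only larger than necessary. -/
theorem Mem.clipLeft {x : Pt} {Q : Poly} (h : Mem x Q) {i : ℕ} {c : Surd} (hc : form i x < c.val)
    {m : ℕ} (hm : 1 ≤ m) : form (i + m) x < (clipLeft Q i c m).val := by
  refine lt_foldl _ _ (h.lt _) fun b hb v hv => ?_
  rw [List.mem_range'_1] at hb
  have h1 := form_sin hm hb.1 (by omega) i x
  have h2 := Surd.val_divSin hv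
  rw [Surd.val_add, Surd.val_mulSin, Surd.val_mulSin] at h2
  have hp := Surd.sinWeight_pos (n := m + b) (by omega) (by omega)
  have hpb := Surd.sinWeight_pos (n := b) (by omega) (by omega)
  have hpm := Surd.sinWeight_pos (n := m) (by omega) (by omega)
  have h3 := h.lt (i + m + b)
  refine lt_of_mul_lt_mul_left ?_ hp.le
  rw [h1, ← h2]
  exact add_lt_add (mul_lt_mul_of_pos_left hc hpb) (mul_lt_mul_of_pos_left h3 hpm)

theorem Mem.clipRight {x : Pt} {Q : Poly} (h : Mem x Q) {i : ℕ} {c : Surd} (hc : form i x < c.val)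
    {m : ℕ} (hm : 1 ≤ m) (hm5 : m ≤ 5) : form (i + (12 - m)) x < (clipRight Q i c m).val := by
  refine lt_foldl _ _ (h.lt _) fun b hb v hv => ?_
  rw [List.mem_range'_1] at hb
  have h1 := form_sin (m := b) (b := m) hb.1 hm (by omega) (i + (24 - (m + b))) x
  rw [show i + (24 - (m + b)) + b = i + (12 - m) + 12 * 1 by omega,
    show i + (12 - m) + 12 * 1 + m = i + 12 * 2 by omega,
    ← form_mod (i + (12 - m) + 12 * 1), Nat.add_mul_mod_self_left, form_mod,
    ← form_mod (i + 12 * 2), Nat.add_mul_mod_self_left, form_mod, add_comm b m] at h1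
  have h2 := Surd.val_divSin hv
  rw [Surd.val_add, Surd.val_mulSin, Surd.val_mulSin] at h2
  have hp := Surd.sinWeight_pos (n := m + b) (by omega) (by omega)
  have hpb := Surd.sinWeight_pos (n := b) (by omega) (by omega)
  have hpm := Surd.sinWeight_pos (n := m) (by omega) (by omega)
  have h3 := h.lt (i + (24 - (m + b)))
  refine lt_of_mul_lt_mul_left ?_ hp.le
  rw [h1, ← h2]
  have := mul_lt_mul_of_pos_left hc hpb
  have := mul_lt_mul_of_pos_left h3 hpm
  linarith

theorem Mem.clip {x : Pt} {Q : Poly} (h : Mem x Q) {i : ℕ} {c : Surd} (hc : form i x < c.val) :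
    Mem x (clip i c Q) := by
  refine ⟨by simp [Poly.clip], fun k hk => ?_⟩
  have hget : (Poly.clip i c Q).getD k (0, 0) =
      let m := (k + 12 - i % 12) % 12
      if m = 0 then Surd.min c (Q.get k)
      else if m < 6 then Poly.clipLeft Q i c m
      else if m = 6 then Q.get k
      else Poly.clipRight Q i c (12 - m) := by
    simp [Poly.clip, List.getD_eq_getElem?_getD, hk]
  rw [hget]
  have hm : (i + (k + 12 - i % 12) % 12) % 12 = k := by omega
  have hm12 := Nat.mod_lt (k + 12 - i % 12) (show 12 > 0 by norm_num)
  generalize (k + 12 - i % 12) % 12 = m at hm hm12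
  have hform : form k x = form (i + m) x := by rw [← hm, form_mod]
  dsimp only
  split_ifs with h0 h1 h2
  · refine Surd.lt_val_min ?_ (h.lt k)
    rwa [hform, h0, add_zero]
  · rw [hform]; exact h.clipLeft hc (by omega)
  · exact h.lt k
  · have := h.clipRight hc (m := 12 - m) (by omega) (by omega)
    rwa [show 12 - (12 - m) = m by omega, ← hform] at this

end Poly

namespace Surd

theorem val_injective : Function.Injective val := by
  intro x y h
  have hirr : Irrational √3 := by
    have := Nat.Prime.irrational_sqrt (p := 3) (by norm_num)
    exact_mod_cast this
  have h1 : ((x.1 - y.1 : ℤ) : ℝ) = ((y.2 - x.2 : ℤ) : ℝ) * √3 := by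
    simp only [val] at h
    push_cast
    linarith
  have h2 : y.2 - x.2 = 0 := by
    by_contra hne
    exact (hirr.intCast_mul hne) ⟨((x.1 - y.1 : ℤ) : ℚ), by rw [← h1]; push_cast; rfl⟩
  rw [h2] at h1
  have h3 : x.1 - y.1 = 0 := by
    have : ((x.1 - y.1 : ℤ) : ℝ) = 0 := by rw [h1]; simp
    exact_mod_cast this
  exact Prod.ext (by omega) (by omega)

end Surd

namespace Poly

theorem length_ofPoint (n : ℕ) (a b : Surd) : (ofPoint n a b).length = n := by
  induction n generalizing a b with
  | zero => rfl
  | succ n ih => simp [ofPoint, ih]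

theorem val_ofPoint {n i : ℕ} (h : i < n) (a b : Surd) :
    ((ofPoint n a b).getD i (0, 0)).val = form i (a.val, b.val) := by
  induction n generalizing a b i with
  | zero => omega
  | succ n ih =>
    cases i with
    | zero => simp [ofPoint, form]
    | succ i =>
      have h1 : Surd.val (3 * b.2 - a.1, b.1 - a.2) = √3 * b.val - a.val := by
        rw [← Surd.val_mul_sqrt3]
        simp only [Surd.val]
        push_cast
        ring
      rw [ofPoint, List.getD_cons_succ, ih (by omega), h1]
      simp only [form, Function.iterate_succ_apply, turn]

end Poly

namespace Move

noncomputable def act (m : Move) (x : Pt) : Pt := turn^[m.1] x + (m.2.1.val, m.2.2.val)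

theorem form_act (m : Move) (i : ℕ) (x : Pt) :
    form i (m.act x) = form (i + m.1) x + form i (m.2.1.val, m.2.2.val) := by
  rw [act, form_add, form_turn]

theorem act_comp {l : Move} (hl : l.1 < 12) (m : Move) (x : Pt) :
    (comp l m).act x = l.act (m.act x) := by
  have h1 := Poly.val_ofPoint (n := 13) (i := l.1) (by omega) m.2.1 m.2.2
  have h2 := Poly.val_ofPoint (n := 13) (i := l.1 + 1) (by omega) m.2.1 m.2.2
  have h3 : turn^[l.1] (m.2.1.val, m.2.2.val) =
      (form l.1 (m.2.1.val, m.2.2.val), form (l.1 + 1) (m.2.1.val, m.2.2.val)) := by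
    ext
    · rfl
    · simp only [form, Function.iterate_succ_apply', turn]
  simp only [act, comp, turn_iterate_mod, turn_iterate_add, Surd.val_add, h1, h2, h3,
    Function.iterate_add_apply, add_assoc, Prod.mk_add_mk]

theorem act_injective (m : Move) : Function.Injective m.act := by
  intro x y h
  have h1 : turn^[m.1] x = turn^[m.1] y := add_right_cancel h
  have h2 := congrArg (turn^[11 * m.1]) h1
  rwa [← Function.iterate_add_apply, ← Function.iterate_add_apply,
    ← turn_iterate_mod (11 * m.1 + m.1), ← turn_iterate_mod (11 * m.1 + m.1),
    show (11 * m.1 + m.1) % 12 = 0 by omega] at h2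

end Move

theorem Poly.Mem.move {x : Pt} {Q : Poly} (h : Mem x Q) {m : Move} (hm : m.1 < 12) :
    Mem (m.act x) (Q.move m) := by
  have hl : (Q.drop m.1 ++ Q.take m.1).length = 12 := by simp [h.1]; omega
  refine ⟨by simp [Poly.move, length_ofPoint, h.1]; omega, fun i hi => ?_⟩
  have h1 : (Q.drop m.1 ++ Q.take m.1).getD i (0, 0) = Q.get (i + m.1) := by
    by_cases hi' : i < 12 - m.1
    · rw [List.getD_append _ _ _ _ (by simp [h.1]; omega), Poly.get,
        Nat.mod_eq_of_lt (by omega)]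
      simp [List.getD_eq_getElem?_getD, add_comm]
    · rw [List.getD_append_right _ _ _ _ (by simp [h.1]; omega), Poly.get,
        Nat.mod_eq_sub_mod (by omega), Nat.mod_eq_of_lt (by omega)]
      simp only [List.length_drop, h.1, List.getD_eq_getElem?_getD]
      rw [List.getElem?_take_of_lt (by omega), show i - (12 - m.1) = i + m.1 - 12 by omega]
  have h2 : (Q.move m).getD i (0, 0) =
      ((Q.drop m.1 ++ Q.take m.1).getD i (0, 0)).add ((ofPoint 12 m.2.1 m.2.2).getD i (0, 0)) := by
    have hlo := length_ofPoint 12 m.2.1 m.2.2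
    simp only [List.getD_eq_getElem?_getD]
    rw [List.getElem?_eq_getElem (by simp [Poly.move, hlo, h.1]; omega),
      List.getElem?_eq_getElem (by omega), List.getElem?_eq_getElem (by omega)]
    simp [Poly.move]
  rw [h2, h1, Surd.val_add, Poly.val_ofPoint hi, Move.form_act]
  have := h.lt (i + m.1)
  linarith

theorem Poly.Mem.of_sub {x : Pt} {Q K : Poly} (h : Mem x Q) (hs : Q.sub K = true)
    (hK : K.length = 12) : Mem x K := by
  refine ⟨hK, fun i hi => (h.2 i hi).trans_le ?_⟩
  have hQ := h.1
  rw [Poly.sub, List.all_eq_true] at hs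
  have h1 := hs (Surd.le (Q.getD i (0, 0)) (K.getD i (0, 0))) (by
    rw [List.mem_iff_getElem]
    refine ⟨i, by simp [hQ, hK, hi], ?_⟩
    simp only [List.getElem_zipWith, List.getD_eq_getElem?_getD]
    rw [List.getElem?_eq_getElem (by omega), List.getElem?_eq_getElem (by omega)]
    rfl)
  exact Surd.val_le h1

theorem Surd.scale_pos : 0 < 7 - 4 * √3 := by
  have h3 := Surd.sqrt3_sq
  have hs : 0 ≤ √3 := Real.sqrt_nonneg 3
  nlinarith

theorem Poly.Mem.scale {x : Pt} {Q : Poly} (h : Mem x Q) :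
    Mem ((7 - 4 * √3) • x) Q.scale := by
  refine ⟨by simp [Poly.scale, h.1], fun i hi => ?_⟩
  have hQ := h.1
  have h1 : Q.scale.getD i (0, 0) = (Q.getD i (0, 0)).scale := by
    simp only [List.getD_eq_getElem?_getD, Poly.scale, List.getElem?_map]
    rw [List.getElem?_eq_getElem (by omega)]
    rfl
  rw [h1, Surd.val_scale, form_smul]
  exact mul_lt_mul_of_pos_left (h.2 i hi) Surd.scale_pos

/-! ### Generic points, decision trees and piecewise motions -/

/-- The point lies on no line in one of the twelve directions that is defined over `ℚ(√3)`. -/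
def Generic (x : Pt) : Prop := ∀ (i : ℕ) (q r : ℚ), form i x ≠ q + r * √3

theorem Surd.exists_rat (x : Surd) : ∃ q r : ℚ, x.val = q + r * √3 :=
  ⟨x.1 / 36, x.2 / 36, by rw [Surd.val]; push_cast; ring⟩

theorem Generic.ne_val {x : Pt} (h : Generic x) (i : ℕ) (c : Surd) : form i x ≠ c.val := by
  obtain ⟨q, r, hc⟩ := c.exists_rat
  rw [hc]
  exact h i q r

theorem form_rat (i : ℕ) (a b : Surd) : ∃ q r : ℚ, form i (a.val, b.val) = q + r * √3 := by
  rw [← Poly.val_ofPoint (Nat.lt_succ_self i)]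
  exact Surd.exists_rat _

theorem Generic.act {x : Pt} (h : Generic x) (m : Move) : Generic (m.act x) := by
  intro i q r he
  obtain ⟨q', r', h1⟩ := form_rat i m.2.1 m.2.2
  rw [Move.form_act, h1] at he
  refine h (i + m.1) (q - q') (r - r') ?_
  push_cast
  linarith

theorem generic_of_smul {x : Pt} (h : Generic ((7 - 4 * √3) • x)) : Generic x := by
  intro i q r he
  refine h i (7 * q - 12 * r) (7 * r - 4 * q) ?_
  rw [form_smul, he]
  push_cast
  linear_combination (-4 * r : ℝ) * Surd.sqrt3_sq

namespace Tree

/-- The point lies strictly inside the cell of the leaf `k`. -/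
def At : Tree → Pt → ℕ → Prop
  | leaf l, _, k => l = k
  | node i c l r, x, k => (form i x < c.val ∧ l.At x k) ∨ (c.val < form i x ∧ r.At x k)

theorem At.unique {T : Tree} {x : Pt} {k l : ℕ} (h : T.At x k) (h' : T.At x l) : k = l := by
  induction T with
  | leaf n => exact h.symm.trans h'
  | node i c a b iha ihb =>
    rcases h with ⟨h1, h2⟩ | ⟨h1, h2⟩ <;> rcases h' with ⟨h3, h4⟩ | ⟨h3, h4⟩
    · exact iha h2 h4
    · exact absurd h1 h3.not_gt
    · exact absurd h1 h3.not_gt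
    · exact ihb h2 h4

theorem exists_at (T : Tree) {x : Pt} (h : Generic x) : ∃ k, T.At x k := by
  induction T with
  | leaf n => exact ⟨n, rfl⟩
  | node i c a b iha ihb =>
    rcases lt_or_gt_of_ne (h.ne_val i c) with h1 | h1
    · obtain ⟨k, hk⟩ := iha
      exact ⟨k, Or.inl ⟨h1, hk⟩⟩
    · obtain ⟨k, hk⟩ := ihb
      exact ⟨k, Or.inr ⟨h1, hk⟩⟩

theorem not_lt_of_le {x : Pt} {Q : Poly} (h : Q.Mem x) {i : ℕ} {c : Surd}
    (hc : c.le (Q.get (i + 6)).neg = true) : c.val < form i x := by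
  have h1 := Surd.val_le hc
  have h2 := h.lt (i + 6)
  rw [form_add_six] at h2
  rw [Surd.val_neg] at h1
  linarith

theorem all_sound {f : ℕ → Poly → Bool} {T : Tree} {Q : Poly} (h : T.all f Q = true) {x : Pt}
    (hx : Q.Mem x) {k : ℕ} (hk : T.At x k) : ∃ P : Poly, P.Mem x ∧ f k P = true := by
  induction T generalizing Q with
  | leaf n => exact ⟨Q, hx, by rw [← (show n = k from hk)]; exact h⟩
  | node i c a b iha ihb =>
    rw [all] at h
    cases h1 : (Q.get i).le c
    · rw [h1, cond_false] at h
      cases h2 : c.le (Q.get (i + 6)).neg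
      · simp only [h2, cond_false, Poly.force_eq, Bool.and_eq_true] at h
        rcases hk with ⟨h3, h4⟩ | ⟨h3, h4⟩
        · exact iha h.1 (hx.clip h3) h4
        · refine ihb h.2 (hx.clip ?_) h4
          rw [form_add_six, Surd.val_neg]
          linarith
      · rw [h2, cond_true] at h
        have h3 := not_lt_of_le hx h2
        rcases hk with ⟨h4, -⟩ | ⟨-, h4⟩
        · exact absurd h3 h4.not_gt
        · exact ihb h hx h4
    · rw [h1, cond_true] at h
      have h3 := (hx.lt i).trans_le (Surd.val_le h1)
      rcases hk with ⟨-, h4⟩ | ⟨h4, -⟩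
      · exact iha h hx h4
      · exact absurd h3 h4.not_gt

theorem locate_sound {T : Tree} {Q : Poly} {k : ℕ} (h : T.locate Q = some k) {x : Pt}
    (hx : Q.Mem x) : T.At x k := by
  induction T with
  | leaf n => exact Option.some.inj h
  | node i c a b iha ihb =>
    rw [locate] at h
    cases h1 : (Q.get i).le c
    · rw [h1, cond_false] at h
      cases h2 : c.le (Q.get (i + 6)).neg
      · rw [h2, cond_false] at h
        exact absurd h (by simp)
      · rw [h2, cond_true] at h
        exact Or.inr ⟨not_lt_of_le hx h2, ihb h⟩
    · rw [h1, cond_true] at h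
      exact Or.inl ⟨(hx.lt i).trans_le (Surd.val_le h1), iha h⟩

end Tree

/-- The piecewise motion on `D` whose pieces are the cells of a tree. -/
noncomputable def treeMap (T : Tree) (maps : List Move) (D : Set Pt) : PMap Pt where
  At x k := x ∈ D ∧ T.At x k
  step k := (moveAt maps k).act

theorem treeMap_det (T : Tree) (maps : List Move) (D : Set Pt) : (treeMap T maps D).Det :=
  fun _ _ _ h h' => h.2.unique h'.2

theorem treeMap_generic {T : Tree} {maps : List Move} {D : Set Pt} {x y : Pt} {w : List ℕ}
    (hx : Generic x) (h : (treeMap T maps D).Run x w y) : Generic y := by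
  induction w generalizing x with
  | nil => exact PMap.run_nil.1 h ▸ hx
  | cons k w ih => exact ih (hx.act _) h.2

theorem moveAt_lt {maps : List Move} (hm : ∀ m ∈ maps, m.1 < 12) (k : ℕ) :
    (moveAt maps k).1 < 12 := by
  rw [moveAt, List.getD_eq_getElem?_getD]
  by_cases hk : k < maps.length
  · rw [List.getElem?_eq_getElem hk]
    exact hm _ (List.getElem_mem hk)
  · rw [List.getElem?_eq_none (by omega)]
    norm_num

theorem explore_sound {T : Tree} {maps : List Move} {D : Set Pt} (hm : ∀ m ∈ maps, m.1 < 12)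
    (hD : ∀ x k, x ∈ D → T.At x k → (moveAt maps k).act x ∈ D)
    {halt : ℕ → Bool} {goal : List (ℕ × Poly)} {P : Pt → Prop}
    (hhalt : ∀ x k, x ∈ D → Generic x → T.At x k → halt k = true → P x)
    (hgoal : ∀ g ∈ goal, ∀ x, x ∈ D → Generic x → g.2.Mem x →
      ∃ w y, (treeMap T maps D).Run x w y ∧ P y)
    (hlen : ∀ g ∈ goal, g.2.length = 12)
    {n : ℕ} {Q : Poly} (h : explore T maps halt goal n Q = true) :
    ∀ x, x ∈ D → Generic x → Q.Mem x → ∃ w y, (treeMap T maps D).Run x w y ∧ P y := by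
  induction n generalizing Q with
  | zero => exact absurd h (by simp [explore])
  | succ n ih =>
    intro x hxD hx hxQ
    obtain ⟨k, hk⟩ := T.exists_at hx
    obtain ⟨R, hR, hf⟩ := Tree.all_sound h hxQ hk
    simp only [Bool.or_eq_true, Poly.force_eq] at hf
    rcases hf with (h1 | h1) | h1
    · exact ⟨[], x, rfl, hhalt x k hxD hx hk h1⟩
    · rw [List.any_eq_true] at h1
      obtain ⟨g, hg, h2⟩ := h1
      rw [Bool.and_eq_true] at h2
      exact hgoal g hg x hxD hx (hR.of_sub h2.2 (hlen g hg))
    · obtain ⟨w, y, hr, hy⟩ := ih h1 _ (hD x k hxD hk) (hx.act _) (hR.move (moveAt_lt hm k))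
      exact ⟨k :: w, y, ⟨⟨hxD, hk⟩, hr⟩, hy⟩

theorem exploreAll_sound {T : Tree} {maps : List Move} {D : Set Pt} (hm : ∀ m ∈ maps, m.1 < 12)
    (hD : ∀ x k, x ∈ D → T.At x k → (moveAt maps k).act x ∈ D)
    {halt : ℕ → Bool} {goal Qs : List (ℕ × Poly)} {P : Pt → Prop}
    (hhalt : ∀ x k, x ∈ D → Generic x → T.At x k → halt k = true → P x)
    (hgoal : ∀ g ∈ goal, ∀ x, x ∈ D → Generic x → g.2.Mem x →
      ∃ w y, (treeMap T maps D).Run x w y ∧ P y)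
    (hlen : ∀ g ∈ goal, g.2.length = 12) (hlen' : ∀ g ∈ Qs, g.2.length = 12)
    {n : ℕ} (h : exploreAll T maps halt n goal Qs = true) :
    ∀ g ∈ Qs, ∀ x, x ∈ D → Generic x → g.2.Mem x →
      ∃ w y, (treeMap T maps D).Run x w y ∧ P y := by
  induction Qs generalizing goal with
  | nil => simp
  | cons Q Qs ih =>
    rw [exploreAll, Bool.and_eq_true] at h
    have h1 := explore_sound hm hD hhalt hgoal hlen h.1
    have h2 := ih (goal := Q :: goal)
      (by
        intro g hg
        rcases List.mem_cons.1 hg with rfl | hg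
        · exact h1
        · exact hgoal g hg)
      (by
        intro g hg
        rcases List.mem_cons.1 hg with rfl | hg
        · exact hlen' _ List.mem_cons_self
        · exact hlen g hg)
      (fun g hg => hlen' g (List.mem_cons_of_mem _ hg)) h.2
    intro g hg
    rcases List.mem_cons.1 hg with rfl | hg
    · exact h1
    · exact h2 g hg

/-- The polygon is never cut, so all its points share one word and one motion. Writing the moving
point as `m.act x` with x fixed lets the accumulated motion serve all of them at once. -/
theorem trace_sound {T : Tree} {maps : List Move} (hm : ∀ m ∈ maps, m.1 < 12)
    {out halt : Move → Poly → Bool} {n : ℕ} {m m' : Move} {Q Q' : Poly} {w : List ℕ}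
    (h : trace T maps out halt n m Q = some (w, m', Q')) :
    halt m' Q' = true ∧ w ≠ [] ∧ ∀ x, Q.Mem (m.act x) →
      Q'.Mem (m'.act x) ∧ (treeMap T maps Set.univ).Run (m.act x) w (m'.act x) ∧
      ∀ u v y, w = u ++ v → u ≠ [] → v ≠ [] → (treeMap T maps Set.univ).Run (m.act x) u y →
        ∃ l P, y = l.act x ∧ P.Mem y ∧ out l P = true ∧ halt l P = false := by
  induction n generalizing m Q w with
  | zero => exact absurd h (by simp [trace])
  | succ n ih =>
    rw [trace] at h
    cases hloc : T.locate Q with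
    | none => rw [hloc] at h; exact absurd h (by simp)
    | some k =>
      rw [hloc] at h
      simp only [Move.force_eq, Poly.force_eq] at h
      have hlt := moveAt_lt hm k
      have hstep : ∀ x, Q.Mem (m.act x) →
          (Q.move (moveAt maps k)).Mem (((moveAt maps k).comp m).act x) := by
        intro x hx
        rw [Move.act_comp hlt]
        exact hx.move hlt
      cases hs : halt ((moveAt maps k).comp m) (Q.move (moveAt maps k))
      · rw [hs, cond_false] at h
        cases ho : out ((moveAt maps k).comp m) (Q.move (moveAt maps k))
        · rw [ho] at h; exact absurd h (by simp)
        · rw [ho, cond_true] at h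
          cases ht : trace T maps out halt n ((moveAt maps k).comp m) (Q.move (moveAt maps k)) with
          | none => rw [ht] at h; exact absurd h (by simp)
          | some p =>
            obtain ⟨w', p⟩ := p
            rw [ht] at h
            simp only [Option.some.injEq, Prod.mk.injEq] at h
            obtain ⟨rfl, rfl⟩ := h
            obtain ⟨h1, -, h3⟩ := ih ht
            refine ⟨h1, by simp, fun x hx => ?_⟩
            obtain ⟨h4, h5, h6⟩ := h3 x (hstep x hx)
            refine ⟨h4, ⟨⟨trivial, Tree.locate_sound hloc hx⟩, ?_⟩, ?_⟩
            · rw [Move.act_comp hlt] at h5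
              exact h5
            · intro u v y he hu hv hr
              cases u with
              | nil => exact absurd rfl hu
              | cons l u =>
                simp only [List.cons_append, List.cons.injEq] at he
                obtain ⟨rfl, he⟩ := he
                have hr' := hr.2
                by_cases hu0 : u = []
                · subst hu0
                  refine ⟨_, _, ?_, ?_, ho, hs⟩
                  · rw [Move.act_comp hlt]; exact hr'.symm
                  · have := hstep x hx
                    rw [Move.act_comp hlt] at this
                    rw [← PMap.run_nil.1 hr']
                    exact this
                · refine h6 u v y he hu0 hv ?_
                  rw [Move.act_comp hlt]
                  exact hr'
      · rw [hs, cond_true] at h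
        simp only [Option.some.injEq, Prod.mk.injEq] at h
        obtain ⟨rfl, rfl, rfl⟩ := h
        refine ⟨hs, by simp, fun x hx => ⟨hstep x hx, ⟨⟨trivial, Tree.locate_sound hloc hx⟩, ?_⟩, ?_⟩⟩
        · rw [Move.act_comp hlt]; rfl
        · intro u v y he hu hv hr
          rcases u with _ | ⟨l, _ | ⟨l', u⟩⟩
          · exact absurd rfl hu
          · simp only [List.cons_append, List.nil_append, List.cons.injEq] at he
            exact absurd he.2.symm hv
          · simp at he

/-! ### Domains bounded by half-planes, and certificates for first returns -/

/-- The conditions `form i x < c`, for the pairs `(i, c)` of a list. -/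
abbrev Dom := List (ℕ × Surd)

namespace Dom

def set (D : Dom) : Set Pt := {x | ∀ p ∈ D, form p.1 x < p.2.val}

def has (D : Dom) (Q : Poly) : Bool := D.all fun p => (Q.get p.1).le p.2

def misses (D : Dom) (Q : Poly) : Bool := D.any fun p => p.2.le (Q.get (p.1 + 6)).neg

/-- The bound `c` for form `i` follows from one or two of the bounds in `D`. -/
def implies (D : Dom) (i : ℕ) (c : Surd) : Bool :=
  D.any fun p =>
    (p.1 % 12 == i % 12 && p.2.le c) ||
    D.any fun q =>
      let m := (i + 12 - p.1 % 12) % 12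
      let b := (q.1 + 12 - i % 12) % 12
      Nat.ble 1 m && Nat.ble 1 b && Nat.ble (m + b) 5 &&
        ((p.2.mulSin b).add (q.2.mulSin m)).le (c.mulSin (m + b))

def bounds (D : Dom) (Q : Poly) : Bool :=
  Q.length == 12 && (List.range 12).all fun i => D.implies i (Q.get i)

theorem has_sound {D : Dom} {Q : Poly} (h : D.has Q = true) {x : Pt} (hx : Q.Mem x) :
    x ∈ D.set := by
  intro p hp
  rw [has, List.all_eq_true] at h
  exact (hx.lt _).trans_le (Surd.val_le (h p hp))

theorem misses_sound {D : Dom} {Q : Poly} (h : D.misses Q = true) {x : Pt} (hx : Q.Mem x) :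
    x ∉ D.set := by
  intro hD
  rw [misses, List.any_eq_true] at h
  obtain ⟨p, hp, h⟩ := h
  exact (hD p hp).not_gt (Tree.not_lt_of_le hx h)

theorem implies_sound {D : Dom} {i : ℕ} {c : Surd} (h : D.implies i c = true) {x : Pt}
    (hx : x ∈ D.set) : form i x < c.val := by
  rw [implies, List.any_eq_true] at h
  obtain ⟨p, hp, h⟩ := h
  rw [Bool.or_eq_true] at h
  rcases h with h | h
  · rw [Bool.and_eq_true, beq_iff_eq] at h
    rw [← form_mod, ← h.1, form_mod]
    exact (hx p hp).trans_le (Surd.val_le h.2)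
  · rw [List.any_eq_true] at h
    obtain ⟨q, hq, h⟩ := h
    simp only [Bool.and_eq_true] at h
    obtain ⟨⟨⟨hm, hb⟩, hmb⟩, h⟩ := h
    replace hm := Nat.le_of_ble_eq_true hm
    replace hb := Nat.le_of_ble_eq_true hb
    replace hmb := Nat.le_of_ble_eq_true hmb
    have e1 : (p.1 + (i + 12 - p.1 % 12) % 12) % 12 = i % 12 := by omega
    have e2 : (p.1 + (i + 12 - p.1 % 12) % 12 + (q.1 + 12 - i % 12) % 12) % 12 = q.1 % 12 := by
      omega
    generalize (i + 12 - p.1 % 12) % 12 = m at *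
    generalize (q.1 + 12 - i % 12) % 12 = b at *
    have h1 := form_sin hm hb hmb p.1 x
    rw [← form_mod (p.1 + m), e1, form_mod, ← form_mod (p.1 + m + b), e2, form_mod] at h1
    have h2 := Surd.val_le h
    rw [Surd.val_add, Surd.val_mulSin, Surd.val_mulSin, Surd.val_mulSin] at h2
    have hpp := Surd.sinWeight_pos (n := m + b) (by omega) hmb
    have hpb := Surd.sinWeight_pos (n := b) hb (by omega)
    have hpm := Surd.sinWeight_pos (n := m) hm (by omega)
    have := mul_lt_mul_of_pos_left (hx p hp) hpb
    have := mul_lt_mul_of_pos_left (hx q hq) hpm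
    exact lt_of_mul_lt_mul_left (by linarith) hpp.le

theorem bounds_sound {D : Dom} {Q : Poly} (h : D.bounds Q = true) {x : Pt} (hx : x ∈ D.set) :
    Q.Mem x := by
  rw [bounds, Bool.and_eq_true, beq_iff_eq, List.all_eq_true] at h
  refine ⟨h.1, fun i hi => ?_⟩
  have h1 := implies_sound (h.2 i (List.mem_range.2 hi)) hx
  rwa [Poly.get, Nat.mod_eq_of_lt hi] at h1

theorem mem_set_append {D E : Dom} {x : Pt} : x ∈ set (D ++ E) ↔ x ∈ D.set ∧ x ∈ E.set := by
  simp only [set, Set.mem_ofPred_eq, List.mem_append]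
  exact ⟨fun h => ⟨fun p hp => h p (Or.inl hp), fun p hp => h p (Or.inr hp)⟩,
    fun h p hp => hp.elim (h.1 p) (h.2 p)⟩

theorem mem_set_cons {D : Dom} {p : ℕ × Surd} {x : Pt} :
    x ∈ set (p :: D) ↔ form p.1 x < p.2.val ∧ x ∈ D.set := by
  simp [set]

theorem mem_set_nil {x : Pt} : x ∈ set [] := by simp [set]

end Dom

namespace Tree

/-- The leaves with the conditions that define their cells. -/
def paths : Tree → List (ℕ × Dom)
  | leaf k => [(k, [])]
  | node i c l r => l.paths.map (fun p => (p.1, (i, c) :: p.2)) ++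
      r.paths.map fun p => (p.1, (i + 6, c.neg) :: p.2)

theorem at_iff_paths {T : Tree} {x : Pt} {k : ℕ} :
    T.At x k ↔ ∃ E, (k, E) ∈ T.paths ∧ x ∈ Dom.set E := by
  induction T with
  | leaf l =>
    simp only [At, paths, List.mem_singleton, Prod.mk.injEq]
    exact ⟨fun h => ⟨[], ⟨h.symm, rfl⟩, Dom.mem_set_nil⟩, fun ⟨_, h, _⟩ => h.1.symm⟩
  | node i c l r ihl ihr =>
    have hneg : form (i + 6) x < c.neg.val ↔ c.val < form i x := by
      rw [form_add_six, Surd.val_neg, neg_lt_neg_iff]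
    simp only [At, paths, ihl, ihr, List.mem_append, List.mem_map, Prod.mk.injEq, Prod.exists]
    constructor
    · rintro (⟨h1, E, hE, h2⟩ | ⟨h1, E, hE, h2⟩)
      · exact ⟨_, Or.inl ⟨k, E, hE, rfl, rfl⟩, Dom.mem_set_cons.2 ⟨h1, h2⟩⟩
      · exact ⟨_, Or.inr ⟨k, E, hE, rfl, rfl⟩, Dom.mem_set_cons.2 ⟨hneg.2 h1, h2⟩⟩
    · rintro ⟨E, (⟨k', E', hE, rfl, rfl⟩ | ⟨k', E', hE, rfl, rfl⟩), h⟩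
      · rw [Dom.mem_set_cons] at h
        exact Or.inl ⟨h.1, E', hE, h.2⟩
      · rw [Dom.mem_set_cons] at h
        exact Or.inr ⟨hneg.1 h.1, E', hE, h.2⟩

/-- Checks that `D`, together with the conditions for any leaf accepted by `f`, implies `D'`. -/
def entails (T : Tree) (f : ℕ → Bool) (D D' : Dom) : Bool :=
  T.paths.all fun E => !f E.1 || D'.all fun p => Dom.implies (E.2 ++ D) p.1 p.2

theorem entails_sound {T : Tree} {f : ℕ → Bool} {D D' : Dom} (h : T.entails f D D' = true)
    {x : Pt} {k : ℕ} (hk : T.At x k) (hf : f k = true) (hx : x ∈ D.set) : x ∈ D'.set := by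
  obtain ⟨E, hE, hxE⟩ := at_iff_paths.1 hk
  rw [entails, List.all_eq_true] at h
  have h1 := h _ hE
  simp only [hf, Bool.not_true, Bool.false_or, List.all_eq_true] at h1
  exact fun p hp => Dom.implies_sound (h1 p hp) (Dom.mem_set_append.2 ⟨hxE, hx⟩)

end Tree

/-- The conditions for `x` that are equivalent to the conditions `D` for the image of `x`. -/
def Dom.pull (D : Dom) (m : Move) : Dom :=
  D.map fun p => (p.1 + m.1, p.2.add ((Poly.ofPoint 12 m.2.1 m.2.2).getD (p.1 % 12) (0, 0)).neg)

theorem Dom.mem_pull {D : Dom} {m : Move} {x : Pt} : x ∈ (D.pull m).set ↔ m.act x ∈ D.set := by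
  simp only [pull, set, List.mem_map, Set.mem_ofPred_eq]
  constructor
  · intro h p hp
    have h1 := h _ ⟨p, hp, rfl⟩
    simp only [Surd.val_add, Surd.val_neg] at h1
    rw [Poly.val_ofPoint (Nat.mod_lt _ (by norm_num)), form_mod] at h1
    rw [Move.form_act]
    linarith
  · rintro h _ ⟨p, hp, rfl⟩
    have h1 := h p hp
    simp only [Surd.val_add, Surd.val_neg]
    rw [Poly.val_ofPoint (Nat.mod_lt _ (by norm_num)), form_mod]
    rw [Move.form_act] at h1
    linarith

/-- `D` is invariant. -/
def Dom.closed (D : Dom) (T : Tree) (maps : List Move) : Bool :=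
  (List.range maps.length).all fun k => T.entails (· == k) D (D.pull (moveAt maps k))

theorem act_zero (x : Pt) : Move.act (0, (0, 0), (0, 0)) x = x := by
  ext <;> simp [Move.act, Surd.val]

theorem Dom.closed_sound {D : Dom} {T : Tree} {maps : List Move} (h : D.closed T maps = true)
    {x : Pt} {k : ℕ} (hx : x ∈ D.set) (hk : T.At x k) : (moveAt maps k).act x ∈ D.set := by
  by_cases hl : k < maps.length
  · rw [closed, List.all_eq_true] at h
    exact Dom.mem_pull.1 (Tree.entails_sound (h k (List.mem_range.2 hl)) hk (by simp) hx)
  · rw [moveAt, List.getD_eq_getElem?_getD, List.getElem?_eq_none (by omega), Option.getD_none,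
      act_zero]
    exact hx

/-- Traces are certified for the tree map on the whole plane; invariance of the domain carries them
over. -/
theorem run_of_univ {T : Tree} {maps : List Move} {D : Set Pt}
    (hD : ∀ x k, x ∈ D → T.At x k → (moveAt maps k).act x ∈ D) {x y : Pt} {w : List ℕ}
    (h : (treeMap T maps Set.univ).Run x w y) (hx : x ∈ D) :
    (treeMap T maps D).Run x w y ∧ y ∈ D := by
  induction w generalizing x with
  | nil => exact ⟨h, PMap.run_nil.1 h ▸ hx⟩
  | cons k w ih =>
    obtain ⟨h1, h2⟩ := ih h.2 (hD x k hx h.1.2)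
    exact ⟨⟨⟨hx, h.1.2⟩, h1⟩, h2⟩

theorem univ_of_run {T : Tree} {maps : List Move} {D : Set Pt} {x y : Pt} {w : List ℕ}
    (h : (treeMap T maps D).Run x w y) : (treeMap T maps Set.univ).Run x w y := by
  induction w generalizing x with
  | nil => exact h
  | cons k w ih => exact ⟨⟨trivial, h.1.2⟩, ih h.2⟩

/-- The orbit of the polygon returns to `D` for the first time with word `w` and motion `m`. -/
def returns (T : Tree) (maps : List Move) (D : Dom) (Q : Poly) (w : List ℕ) (m : Move) : Bool :=
  match trace T maps (fun _ => D.misses) (fun _ => D.has) 300 (0, (0, 0), (0, 0)) Q with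
  | some (v, l, _) => v == w && l == m
  | none => false

theorem returns_sound {T : Tree} {maps : List Move} (hm : ∀ m ∈ maps, m.1 < 12) {D : Set Pt}
    (hD : ∀ x k, x ∈ D → T.At x k → (moveAt maps k).act x ∈ D) {E : Dom} {Q : Poly}
    {w : List ℕ} {m : Move} (h : returns T maps E Q w m = true) {x : Pt} (hxD : x ∈ D)
    (hx : Q.Mem x) : w ≠ [] ∧ (treeMap T maps D).Run x w (m.act x) ∧ m.act x ∈ E.set ∧
      ∀ u v y, w = u ++ v → u ≠ [] → v ≠ [] → (treeMap T maps D).Run x u y → y ∉ E.set := by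
  rw [returns] at h
  split at h
  · next v l P ht =>
    rw [Bool.and_eq_true, beq_iff_eq, beq_iff_eq] at h
    obtain ⟨rfl, rfl⟩ := h
    obtain ⟨h1, h2, h3⟩ := trace_sound hm ht
    obtain ⟨h4, h5, h6⟩ := h3 x (by rwa [act_zero])
    rw [act_zero] at h5
    refine ⟨h2, (run_of_univ hD h5 hxD).1, Dom.has_sound h1 h4, fun u v y he hu hv hr => ?_⟩
    obtain ⟨l, R, -, hR, ho, -⟩ := h6 u v y he hu hv (by rw [act_zero]; exact univ_of_run hr)
    exact Dom.misses_sound ho hR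
  · exact absurd h (by simp)

/-- The orbit of the polygon comes to `D` with the motion `m`. -/
def arrives (T : Tree) (maps : List Move) (D : Dom) (Q : Poly) (m : Move) : Bool :=
  match trace T maps (fun _ _ => true) (fun _ => D.has) 300 (0, (0, 0), (0, 0)) Q with
  | some (_, l, _) => l == m
  | none => false

theorem arrives_sound {T : Tree} {maps : List Move} (hm : ∀ m ∈ maps, m.1 < 12) {D : Set Pt}
    (hD : ∀ x k, x ∈ D → T.At x k → (moveAt maps k).act x ∈ D) {E : Dom} {Q : Poly}
    {m : Move} (h : arrives T maps E Q m = true) {x : Pt} (hxD : x ∈ D) (hx : Q.Mem x) :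
    (∃ w, (treeMap T maps D).Run x w (m.act x)) ∧ m.act x ∈ E.set := by
  rw [arrives] at h
  split at h
  · next v l P ht =>
    rw [beq_iff_eq] at h
    subst h
    obtain ⟨h1, -, h3⟩ := trace_sound hm ht
    obtain ⟨h4, h5, -⟩ := h3 x (by rwa [act_zero])
    rw [act_zero] at h5
    exact ⟨⟨v, (run_of_univ hD h5 hxD).1⟩, Dom.has_sound h1 h4⟩
  · exact absurd h (by simp)

/-! ### Islands and their certificates -/

/-- The sum of the weights of the letters. -/
def weigh {n : ℕ} (v : ℕ → Fin n → ℕ) (w : List ℕ) : Fin n → ℕ := (w.map v).sum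

/-- `K` is mapped to itself with the word `w` of the periodic point `z` of `K`. -/
structure Island (S : PMap Pt) (K : Set Pt) (z : Pt) (w : List ℕ) : Prop where
  mem : z ∈ K
  prim : S.Prim z w
  run : ∀ x ∈ K, ∃ y ∈ K, S.Run x w y

/-- A weight vector, a periodic point and a polygon around it. -/
abbrev Entry (n : ℕ) := (Fin n → ℕ) × Surd × Surd × Poly

namespace Entry

variable {n : ℕ}

noncomputable def centre (e : Entry n) : Pt := (e.2.1.val, e.2.2.1.val)

def poly (e : Entry n) : Poly := e.2.2.2

/-- Checks that the entry is an island with a word of the given weight and with the property `f`,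
in the domain `D`. -/
def check (T : Tree) (maps : List Move) (v : ℕ → Fin n → ℕ) (f : List ℕ → Bool) (D : Dom)
    (e : Entry n) : Bool :=
  D.has e.poly && e.poly.length == 12 &&
  (List.range 12).all (fun i => Surd.le
    (((Poly.ofPoint 12 e.2.1 e.2.2.1).getD i (0, 0)).add (97, -56)) (e.poly.getD i (0, 0))) &&
  match trace T maps (fun _ _ => true) (fun l _ => l.2 == (e.2.1, e.2.2.1)) 500
    (0, e.2.1, e.2.2.1) e.poly with
  | some (w, _, P) => P.sub e.poly && decide (weigh v w = e.1) && f w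
  | none => false

theorem check_sound {T : Tree} {maps : List Move} (hm : ∀ m ∈ maps, m.1 < 12)
    {v : ℕ → Fin n → ℕ} {f : List ℕ → Bool} {D : Dom}
    (hD : ∀ x k, x ∈ D.set → T.At x k → (moveAt maps k).act x ∈ D.set) {e : Entry n}
    (h : e.check T maps v f D = true) :
    ∃ w, Island (treeMap T maps D.set) {x | e.poly.Mem x} e.centre w ∧ weigh v w = e.1 ∧
      f w = true := by
  rw [check, Bool.and_eq_true, Bool.and_eq_true, Bool.and_eq_true, beq_iff_eq] at h
  obtain ⟨⟨⟨hhas, hlen⟩, hz⟩, h⟩ := h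
  split at h
  · next w l P ht =>
    simp only [Bool.and_eq_true, decide_eq_true_eq] at h
    obtain ⟨⟨hsub, hw⟩, hf⟩ := h
    obtain ⟨hhalt, hne, h3⟩ := trace_sound hm ht
    rw [beq_iff_eq] at hhalt
    -- The check leaves a margin of (97 - 56√3)/36, which is positive since 97 - 56√3 = (7 - 4√3)²;
    -- this makes the inequalities strict.
    have hcm : e.poly.Mem e.centre := by
      refine ⟨hlen, fun i hi => ?_⟩
      rw [List.all_eq_true] at hz
      have h1 := Surd.val_le (hz i (List.mem_range.2 hi))
      rw [Surd.val_add, Poly.val_ofPoint hi] at h1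
      have : 0 < Surd.val (97, -56) := by
        have := Surd.sqrt3_sq
        have : 0 ≤ √3 := Real.sqrt_nonneg 3
        simp only [Surd.val]
        push_cast
        nlinarith
      rw [centre]
      linarith
    have hact : ∀ x, Move.act (0, e.2.1, e.2.2.1) x = x + e.centre := fun x => rfl
    have hzero : ∀ l : Move, l.act 0 = (l.2.1.val, l.2.2.val) := by
      intro l
      have : turn^[l.1] 0 = 0 := by
        have := turn_iterate_smul l.1 0 0
        rwa [zero_smul, zero_smul] at this
      rw [Move.act, this, zero_add]
    -- The trace starts with the translation by the centre, so the argument 0 follows the centre,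
    -- and `x - e.centre` below follows any other point of the polygon.
    have h0 := h3 0 (by rw [hact, zero_add]; exact hcm)
    rw [hact, zero_add, hzero, hhalt] at h0
    have hrun : (treeMap T maps D.set).Run e.centre w e.centre :=
      (run_of_univ hD h0.2.1 (Dom.has_sound hhas hcm)).1
    refine ⟨w, ⟨hcm, ⟨hne, hrun, fun u hu hr => ?_⟩, fun x hx => ?_⟩, hw, hf⟩
    -- At an earlier return of the centre the translation part of the motion would equal the centre
    -- also as a pair of surds, and the trace would have halted there.
    · by_contra hlt
      push Not at hlt
      obtain ⟨t, rfl, -⟩ := hr.split (treeMap_det _ _ _) hrun hlt.le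
      obtain ⟨l', R, h4, -, -, h5⟩ := h0.2.2 u t _ rfl hu (by rintro rfl; simp at hlt)
        (univ_of_run hr)
      rw [hzero, centre, Prod.mk.injEq] at h4
      rw [beq_eq_false_iff_ne] at h5
      exact h5 (Prod.ext (Surd.val_injective h4.1).symm (Surd.val_injective h4.2).symm)
    · have h4 := h3 (x - e.centre) (by rw [hact, sub_add_cancel]; exact hx)
      rw [hact, sub_add_cancel] at h4
      exact ⟨_, h4.1.of_sub hsub hlen, (run_of_univ hD h4.2.1 (Dom.has_sound hhas hx)).1⟩
  · exact absurd h (by simp)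

end Entry

/-! ### The data for the dodecagon -/

def sectorTree : Tree := .node 7 (36,0) (.leaf 1) (.node 8 (36,36) (.leaf 2) (.node 9 (108,36)
  (.leaf 3) (.node 10 (108,72) (.leaf 4) (.node 11 (144,72) (.leaf 5) (.leaf 6)))))

/-- The label is the number of vertices by which the tangency point advances. Entry 0 is a dummy, as
no cell has this label. -/
def sectorMaps : List Move := [(0,(0,0), (0,0)), (7,(-36,0), (0,-36)), (8,(-36,-36), (-72,-36)),
  (9,(-108,-36), (-72,-72)), (10,(-108,-72), (-108,-72)), (11,(-144,-72), (-108,-72)),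
  (0,(-144,-72), (-72,-72))]

def nearTree : Tree := .node 6 (72,0) (.node 7 (36,0) (.leaf 0) (.node 8 (36,36) (.leaf 1) (.leaf
  2))) (.node 8 (-36,108) (.node 1 (-252,72) (.leaf 4) (.leaf 5)) (.node 4 (36,-72) (.leaf 3)
  (.node 3 (-324,108) (.leaf 6) (.leaf 7))))

def nearMaps : List Move := [
  (7,(-36,0), (0,-36)),
  (8,(-36,-36), (-72,-36)),
  (9,(-108,-36), (-72,-72)),
  (7,(-108,-72), (-144,-108)),
  (11,(72,-72), (-180,72)),
  (10,(252,-216), (-252,72)),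
  (1,(324,-144), (-288,180)),
  (0,(144,-72), (0,0))]

/-- Leaf 9 is the part in `scaledDomain`, where explorations stop. It has no entry in `tipMaps`, so
its motion is the default one, the identity. -/
def tipTree : Tree := .node 9 (324,-180) (.leaf 9)
  (.node 3 (-324,180) (.node 2 (36,-36) (.leaf 0) (.node 1 (-396,216) (.node 10 (1260,-720) (.node
  0 (2232,-1296) (.leaf 2) (.leaf 3)) (.leaf 4)) (.node 4 (108,-72) (.leaf 1) (.leaf 5)))) (.node
  2 (180,-108) (.leaf 6) (.node 1 (-252,144) (.leaf 7) (.leaf 8))))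

def tipMaps : List Move := [
  (7,(-36,0), (0,-36)),
  (4,(-108,72), (108,-72)),
  (10,(972,-576), (-36,0)),
  (11,(2232,-1296), (-2268,1296)),
  (9,(900,-540), (-1296,720)),
  (3,(324,-180), (-144,72)),
  (2,(-180,108), (288,-180)),
  (1,(252,-144), (-216,108)),
  (0,(0,0), (216,-144))]

/-- Bounds for the eight cells of `nearTree` in `nearDomain`; see `mem_nearCell`. -/
def nearCells : List Poly := [
  [(0,0), (0,0), (0,0), (0,0), (0,0), (0,0), (0,12), (36,0), (0,36), (72,0), (0,36), (36,0)],
  [(0,0), (-36,0), (0,-24), (-36,0), (0,-12), (0,0), (18,18), (54,18), (36,36), (72,24), (36,36),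
  (36,12)],
  [(0,0), (-36,-12), (-36,-36), (-54,-18), (-18,-18), (0,0), (72,0), (54,54), (90,54), (108,36),
  (54,54), (54,18)],
  [(-72,0), (-72,-36), (-36,-72), (-144,0), (36,-72), (0,0), (36,36), (108,36), (72,72), (108,36),
  (18,54), (54,-18)],
  [(-72,0), (-252,72), (144,-168), (-252,72), (72,-84), (0,0), (-18,54), (162,-18), (-36,108),
  (216,-48), (-108,108), (108,-60)],
  [(-72,0), (0,-72), (-144,0), (0,-72), (-72,0), (0,0), (-72,84), (252,-72), (-288,252),
  (504,-216), (-360,252), (252,-144)],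
  [(-72,0), (-162,18), (126,-162), (-324,108), (108,-108), (0,0), (-36,72), (216,-36), (-72,144),
  (216,-36), (-36,72), (72,-36)],
  [(-72,0), (-108,-12), (36,-108), (-162,18), (18,-54), (0,0), (-108,108), (324,-108), (-216,216),
  (324,-108), (-198,162), (162,-90)]]

def nearPoly : Poly := [(0,0), (0,0), (0,0), (0,0), (0,0), (0,0), (36,36), (108,36), (72,72),
  (108,36), (54,54), (54,18)]

def tipPoly : Poly := [(0,0), (0,0), (0,0), (0,0), (0,0), (0,0), (0,12), (36,0), (0,36), (72,0),
  (0,36), (36,0)]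

def nearIslands : List (Entry 8) := [
  (![0, 1, 0, 0, 0, 0, 0, 0], (0,-12), (-36,-12),
    [(0,0), (-36,0), (-18,-18), (-18,-18), (-36,0), (0,0), (18,18), (54,18), (36,36), (36,36),
      (54,18), (18,18)]),
  (![0, 0, 1, 0, 0, 0, 0, 0], (-36,0), (-36,-36),
    [(0,0), (-36,-12), (-36,-36), (-36,-36), (-36,-12), (0,0), (72,0), (36,60), (108,36),
      (108,36), (36,60), (72,0)]),
  (![9, 2, 5, 2, 0, 0, 0, 0], (-72,36), (48,-40),
    [(180,-108), (-144,72), (36,-36), (-108,48), (108,-72), (-252,144), (324,-180), (-288,180),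
      (216,-108), (-36,36), (144,-72), (-180,108)]),
  (![6, 4, 10, 4, 0, 0, 0, 0], (-60,34), (27,-29),
    [(0,0), (0,-12), (-36,0), (0,-24), (-36,0), (-144,72), (108,-60), (-36,36), (0,24), (108,-36),
      (-54,54), (54,-18)]),
  (![0, 0, 2, 3, 0, 0, 1, 0], (72,-84), (-252,60),
    [(-72,0), (-396,144), (162,-198), (-198,18), (-108,0), (-144,72), (-18,54), (306,-90),
      (-252,252), (108,36), (18,54), (54,-18)]),
  (![24, 24, 120, 102, 0, 0, 18, 0], (-1212,696), (780,-460),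
    [(1116,-648), (108,-72), (2160,-1260), (-3888,2232), (4536,-2628), (-3996,2304), (2376,-1368),
      (-2124,1236), (1332,-756), (-2160,1260), (2448,-1404), (-2052,1188)]),
  (![48, 48, 156, 108, 0, 0, 24, 0], (-1479,851), (1512,-890),
    [(-1782,1026), (2340,-1368), (-1584,888), (324,-216), (936,-564), (-2016,1152), (504,-288),
      (-864,516), (1044,-576), (-864,528), (540,-288), (738,-414)]),
  (![4, 4, 9, 4, 0, 0, 1, 0], (-252,144), (36,-36),
    [(0,0), (-252,132), (396,-252), (-108,36), (108,-84), (-144,72), (504,-288), (-324,204),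
      (108,-36), (612,-324), (-684,420), (648,-360)]),
  (![1, 0, 0, 0, 0, 0, 0, 0], (-72,36), (36,-36),
    [(0,0), (108,-72), (36,-36), (36,-36), (108,-72), (0,0), (144,-72), (36,0), (108,-36),
      (108,-36), (36,0), (144,-72)]),
  (![0, 0, 1, 1, 0, 0, 0, 0], (-144,36), (36,-108),
    [(-72,0), (108,-144), (-108,-36), (36,-108), (36,-72), (0,0), (216,-72), (36,72), (252,-36),
      (108,36), (108,0), (144,-72)]),
  (![2, 2, 4, 2, 0, 0, 1, 0], (432,-252), (-468,252),
    [(0,0), (-900,504), (-108,36), (-612,324), (-540,288), (-144,72), (-864,504), (36,0),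
      (-756,468), (-252,180), (-324,216), (-720,432)]),
  (![0, 0, 7, 8, 0, 0, 1, 0], (-144,36), (540,-396),
    [(792,-504), (1476,-936), (-108,-36), (1908,-1188), (36,-72), (1368,-792), (1080,-576),
      (396,-144), (1980,-1044), (-36,108), (1836,-1008), (504,-288)]),
  (![6, 6, 13, 6, 0, 0, 2, 0], (-72,36), (900,-540),
    [(864,-504), (1836,-1080), (-612,324), (2628,-1548), (-540,288), (1728,-1008), (1008,-576),
      (36,0), (2484,-1404), (-756,468), (2412,-1368), (144,-72)])]

/-- Contains the cell 4 of `sector`. -/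
def midPoly : Poly := [(0,0), (-54,-18), (-54,-54), (-108,-36), (-36,-36), (0,0), (108,72),
  (216,108), (216,144), (216,108), (108,72), (72,36)]

/-- Contains the points of cell 5 that are mapped into cell 5 again. -/
def farPoly : Poly := [(0,0), (-72,-36), (-108,-72), (-144,-72), (-108,-72), (0,0), (252,144),
  (432,252), (504,288), (432,252), (252,144), (144,72)]

def farIslands : List (Entry 6) := [
  (![0, 0, 0, 0, 1, 0], (-72,-36), (-180,-108),
    [(0,0), (-108,-72), (-180,-108), (-180,-108), (-108,-72), (0,0), (144,72), (252,144),
      (324,180), (324,180), (252,144), (144,72)]),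
  (![0, 0, 0, 1, 0, 0], (0,-36), (-108,-36),
    [(0,0), (-108,0), (-108,-36), (-108,-36), (-108,0), (0,0), (0,72), (108,72), (108,108),
      (108,108), (108,72), (0,72)]),
  (![0, 0, 0, 24, 36, 0], (-129,21), (-48,-106),
    [(-216,72), (0,-132), (-180,-72), (-216,-48), (36,-144), (-162,54), (126,-18), (108,72),
      (144,96), (180,72), (72,84), (72,0)]),
  (![0, 0, 0, 18, 36, 0], (-120,28), (-48,-96),
    [(-216,84), (36,-144), (-360,36), (72,-216), (-288,36), (36,-72), (72,0), (216,0), (-72,216),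
      (432,-72), (-144,216), (216,-72)]),
  (![0, 0, 0, 1, 2, 0], (-72,-60), (-180,-84),
    [(-54,-54), (-180,-72), (-180,-108), (-162,-90), (-90,-54), (0,0), (72,72), (198,90),
      (198,126), (180,108), (108,72), (18,18)]),
  (![0, 0, 0, 1, 1, 0], (-72,-36), (-144,-72),
    [(-72,-12), (-108,-72), (-108,-108), (-180,-48), (-36,-72), (0,0), (72,60), (180,72),
      (180,108), (180,96), (108,72), (72,0)]),
  (![0, 0, 0, 2, 1, 0], (-144,36), (-36,-108),
    [(-72,0), (36,-144), (-108,-108), (-108,-108), (36,-144), (-72,0), (216,-72), (108,72),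
      (252,36), (252,36), (108,72), (216,-72)]),
  (![0, 0, 0, 1, 3, 0], (-72,36), (-36,-108),
    [(0,0), (36,-144), (-180,-108), (-108,-180), (-108,-144), (-72,-72), (144,-72), (108,72),
      (324,36), (252,108), (252,72), (216,0)])]

def nearWords : List (List ℕ) := [
  [1],
  [2],
  [3],
  [3, 4],
  [3, 4, 4, 4, 4, 5, 4, 4, 5, 4, 4, 4, 4],
  [3, 4, 4, 4, 4, 5, 4, 4, 5, 4, 4, 5, 4, 4, 5, 4, 4, 5, 4, 4, 5, 4, 4, 5, 4, 4, 4, 4],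
  [3, 4, 4, 4, 4, 5, 4, 5, 4, 5, 5, 4, 5, 5, 5, 4, 5, 5, 5, 4, 5, 5, 4, 5, 4, 5, 4, 4, 4, 4],
  [3, 4, 4, 4, 4, 5, 4, 5, 4, 5, 5, 4, 5, 5, 5, 4, 5, 5, 5, 4, 5, 5, 4, 5, 4, 5, 4, 4, 5, 4, 4,
    5, 4, 5, 4, 5, 5, 4, 5, 5, 5, 4, 5, 5, 5, 4, 5, 5, 4, 5, 4, 5, 4, 4, 4, 4]]

def returnWords : List (List ℕ) := [
  [0, 1, 2, 5, 2, 2, 1, 0],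
  [0, 1, 2, 4, 2, 2, 1, 0],
  [0, 1, 2, 7, 2, 2, 1, 0],
  [0, 1, 2, 7, 2, 2, 1, 0, 0, 1, 2, 6, 2, 2, 1, 0],
  [0, 1, 2, 7, 2, 2, 1, 0, 0, 1, 2, 6, 2, 2, 1, 0, 0, 1, 2, 6, 2, 2, 1, 0, 0, 1, 2, 6, 2, 2, 1,
    0, 0, 1, 2, 6, 2, 2, 1, 0, 0, 1, 2, 3, 3, 2, 2, 1, 0, 0, 1, 2, 6, 2, 2, 1, 0, 0, 1, 2, 6, 2,
    2, 1, 0, 0, 1, 2, 3, 3, 2, 2, 1, 0, 0, 1, 2, 6, 2, 2, 1, 0, 0, 1, 2, 6, 2, 2, 1, 0, 0, 1, 2,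
    6, 2, 2, 1, 0, 0, 1, 2, 6, 2, 2, 1, 0],
  [0, 1, 2, 7, 2, 2, 1, 0, 0, 1, 2, 6, 2, 2, 1, 0, 0, 1, 2, 6, 2, 2, 1, 0, 0, 1, 2, 6, 2, 2, 1,
    0, 0, 1, 2, 6, 2, 2, 1, 0, 0, 1, 2, 3, 3, 2, 2, 1, 0, 0, 1, 2, 6, 2, 2, 1, 0, 0, 1, 2, 6, 2,
    2, 1, 0, 0, 1, 2, 3, 3, 2, 2, 1, 0, 0, 1, 2, 6, 2, 2, 1, 0, 0, 1, 2, 6, 2, 2, 1, 0, 0, 1, 2,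
    3, 3, 2, 2, 1, 0, 0, 1, 2, 6, 2, 2, 1, 0, 0, 1, 2, 6, 2, 2, 1, 0, 0, 1, 2, 3, 3, 2, 2, 1, 0,
    0, 1, 2, 6, 2, 2, 1, 0, 0, 1, 2, 6, 2, 2, 1, 0, 0, 1, 2, 3, 3, 2, 2, 1, 0, 0, 1, 2, 6, 2, 2,
    1, 0, 0, 1, 2, 6, 2, 2, 1, 0, 0, 1, 2, 3, 3, 2, 2, 1, 0, 0, 1, 2, 6, 2, 2, 1, 0, 0, 1, 2, 6,
    2, 2, 1, 0, 0, 1, 2, 3, 3, 2, 2, 1, 0, 0, 1, 2, 6, 2, 2, 1, 0, 0, 1, 2, 6, 2, 2, 1, 0, 0, 1,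
    2, 6, 2, 2, 1, 0, 0, 1, 2, 6, 2, 2, 1, 0],
  [0, 1, 2, 7, 2, 2, 1, 0, 0, 1, 2, 6, 2, 2, 1, 0, 0, 1, 2, 6, 2, 2, 1, 0, 0, 1, 2, 6, 2, 2, 1,
    0, 0, 1, 2, 6, 2, 2, 1, 0, 0, 1, 2, 3, 3, 2, 2, 1, 0, 0, 1, 2, 6, 2, 2, 1, 0, 0, 1, 2, 3, 3,
    2, 2, 1, 0, 0, 1, 2, 6, 3, 6, 3, 3, 3, 3, 3, 3, 6, 3, 3, 3, 3, 3, 3, 6, 3, 6, 2, 2, 1, 0, 0,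
    1, 2, 3, 3, 2, 2, 1, 0, 0, 1, 2, 6, 2, 2, 1, 0, 0, 1, 2, 3, 3, 2, 2, 1, 0, 0, 1, 2, 6, 2, 2,
    1, 0, 0, 1, 2, 6, 2, 2, 1, 0, 0, 1, 2, 6, 2, 2, 1, 0, 0, 1, 2, 6, 2, 2, 1, 0],
  [0, 1, 2, 7, 2, 2, 1, 0, 0, 1, 2, 6, 2, 2, 1, 0, 0, 1, 2, 6, 2, 2, 1, 0, 0, 1, 2, 6, 2, 2, 1,
    0, 0, 1, 2, 6, 2, 2, 1, 0, 0, 1, 2, 3, 3, 2, 2, 1, 0, 0, 1, 2, 6, 2, 2, 1, 0, 0, 1, 2, 3, 3,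
    2, 2, 1, 0, 0, 1, 2, 6, 3, 6, 3, 3, 3, 3, 3, 3, 6, 3, 3, 3, 3, 3, 3, 6, 3, 6, 2, 2, 1, 0, 0,
    1, 2, 3, 3, 2, 2, 1, 0, 0, 1, 2, 6, 2, 2, 1, 0, 0, 1, 2, 3, 3, 2, 2, 1, 0, 0, 1, 2, 6, 2, 2,
    1, 0, 0, 1, 2, 6, 2, 2, 1, 0, 0, 1, 2, 3, 3, 2, 2, 1, 0, 0, 1, 2, 6, 2, 2, 1, 0, 0, 1, 2, 6,
    2, 2, 1, 0, 0, 1, 2, 3, 3, 2, 2, 1, 0, 0, 1, 2, 6, 2, 2, 1, 0, 0, 1, 2, 3, 3, 2, 2, 1, 0, 0,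
    1, 2, 6, 3, 6, 3, 3, 3, 3, 3, 3, 6, 3, 3, 3, 3, 3, 3, 6, 3, 6, 2, 2, 1, 0, 0, 1, 2, 3, 3, 2,
    2, 1, 0, 0, 1, 2, 6, 2, 2, 1, 0, 0, 1, 2, 3, 3, 2, 2, 1, 0, 0, 1, 2, 6, 2, 2, 1, 0, 0, 1, 2,
    6, 2, 2, 1, 0, 0, 1, 2, 6, 2, 2, 1, 0, 0, 1, 2, 6, 2, 2, 1, 0]]

def wedge : Dom := [(0, (0, 0)), (5, (0, 0))]

def nearDomain : Dom := (9, (108, 36)) :: wedge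

def scaledDomain : Dom := (9, (324, -180)) :: wedge

def tipDomain : Dom := (7, (36, 0)) :: wedge

/-! ### The maps `sector`, `near` and `tip`, and the self-similarity of `near` -/

/-- The outer billiard map in a sector, reduced by the rotations of the dodecagon. -/
noncomputable def sector : PMap Pt := treeMap sectorTree sectorMaps wedge.set

/-- The first return map of `sector` to `nearDomain`. -/
noncomputable def near : PMap Pt := treeMap nearTree nearMaps nearDomain.set

/-- A map of `tipDomain` composed of orbit segments of `near`. -/
noncomputable def tip : PMap Pt := treeMap tipTree tipMaps tipDomain.set

def nearWord (k : ℕ) : List ℕ := nearWords.getD k []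

def returnWord (k : ℕ) : List ℕ := returnWords.getD k []

def sectorWeight (k : ℕ) : Fin 6 → ℕ := fun j => bif Nat.beq (j + 1) k then 1 else 0

/-- These are not the unit vectors: with this choice of coordinates the substitutions `nearWord` and
`returnWord` act by the given matrices `M68` and `M88`. -/
def nearWeights : List (Fin 8 → ℕ) := [
  ![1, 0, 0, 0, 0, 0, 0, 0], ![0, 1, 0, 0, 0, 0, 0, 0], ![0, 0, 1, 0, 0, 0, 0, 0],
  ![0, 0, 1, 1, 0, 0, 0, 0], ![0, 0, 1, 2, 1, 0, 0, 0], ![0, 0, 1, 2, 0, 1, 0, 0],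
  ![0, 0, 1, 2, 0, 0, 1, 0], ![0, 0, 1, 2, 0, 0, 0, 1]]

def nearWeight (k : ℕ) : Fin 8 → ℕ := nearWeights.getD k 0

theorem nearMaps_lt : ∀ m ∈ nearMaps, m.1 < 12 := by decide

theorem sectorMaps_lt : ∀ m ∈ sectorMaps, m.1 < 12 := by decide

theorem tipMaps_lt : ∀ m ∈ tipMaps, m.1 < 12 := by decide

theorem sector_closed (x : Pt) (k : ℕ) (hx : x ∈ wedge.set) (hk : sectorTree.At x k) :
    (moveAt sectorMaps k).act x ∈ wedge.set :=
  Dom.closed_sound (by decide +kernel) hx hk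

theorem mem_nearPoly {x : Pt} (hx : x ∈ nearDomain.set) : nearPoly.Mem x :=
  Dom.bounds_sound (by decide +kernel) hx

theorem mem_tipPoly {x : Pt} (hx : x ∈ tipDomain.set) : tipPoly.Mem x :=
  Dom.bounds_sound (by decide +kernel) hx

theorem mem_wedge_of_nearDomain {x : Pt} (hx : x ∈ nearDomain.set) : x ∈ wedge.set :=
  (Dom.mem_set_cons.1 hx).2

theorem mem_nearDomain_of_tipDomain {x : Pt} (hx : x ∈ tipDomain.set) : x ∈ nearDomain.set := by
  refine Dom.mem_set_cons.2 ⟨Dom.implies_sound (D := tipDomain) (by decide +kernel) hx,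
    (Dom.mem_set_cons.1 hx).2⟩

theorem mem_nearCell {x : Pt} {k : ℕ} (hx : x ∈ nearDomain.set) (hk : nearTree.At x k) :
    k < 8 ∧ (nearCells.getD k []).Mem x := by
  have h : nearTree.all (fun k P => Nat.blt k 8 && P.sub (nearCells.getD k [])) nearPoly = true := by
    decide +kernel
  obtain ⟨P, hP, h1⟩ := Tree.all_sound h (mem_nearPoly hx) hk
  rw [Bool.and_eq_true] at h1
  have h2 : k < 8 := Nat.le_of_ble_eq_true h1.1
  have hlen : ∀ k < 8, (nearCells.getD k []).length = 12 := by decide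
  exact ⟨h2, hP.of_sub h1.2 (hlen k h2)⟩

theorem near_returns : ∀ k < 8, returns sectorTree sectorMaps nearDomain (nearCells.getD k [])
    (nearWord k) (moveAt nearMaps k) = true := by
  decide +kernel

theorem near_returns_scaled : ∀ k < 8, returns nearTree nearMaps scaledDomain
    (nearCells.getD k []).scale (returnWord k)
    ((moveAt nearMaps k).1, (moveAt nearMaps k).2.1.scale, (moveAt nearMaps k).2.2.scale)
    = true := by
  decide +kernel

theorem near_closed (x : Pt) (k : ℕ) (hx : x ∈ nearDomain.set) (hk : nearTree.At x k) :
    (moveAt nearMaps k).act x ∈ nearDomain.set := by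
  obtain ⟨h1, h2⟩ := mem_nearCell hx hk
  exact (returns_sound sectorMaps_lt sector_closed (near_returns k h1)
    (mem_wedge_of_nearDomain hx) h2).2.2.1

theorem near_induced : PMap.Induced sector near id nearWord nearDomain.set where
  inj := Function.injective_id
  run x k h := by
    obtain ⟨h1, h2⟩ := mem_nearCell h.1 h.2
    exact (returns_sound sectorMaps_lt sector_closed (near_returns k h1)
      (mem_wedge_of_nearDomain h.1) h2).2.1
  ne_nil x k h := by
    obtain ⟨h1, h2⟩ := mem_nearCell h.1 h.2
    exact (returns_sound sectorMaps_lt sector_closed (near_returns k h1)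
      (mem_wedge_of_nearDomain h.1) h2).1
  mem x k h := h.1
  first x k u v y h := by
    obtain ⟨h1, h2⟩ := mem_nearCell h.1 h.2
    exact (returns_sound sectorMaps_lt sector_closed (near_returns k h1)
      (mem_wedge_of_nearDomain h.1) h2).2.2.2 u v y

/-- The contraction under which `near` is self-similar. -/
noncomputable def shrink (x : Pt) : Pt := (7 - 4 * √3) • x

theorem shrink_injective : Function.Injective shrink :=
  smul_right_injective Pt Surd.scale_pos.ne'

theorem form_shrink (i : ℕ) (x : Pt) : form i (shrink x) = (7 - 4 * √3) * form i x :=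
  form_smul i _ x

theorem shrink_mem_scaledDomain {x : Pt} :
    shrink x ∈ scaledDomain.set ↔ x ∈ nearDomain.set := by
  have h := Surd.scale_pos
  have h1 : ∀ (i : ℕ) (c : Surd), form i (shrink x) < c.scale.val ↔ form i x < c.val := by
    intro i c
    rw [form_shrink, Surd.val_scale, mul_lt_mul_iff_right₀ h]
  have h2 := h1 9 (108, 36)
  have h3 := h1 0 (0, 0)
  have h4 := h1 5 (0, 0)
  rw [show Surd.scale (108, 36) = (324, -180) by decide] at h2
  rw [show Surd.scale (0, 0) = (0, 0) by decide] at h3 h4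
  simp only [scaledDomain, nearDomain, wedge, Dom.mem_set_cons, h2, h3, h4, Dom.mem_set_nil]

theorem mem_nearDomain_of_scaledDomain {x : Pt} (hx : x ∈ scaledDomain.set) :
    x ∈ nearDomain.set := by
  refine Dom.mem_set_cons.2 ⟨Dom.implies_sound (D := scaledDomain) (by decide +kernel) hx,
    (Dom.mem_set_cons.1 hx).2⟩

theorem act_shrink (m : Move) (x : Pt) :
    Move.act (m.1, m.2.1.scale, m.2.2.scale) (shrink x) = shrink (m.act x) := by
  simp only [Move.act, shrink, turn_iterate_smul, smul_add, Surd.val_scale, Prod.smul_mk,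
    smul_eq_mul]

/-- The shrunken cells return to the shrunken domain by the shrunken motions of `near`; this is what
the computation `near_returns_scaled` confirms. -/
theorem shrink_induced : PMap.Induced near near shrink returnWord scaledDomain.set := by
  have key : ∀ x k, near.At x k → _ := fun x k h =>
    have h' := mem_nearCell h.1 h.2
    returns_sound nearMaps_lt near_closed (near_returns_scaled k h'.1)
      (mem_nearDomain_of_scaledDomain (shrink_mem_scaledDomain.2 h.1)) h'.2.scale
  refine ⟨shrink_injective, fun x k h => ?_, fun x k h => (key x k h).1,
    fun x k h => shrink_mem_scaledDomain.2 h.1, fun x k u v y h => (key x k h).2.2.2 u v y⟩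
  have := (key x k h).2.1
  change near.Run (shrink x) _ (Move.act _ (shrink x)) at this
  rwa [act_shrink] at this

/-! ### Letter counts under the substitutions -/

theorem weigh_nil {n : ℕ} (v : ℕ → Fin n → ℕ) : weigh v [] = 0 := rfl

theorem weigh_cons {n : ℕ} (v : ℕ → Fin n → ℕ) (k : ℕ) (w : List ℕ) :
    weigh v (k :: w) = v k + weigh v w := by
  simp [weigh]

theorem weigh_append {n : ℕ} (v : ℕ → Fin n → ℕ) (u w : List ℕ) :
    weigh v (u ++ w) = weigh v u + weigh v w := by
  simp [weigh]

theorem weigh_flatMap {m n : ℕ} {v : ℕ → Fin n → ℕ} {u : ℕ → Fin m → ℕ}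
    {M : Matrix (Fin n) (Fin m) ℕ} {σ : ℕ → List ℕ} (h : ∀ k, weigh v (σ k) = M *ᵥ u k)
    (w : List ℕ) : weigh v (w.flatMap σ) = M *ᵥ weigh u w := by
  induction w with
  | nil => simp [weigh_nil]
  | cons k w ih => rw [List.flatMap_cons, weigh_append, weigh_cons, ih, h, Matrix.mulVec_add]

theorem weigh_nearWord (w : List ℕ) :
    weigh sectorWeight (w.flatMap nearWord) = M68 *ᵥ weigh nearWeight w := by
  refine weigh_flatMap (fun k => ?_) w
  by_cases hk : k < 8
  · revert k
    decide +kernel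
  · have h1 : nearWord k = [] := List.getD_eq_default _ _ (by simpa [nearWords] using hk)
    have h2 : nearWeight k = 0 := List.getD_eq_default _ _ (by simpa [nearWeights] using hk)
    rw [h1, h2, Matrix.mulVec_zero, weigh_nil]

theorem weigh_returnWord (w : List ℕ) :
    weigh nearWeight (w.flatMap returnWord) = M88 *ᵥ weigh nearWeight w := by
  refine weigh_flatMap (fun k => ?_) w
  by_cases hk : k < 8
  · revert k
    decide +kernel
  · have h1 : returnWord k = [] := List.getD_eq_default _ _ (by
      rw [show returnWords.length = 8 by decide +kernel]
      omega)
    have h2 : nearWeight k = 0 := List.getD_eq_default _ _ (by simpa [nearWeights] using hk)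
    rw [h1, h2, Matrix.mulVec_zero, weigh_nil]

/-! ### The islands, and the proof that generic orbits reach them -/

theorem near_islands {e : Entry 8} (he : e ∈ nearIslands) :
    ∃ w, Island near {x | e.poly.Mem x} e.centre w ∧ weigh nearWeight w = e.1 := by
  have h : nearIslands.all (Entry.check nearTree nearMaps nearWeight (fun _ => true) nearDomain)
      = true := by
    decide +kernel
  obtain ⟨w, h1, h2, -⟩ := Entry.check_sound nearMaps_lt near_closed (List.all_eq_true.1 h e he)
  exact ⟨w, h1, h2⟩

/-- The word is not a repeated word, unless its length is divisible by 4 or odd. -/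
def isNotSquare (w : List ℕ) : Bool :=
  w.length % 4 != 2 || w.take (w.length / 2) != w.drop (w.length / 2)

theorem far_islands {e : Entry 6} (he : e ∈ farIslands) :
    ∃ w, Island sector {x | e.poly.Mem x} e.centre w ∧ weigh sectorWeight w = e.1 ∧
      isNotSquare w = true := by
  have h : farIslands.all (Entry.check sectorTree sectorMaps sectorWeight isNotSquare wedge)
      = true := by
    decide +kernel
  exact Entry.check_sound sectorMaps_lt sector_closed (List.all_eq_true.1 h e he)

theorem tip_step {x : Pt} {k : ℕ} (h : tip.At x k) :
    (∃ w, near.Run x w (tip.step k x)) ∧ tip.step k x ∈ tipDomain.set := by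
  have hc : tipTree.all (fun k P => k == 9 ||
      arrives nearTree nearMaps tipDomain P (moveAt tipMaps k)) tipPoly = true := by
    decide +kernel
  obtain ⟨P, hP, h1⟩ := Tree.all_sound hc (mem_tipPoly h.1) h.2
  rw [Bool.or_eq_true, beq_iff_eq] at h1
  rcases h1 with rfl | h1
  -- The list of motions ends before 9, and the default is the identity.
  · have : tip.step 9 x = x := act_zero x
    rw [this]
    exact ⟨⟨[], rfl⟩, h.1⟩
  · exact arrives_sound nearMaps_lt near_closed h1 (mem_nearDomain_of_tipDomain h.1) hP

theorem near_run_of_tip {x y : Pt} {w : List ℕ} (h : tip.Run x w y) :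
    ∃ u, near.Run x u y := by
  induction w generalizing x with
  | nil => exact ⟨[], h⟩
  | cons k w ih =>
    obtain ⟨⟨u, hu⟩, -⟩ := tip_step h.1
    obtain ⟨v, hv⟩ := ih h.2
    exact ⟨u ++ v, PMap.run_append.2 ⟨_, hu, hv⟩⟩

/-- The polygons of a list of islands, with their positions in a tree. -/
def goals {n : ℕ} (T : Tree) (L : List (Entry n)) : List (ℕ × Poly) :=
  L.filterMap fun e => (T.locate e.poly).map fun k => (k, e.poly)

theorem mem_goals {n : ℕ} {T : Tree} {L : List (Entry n)} {g : ℕ × Poly} (hg : g ∈ goals T L) :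
    ∃ e ∈ L, e.poly = g.2 := by
  rw [goals, List.mem_filterMap] at hg
  obtain ⟨e, he, h⟩ := hg
  rw [Option.map_eq_some_iff] at h
  obtain ⟨k, -, rfl⟩ := h
  exact ⟨e, he, rfl⟩

def waypointsOf {n : ℕ} (T : Tree) (maps : List Move) (s m : ℕ) (L : List (Entry n)) (i : ℕ) :
    List (ℕ × Poly) :=
  waypoints T maps s m s (L.getD i (0, (0, 0), (0, 0), [])).poly

def HitsIsland {n : ℕ} (L : List (Entry n)) (x : Pt) : Prop := ∃ e ∈ L, e.poly.Mem x

theorem explore_goals_sound {T : Tree} {maps : List Move} {D : Dom} (hm : ∀ m ∈ maps, m.1 < 12)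
    (hD : ∀ x k, x ∈ D.set → T.At x k → (moveAt maps k).act x ∈ D.set) {halt : ℕ → Bool} {n : ℕ}
    {L : List (Entry n)} (hL : ∀ e ∈ L, e.poly.length = 12) {Qs : List (ℕ × Poly)}
    (hQs : ∀ g ∈ Qs, g.2.length = 12)
    (h : exploreAll T maps halt 100 (goals T L) Qs = true) {g : ℕ × Poly} (hg : g ∈ Qs) {x : Pt}
    (hxD : x ∈ D.set) (hx : Generic x) (hxg : g.2.Mem x) :
    ∃ w y, (treeMap T maps D.set).Run x w y ∧
      (HitsIsland L y ∨ ∃ k, (treeMap T maps D.set).At y k ∧ halt k = true) := by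
  refine exploreAll_sound
    (P := fun y => HitsIsland L y ∨ ∃ k, (treeMap T maps D.set).At y k ∧ halt k = true)
    hm hD (fun y k hy _ hk hs => Or.inr ⟨k, ⟨hy, hk⟩, hs⟩) ?_ ?_ hQs h g hg x hxD hx hxg
  · intro g hg y _ _ hy
    obtain ⟨e, he, h1⟩ := mem_goals hg
    exact ⟨[], y, rfl, Or.inl ⟨e, he, h1 ▸ hy⟩⟩
  · intro g hg
    obtain ⟨e, he, h1⟩ := mem_goals hg
    rw [← h1]
    exact hL e he

/-- The exploration also stops in cell 0, which lies in `tipDomain`; there the map `tip`, made of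
longer orbit segments, takes over. -/
theorem near_explored : exploreAll nearTree nearMaps (Nat.beq 0) 100 (goals nearTree nearIslands)
    [(0, nearPoly)] = true := by
  decide +kernel

/-- The islands number 6 and 5 have long orbits. Intermediate positions of them are explored before
`tipPoly`, so that a piece of it is recognised without being followed back to the listed polygon. In
`sectorStart` the same is done for two islands of `farIslands`. -/
def tipStart : List (ℕ × Poly) :=
  waypointsOf tipTree tipMaps 10 60 nearIslands 6 ++
    waypointsOf tipTree tipMaps 10 40 nearIslands 5 ++ [(0, tipPoly)]

theorem tip_explored : exploreAll tipTree tipMaps (Nat.beq 9) 100 (goals tipTree nearIslands)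
    tipStart = true := by
  decide +kernel

def sectorStart : List (ℕ × Poly) :=
  waypointsOf sectorTree sectorMaps 8 60 farIslands 2 ++
    waypointsOf sectorTree sectorMaps 8 54 farIslands 3 ++ [(0, midPoly), (0, farPoly)]

def isFarLetter (k : ℕ) : Bool := Nat.beq k 4 || Nat.beq k 5

theorem sector_explored : exploreAll sectorTree sectorMaps (fun k => !isFarLetter k) 100
    (goals sectorTree farIslands) sectorStart = true := by
  decide +kernel

theorem near_cover {x : Pt} (hx : x ∈ nearDomain.set) (hg : Generic x) :
    ∃ w y, near.Run x w y ∧ (HitsIsland nearIslands y ∨ y ∈ scaledDomain.set) := by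
  have hL : ∀ e ∈ nearIslands, e.poly.length = 12 := by decide
  obtain ⟨w, y, hw, h⟩ := explore_goals_sound nearMaps_lt near_closed hL (by decide)
    near_explored (List.mem_singleton_self _) hx hg (mem_nearPoly hx)
  rcases h with h | ⟨k, hk, h0⟩
  · exact ⟨w, y, hw, Or.inl h⟩
  have hy : y ∈ tipDomain.set :=
    Tree.entails_sound (T := nearTree) (f := Nat.beq 0) (D := nearDomain) (by decide +kernel)
      hk.2 h0 hk.1
  obtain ⟨u, z, hu, h⟩ := explore_goals_sound tipMaps_lt (fun x k hx hk => (tip_step ⟨hx, hk⟩).2)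
    hL (by decide +kernel) tip_explored (g := (0, tipPoly)) (by simp [tipStart]) hy
    (treeMap_generic hg hw) (mem_tipPoly hy)
  obtain ⟨v, hv⟩ := near_run_of_tip hu
  refine ⟨w ++ v, z, PMap.run_append.2 ⟨y, hw, hv⟩, h.imp_right ?_⟩
  rintro ⟨l, hl, h9⟩
  exact Tree.entails_sound (T := tipTree) (f := Nat.beq 9) (D := tipDomain) (by decide +kernel)
    hl.2 h9 hl.1

/-- Cell 4 is bounded and is explored as `midPoly`. Cell 5 is an unbounded strip, but a point that
reads 5 twice in a row lies in `farPoly`; otherwise the next point lies in cell 4 or has a letter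
other than 4 and 5. -/
theorem sector_cover {x : Pt} {k : ℕ} (hx : sector.At x k) (hk : isFarLetter k = true)
    (hg : Generic x) :
    ∃ w y, sector.Run x w y ∧ (HitsIsland farIslands y ∨
      ∃ k, sector.At y k ∧ isFarLetter k = false) := by
  have hL : ∀ e ∈ farIslands, e.poly.length = 12 := by decide
  have key : ∀ Q, (0, Q) ∈ sectorStart → ∀ x, x ∈ wedge.set → Generic x → Q.Mem x →
      ∃ w y, sector.Run x w y ∧ (HitsIsland farIslands y ∨
        ∃ k, sector.At y k ∧ isFarLetter k = false) := by
    intro Q hQ x hx hg hxQ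
    obtain ⟨w, y, hw, h⟩ := explore_goals_sound sectorMaps_lt sector_closed hL (by decide +kernel)
      sector_explored hQ hx hg hxQ
    exact ⟨w, y, hw, h.imp_right fun ⟨k, hk, h⟩ => ⟨k, hk, by simpa using h⟩⟩
  have hmid : ∀ x, sector.At x 4 → midPoly.Mem x := fun x hx =>
    Dom.bounds_sound (by decide +kernel) (Tree.entails_sound (T := sectorTree) (f := Nat.beq 4)
      (D := wedge) (D' := [(0, (0, 0)), (5, (0, 0)), (10, (108, 72)), (3, (-108, -36))])
      (by decide +kernel) hx.2 rfl hx.1)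
  by_cases h4 : k = 4
  · subst h4
    exact key midPoly (by simp [sectorStart]) x hx.1 hg (hmid x hx)
  obtain rfl : k = 5 := by simpa [isFarLetter, h4] using hk
  have hy := sector_closed x 5 hx.1 hx.2
  have hgy : Generic (sector.step 5 x) := hg.act _
  obtain ⟨l, hl⟩ := sectorTree.exists_at hgy
  have hrun : sector.Run x [5] (sector.step 5 x) := ⟨hx, rfl⟩
  by_cases hf : isFarLetter l = true
  · by_cases h5 : l = 4
    · subst h5
      obtain ⟨w, y, hw, h⟩ := key midPoly (by simp [sectorStart]) _ hy hgy (hmid _ ⟨hy, hl⟩)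
      exact ⟨[5] ++ w, y, PMap.run_append.2 ⟨_, hrun, hw⟩, h⟩
    obtain rfl : l = 5 := by simpa [isFarLetter, h5] using hf
    refine key farPoly (by simp [sectorStart]) x hx.1 hg ?_
    have h1 := Tree.entails_sound (T := sectorTree) (f := Nat.beq 5) (D := wedge)
      (D' := [(11, (144, 72)), (0, (0, 0)), (5, (0, 0)), (4, (-108, -72))])
      (by decide +kernel) hx.2 rfl hx.1
    have h2 := Tree.entails_sound (T := sectorTree) (f := Nat.beq 5) (D := wedge)
      (D' := [(11, (144, 72))]) (by decide +kernel) hl rfl hy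
    exact Dom.bounds_sound (by decide +kernel)
      (Dom.mem_set_append.2 ⟨h1, Dom.mem_pull.2 h2⟩)
  · exact ⟨[5], _, hrun, Or.inr ⟨l, ⟨hy, hl⟩, by simpa using hf⟩⟩

/-! ### Every generic periodic orbit reaches an island -/

namespace PMap

variable {α : Type*} {S : PMap α}

/-- The word read from another point of the orbit is a rotation of u. It is enough to record that
the letters are the same, since weights and lengths depend on nothing else. -/
theorem Run.cycle (hS : S.Det) {x y : α} {u v : List ℕ} (hu : S.Run x u x) (hne : u ≠ [])
    (hv : S.Run x v y) : ∃ u', u'.Perm u ∧ S.Run y u' y := by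
  induction v generalizing x u with
  | nil => exact ⟨u, List.Perm.refl _, hv ▸ hu⟩
  | cons k v ih =>
    cases u with
    | nil => exact absurd rfl hne
    | cons l u =>
      obtain rfl := hS x k l hv.1 hu.1
      obtain ⟨u', h1, h2⟩ := ih (u := u ++ [k]) (run_append.2 ⟨x, hu.2, hu.1, rfl⟩) (by simp) hv.2
      exact ⟨u', h1.trans (List.perm_append_singleton k u), h2⟩

theorem Prim.cycle (hS : S.Det) {x y : α} {u v : List ℕ} (hu : S.Prim x u) (hv : S.Run x v y) :
    ∃ u', u'.Perm u ∧ S.Prim y u' := by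
  induction v generalizing x u with
  | nil => exact ⟨u, List.Perm.refl _, hv ▸ hu⟩
  | cons k v ih =>
    cases u with
    | nil => exact absurd rfl hu.1
    | cons l u =>
      obtain rfl := hS x k l hv.1 hu.2.1.1
      obtain ⟨u', h1, h2⟩ := ih (u := u ++ [k])
        (Prim.rotate hS (u := [k]) hu (run_singleton.2 ⟨hv.1, rfl⟩)) hv.2
      exact ⟨u', h1.trans (List.perm_append_singleton k u), h2⟩

theorem Prim.unique (hS : S.Det) {x : α} {u v : List ℕ} (hu : S.Prim x u) (hv : S.Prim x v) :
    u = v :=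
  (hu.2.1.eq_of_length hS hv.2.1
    ((hu.2.2 v hv.1 hv.2.1).antisymm (hv.2.2 u hu.1 hu.2.1))).1

theorem exists_at_of_mem {x y : α} {w : List ℕ} {k : ℕ} (h : S.Run x w y) (hk : k ∈ w) :
    ∃ v z, S.Run x v z ∧ S.At z k := by
  obtain ⟨u, v, rfl⟩ := List.append_of_mem hk
  obtain ⟨z, hz, hv⟩ := run_append.1 h
  exact ⟨u, z, hz, hv.1⟩

end PMap

open PMap

theorem Island.lift {S S' : PMap Pt} {e : Pt → Pt} {σ : ℕ → List ℕ} {D : Set Pt} {K : Set Pt}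
    {z : Pt} {w : List ℕ} (hS : S.Det) (hS' : S'.Det) (hI : Induced S S' e σ D)
    (h : Island S' K z w) : Island S (e '' K) (e z) (w.flatMap σ) where
  mem := ⟨z, h.mem, rfl⟩
  prim := hI.prim hS hS' h.prim
  run := by
    rintro _ ⟨x, hx, rfl⟩
    obtain ⟨y, hy, hr⟩ := h.run x hx
    exact ⟨e y, ⟨y, hy, rfl⟩, hI.lift hr⟩

theorem Island.run_rep {S : PMap Pt} {K : Set Pt} {z : Pt} {w : List ℕ} (h : Island S K z w)
    (n : ℕ) {x : Pt} (hx : x ∈ K) : ∃ y ∈ K, S.Run x (List.replicate n w).flatten y := by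
  induction n generalizing x with
  | zero => exact ⟨x, hx, rfl⟩
  | succ n ih =>
    obtain ⟨y, hy, h1⟩ := h.run x hx
    obtain ⟨z, hz, h2⟩ := ih hy
    refine ⟨z, hz, ?_⟩
    rw [List.replicate_succ, List.flatten_cons]
    exact run_append.2 ⟨y, h1, h2⟩

/-- The |u|-th power of w and the |w|-th power of u are words of equal length that both occur from
x, so they coincide; x and z thus return with a common word. -/
theorem Island.sameItinerary {S : PMap Pt} (hS : S.Det) {K : Set Pt} {x z : Pt} {u w : List ℕ}
    (h : Island S K z w) (hx : x ∈ K) (hu : S.Run x u x) (hne : u ≠ []) :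
    S.SameItinerary x z := by
  obtain ⟨y, -, h1⟩ := h.run_rep u.length hx
  have h2 := hu.rep w.length
  have hl : (List.replicate u.length w).flatten.length =
      (List.replicate w.length u).flatten.length := by
    simp [mul_comm]
  obtain ⟨h3, rfl⟩ := h1.eq_of_length hS h2 hl
  refine sameItinerary_of_run hS ?_ h1 (h.prim.2.1.rep _)
  intro h4
  have h5 := congrArg List.length h4
  have h6 := List.length_pos_iff.2 hne
  have h7 := List.length_pos_iff.2 h.prim.1
  simp at h5
  simp_all

theorem near_det : near.Det := treeMap_det _ _ _

theorem sector_det : sector.Det := treeMap_det _ _ _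

theorem mem_F_of_nearIslands {e : Entry 8} (he : e ∈ nearIslands) : e.1 ∈ F := by
  have h : ∀ e ∈ nearIslands, e.1 ∈ nearIslands.map Prod.fst := fun e he => List.mem_map_of_mem he
  have h1 := h e he
  simp only [nearIslands, List.map_cons, List.map_nil, List.mem_cons, List.not_mem_nil,
    or_false] at h1
  simpa only [F, Set.mem_insert_iff, Set.mem_singleton_iff] using h1

theorem exists_nearIsland {f : Fin 8 → ℕ} (hf : f ∈ F) : ∃ e ∈ nearIslands, e.1 = f := by
  have h : f ∈ nearIslands.map Prod.fst := by
    simp only [F, Set.mem_insert_iff, Set.mem_singleton_iff] at hf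
    simpa only [nearIslands, List.map_cons, List.map_nil, List.mem_cons, List.not_mem_nil,
      or_false] using hf
  obtain ⟨e, he, h⟩ := List.mem_map.1 h
  exact ⟨e, he, h⟩

theorem mem_G_of_farIslands {e : Entry 6} (he : e ∈ farIslands) : e.1 ∈ G := by
  have h : ∀ e ∈ farIslands, e.1 ∈ farIslands.map Prod.fst := fun e he => List.mem_map_of_mem he
  have h1 := h e he
  simp only [farIslands, List.map_cons, List.map_nil, List.mem_cons, List.not_mem_nil,
    or_false] at h1
  simpa only [G, Set.mem_insert_iff, Set.mem_singleton_iff] using h1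

theorem exists_farIsland {g : Fin 6 → ℕ} (hg : g ∈ G) : ∃ e ∈ farIslands, e.1 = g := by
  have h : g ∈ farIslands.map Prod.fst := by
    simp only [G, Set.mem_insert_iff, Set.mem_singleton_iff] at hg
    simpa only [farIslands, List.map_cons, List.map_nil, List.mem_cons, List.not_mem_nil,
      or_false] using hg
  obtain ⟨e, he, h⟩ := List.mem_map.1 h
  exact ⟨e, he, h⟩

theorem exists_near_at {x : Pt} (hx : x ∈ nearDomain.set) (hg : Generic x) :
    ∃ k, near.At x k :=
  let ⟨k, hk⟩ := nearTree.exists_at hg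
  ⟨k, hx, hk⟩

theorem near_step (x : Pt) (k : ℕ) (hx : x ∈ nearDomain.set ∧ Generic x) (hk : near.At x k) :
    near.step k x ∈ nearDomain.set ∧ Generic (near.step k x) :=
  ⟨near_closed x k hk.1 hk.2, hx.2.act _⟩

theorem length_lt_length_flatMap {σ : ℕ → List ℕ} {w : List ℕ} (hne : w ≠ [])
    (h : ∀ k ∈ w, 1 < (σ k).length) : w.length < (w.flatMap σ).length := by
  induction w with
  | nil => exact absurd rfl hne
  | cons k w ih =>
    have h1 := h k List.mem_cons_self
    rw [List.flatMap_cons, List.length_append, List.length_cons]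
    by_cases hw : w = []
    · subst hw
      simpa using h1
    · have := ih hw fun l hl => h l (List.mem_cons_of_mem _ hl)
      omega

theorem near_letter_lt {x y : Pt} {w : List ℕ} (h : near.Run x w y) : ∀ k ∈ w, k < 8 := by
  intro k hk
  obtain ⟨v, z, -, hz⟩ := exists_at_of_mem h hk
  exact (mem_nearCell hz.1 hz.2).1

/-- Descent on the length of the word. If no island is met, the orbit enters `scaledDomain`;
magnified, it is an orbit of `near` with a shorter word, because every return word has more than one
letter. Each level contributes one factor `M88`. -/
theorem near_reach {x : Pt} (hg : Generic x) {u : List ℕ} (hu : u ≠ []) (h : near.Run x u x) :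
    ∃ v y K z w, near.Run x v y ∧ y ∈ K ∧ Island near K z w ∧
      ∃ f ∈ F, ∃ n : ℕ, weigh nearWeight w = M88 ^ n *ᵥ f := by
  induction hn : u.length using Nat.strong_induction_on generalizing x u with
  | _ n ih =>
    have hx : x ∈ nearDomain.set := by
      cases u with
      | nil => exact absurd rfl hu
      | cons k u => exact h.1.1
    obtain ⟨v, y, hv, hy⟩ := near_cover hx hg
    rcases hy with ⟨e, he, hy⟩ | hy
    · obtain ⟨w, hw, hwe⟩ := near_islands he
      exact ⟨v, y, _, _, w, hv, hy, hw, e.1, mem_F_of_nearIslands he, 0, by simp [hwe]⟩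
    obtain ⟨u', hp, hu'⟩ := h.cycle near_det hu hv
    obtain ⟨x', rfl⟩ : ∃ x', shrink x' = y :=
      ⟨(7 - 4 * √3)⁻¹ • y, smul_inv_smul₀ Surd.scale_pos.ne' y⟩
    have hgx' : Generic x' := generic_of_smul (treeMap_generic hg hv)
    have hx' := shrink_mem_scaledDomain.1 hy
    obtain ⟨w', y', hw', hflat, hy'⟩ := shrink_induced.decode near_det
      (Q := fun x => x ∈ nearDomain.set ∧ Generic x)
      (fun x hx => exists_near_at hx.1 hx.2)
      near_step (x := x') (And.intro hx' hgx') hu' hy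
    obtain rfl := shrink_injective hy'
    have hu0 : u' ≠ [] := by
      rintro rfl
      exact hu hp.nil_eq.symm
    have hw0 : w' ≠ [] := by
      rintro rfl
      exact hu0 hflat
    have hlt : w'.length < n := by
      rw [← hn, ← hp.length_eq, hflat]
      refine length_lt_length_flatMap hw0 fun k hk => ?_
      have h8 : ∀ k < 8, 1 < (returnWord k).length := by decide +kernel
      exact h8 k (near_letter_lt hw' k hk)
    obtain ⟨v', y', K, z, w, h1, h2, h3, f, hf, m, h4⟩ := ih _ hlt hgx' hw0 hw' rfl
    refine ⟨v ++ v'.flatMap returnWord, shrink y', shrink '' K, _, _,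
      run_append.2 ⟨_, hv, shrink_induced.lift h1⟩, ⟨y', h2, rfl⟩,
      h3.lift near_det near_det shrink_induced, f, hf, m + 1, ?_⟩
    rw [weigh_returnWord, h4, Matrix.mulVec_mulVec, pow_succ']

/-- The weights of the islands of `sector` whose words have no letter 6. -/
def IsBase (w : List ℕ) : Prop :=
  (∃ f ∈ F, ∃ n : ℕ, weigh sectorWeight w = (M68 * M88 ^ n) *ᵥ f) ∨
    weigh sectorWeight w ∈ G ∧ isNotSquare w = true

theorem sector_at_le {x : Pt} {k : ℕ} (h : sector.At x k) : 1 ≤ k ∧ k ≤ 6 := by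
  have h1 : ∀ p ∈ sectorTree.paths, 1 ≤ p.1 ∧ p.1 ≤ 6 := by decide
  obtain ⟨E, hE, -⟩ := Tree.at_iff_paths.1 h.2
  exact h1 _ hE

theorem sector_reach {x : Pt} (hg : Generic x) {u : List ℕ} (hu : u ≠ [])
    (h : sector.Run x u x) (h6 : 6 ∉ u) :
    ∃ v y K z w, sector.Run x v y ∧ y ∈ K ∧ Island sector K z w ∧ IsBase w := by
  by_cases hfar : ∀ k ∈ u, isFarLetter k = true
  · obtain ⟨k, u, rfl⟩ := List.exists_cons_of_ne_nil hu
    obtain ⟨v, y, hv, h1⟩ := sector_cover h.1 (hfar k List.mem_cons_self) hg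
    rcases h1 with ⟨e, he, hy⟩ | ⟨l, hl, hl'⟩
    · obtain ⟨w, h2, h3, h4⟩ := far_islands he
      exact ⟨v, y, _, _, w, hv, hy, h2, Or.inr ⟨h3 ▸ mem_G_of_farIslands he, h4⟩⟩
    -- From y the periodic orbit reads the letters of u again, and these are all 4 or 5.
    · exfalso
      obtain ⟨u', hp, hu'⟩ := h.cycle sector_det hu hv
      cases u' with
      | nil => exact absurd hp.nil_eq (by simp)
      | cons k' u' =>
        obtain rfl := sector_det _ _ _ hl hu'.1
        rw [hfar l (hp.subset List.mem_cons_self)] at hl'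
        exact absurd hl' (by simp)
  · push Not at hfar
    obtain ⟨k, hk, hkf⟩ := hfar
    obtain ⟨v, y, hv, hy⟩ := exists_at_of_mem h hk
    have hk3 := sector_at_le hy
    have hyD : y ∈ nearDomain.set := by
      refine Tree.entails_sound (T := sectorTree) (f := fun k => Nat.ble k 3) (D := wedge)
        (by decide +kernel) hy.2 ?_ hy.1
      have h1 : k ≠ 6 := by rintro rfl; exact h6 hk
      rcases hk3 with ⟨h2, h3⟩
      interval_cases k <;> simp_all [isFarLetter]
    obtain ⟨u', hp, hu'⟩ := h.cycle sector_det hu hv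
    have hgy : Generic y := treeMap_generic hg hv
    obtain ⟨w', y', hw', hflat, hy'⟩ := near_induced.decode sector_det
      (Q := fun x => x ∈ nearDomain.set ∧ Generic x)
      (fun x hx => exists_near_at hx.1 hx.2)
      near_step (x := y) (And.intro hyD hgy) hu' hyD
    obtain rfl : y = y' := hy'
    have hw0 : w' ≠ [] := by
      rintro rfl
      rw [hflat] at hp
      exact hu hp.nil_eq.symm
    obtain ⟨v', y', K, z, w, h1, h2, h3, f, hf, m, h4⟩ := near_reach hgy hw0 hw'
    refine ⟨v ++ v'.flatMap nearWord, y', id '' K, _, _,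
      run_append.2 ⟨_, hv, near_induced.lift h1⟩, ⟨y', h2, rfl⟩,
      h3.lift sector_det near_det near_induced, Or.inl ⟨f, hf, m, ?_⟩⟩
    rw [weigh_nearWord, h4, Matrix.mulVec_mulVec]

/-! ### Rotation of words, and points with the same itinerary -/

/-- Unless 12 ∣ r, some multiple of r is congruent to 6 or 4 modulo 12, and the rotations by 180°
and 120° fix only 0. -/
theorem turn_iterate_eq_self {r : ℕ} (hr : ¬12 ∣ r) {v : Pt} (h : turn^[r] v = v) : v = 0 := by
  have hmul : ∀ m, turn^[m * r] v = v := by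
    intro m
    rw [mul_comm, Function.iterate_mul]
    exact Function.iterate_fixed h m
  have h6 : turn^[6] v = v → v = 0 := by
    intro h
    rw [turn_six] at h
    exact self_eq_neg.1 h.symm
  have h4 : turn^[4] v = v → v = 0 := by
    intro h
    have h3 := Surd.sqrt3_sq
    have hs : √3 ≠ 0 := by positivity
    simp only [Function.iterate_succ_apply, Function.iterate_zero_apply, turn, Prod.ext_iff] at h
    obtain ⟨ha, hb⟩ := h
    have h1 : v.1 = 0 := by
      have : √3 * v.1 = 0 := by
        linear_combination -hb + (√3 * √3 * v.2 - √3 * v.1) * h3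
      exact (mul_eq_zero.1 this).resolve_left hs
    have h2 : v.2 = 0 := by
      have : √3 * v.2 = 0 := by
        linear_combination ha - √3 * v.2 * h3 + √3 * √3 * h1
      exact (mul_eq_zero.1 this).resolve_left hs
    exact Prod.ext h1 h2
  have hmod : ∀ m n, m * r % 12 = n → turn^[n] v = v := by
    intro m n hm
    rw [← hm, turn_iterate_mod, hmul]
  have hlt := Nat.mod_lt r (show 12 > 0 by norm_num)
  have h0 : r % 12 ≠ 0 := fun h => hr (Nat.dvd_of_mod_eq_zero h)
  have hcases : 1 * r % 12 = 6 ∨ 2 * r % 12 = 6 ∨ 3 * r % 12 = 6 ∨ 6 * r % 12 = 6 ∨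
      1 * r % 12 = 4 ∨ 2 * r % 12 = 4 := by omega
  rcases hcases with h | h | h | h | h | h
  · exact h6 (hmod _ _ h)
  · exact h6 (hmod _ _ h)
  · exact h6 (hmod _ _ h)
  · exact h6 (hmod _ _ h)
  · exact h4 (hmod _ _ h)
  · exact h4 (hmod _ _ h)

/-- The composed motion of a word turns by this multiple of 30°. -/
def rot (w : List ℕ) : ℕ := (w.map fun k => (moveAt sectorMaps k).1).sum

theorem rot_append (u v : List ℕ) : rot (u ++ v) = rot u + rot v := by simp [rot]

theorem rot_replicate (m : ℕ) (w : List ℕ) : rot (List.replicate m w).flatten = m * rot w := by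
  induction m with
  | zero => simp [rot]
  | succ m ih => rw [List.replicate_succ, List.flatten_cons, rot_append, ih]; ring

theorem exists_translation (w : List ℕ) :
    ∃ t, ∀ x y, sector.Run x w y → y = turn^[rot w] x + t := by
  induction w with
  | nil => exact ⟨0, fun x y h => by rw [add_zero]; exact (run_nil.1 h).symm⟩
  | cons k w ih =>
    obtain ⟨t, ht⟩ := ih
    refine ⟨turn^[rot w] ((moveAt sectorMaps k).2.1.val, (moveAt sectorMaps k).2.2.val) + t,
      fun x y h => ?_⟩
    rw [ht _ _ h.2]
    change turn^[rot w] (turn^[_] x + _) + t = _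
    rw [turn_iterate_add, ← Function.iterate_add_apply, add_assoc]
    simp [rot, add_comm]

/-- The motion is a translation with the fixed point z, hence the identity. -/
theorem eq_of_run_of_dvd {w : List ℕ} (h : 12 ∣ rot w) {x y z : Pt} (hz : sector.Run z w z)
    (hx : sector.Run x w y) : y = x := by
  obtain ⟨t, ht⟩ := exists_translation w
  have h0 : ∀ v, turn^[rot w] v = v := by
    intro v
    rw [← turn_iterate_mod, Nat.mod_eq_zero_of_dvd h]
    rfl
  have h1 := ht _ _ hz
  have h2 := ht _ _ hx
  rw [h0] at h1 h2
  rw [h2, left_eq_add.1 h1, add_zero]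

/-- A motion that turns by a nonzero angle has at most one fixed point. -/
theorem eq_of_run_of_not_dvd {w : List ℕ} (h : ¬12 ∣ rot w) {x z : Pt} (hz : sector.Run z w z)
    (hx : sector.Run x w x) : x = z := by
  obtain ⟨t, ht⟩ := exists_translation w
  have h1 := ht _ _ hz
  have h2 := ht _ _ hx
  refine sub_eq_zero.1 (turn_iterate_eq_self h ?_)
  have h3 : turn^[rot w] (x - z) = turn^[rot w] x - turn^[rot w] z := by
    rw [eq_sub_iff_add_eq, ← turn_iterate_add, sub_add_cancel]
  rw [h3]
  nth_rewrite 2 [h1]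
  nth_rewrite 2 [h2]
  abel

/-- The order of the rotation by `30° r`. -/
def ord (r : ℕ) : ℕ := 12 / Nat.gcd 12 r

theorem dvd_mul_iff_ord_dvd {m r : ℕ} : 12 ∣ m * r ↔ ord r ∣ m := by
  have h1 := ZMod.addOrderOf_coe r (n := 12) (by norm_num)
  rw [ord, ← h1, addOrderOf_dvd_iff_nsmul_eq_zero, nsmul_eq_mul, ← Nat.cast_mul,
    ZMod.natCast_eq_zero_iff]

theorem ord_mul_dvd (r : ℕ) : 12 ∣ ord r * r := dvd_mul_iff_ord_dvd.2 dvd_rfl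

theorem ord_pos (r : ℕ) : 0 < ord r :=
  Nat.div_pos (Nat.gcd_le_left _ (by norm_num)) (Nat.gcd_pos_of_pos_left _ (by norm_num))

theorem replicate_flatten_ne_nil {w : List ℕ} (hw : w ≠ []) {m : ℕ} (hm : 0 < m) :
    (List.replicate m w).flatten ≠ [] := by
  obtain ⟨m, rfl⟩ := Nat.exists_eq_succ_of_ne_zero hm.ne'
  simp [List.replicate_succ, hw]

/-- The second word is the first one repeated, as often as the order of its rotation says. -/
def IsPower (u w : List ℕ) : Prop := w = (List.replicate (ord (rot u)) u).flatten

theorem run_of_sameItinerary {x z : Pt} {w : List ℕ} (h : sector.SameItinerary x z)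
    (hz : sector.Run z w z) : ∃ y, sector.Run x w y :=
  (h w).2 ⟨z, hz⟩

/-- The motion of w is the identity, so x also returns with w, and w is a power of u whose exponent
is a multiple of the order of `rot u`. Conversely z returns with the power of u that has this order
as exponent, and minimality of w gives equality. -/
theorem eq_or_isPower_of_dvd {x z : Pt} {u w : List ℕ} (hu : sector.Prim x u)
    (hw : sector.Prim z w) (h : sector.SameItinerary x z) (hr : 12 ∣ rot w) :
    u = w ∨ IsPower u w := by
  have h1 : sector.Run x w x := by
    obtain ⟨y, hy⟩ := run_of_sameItinerary h hw.2.1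
    rwa [eq_of_run_of_dvd hr hw.2.1 hy] at hy
  obtain ⟨m, hm⟩ := hu.exists_rep sector_det h1
  have h2 : ord (rot u) ∣ m := by
    rw [← dvd_mul_iff_ord_dvd, ← rot_replicate, ← hm]
    exact hr
  have h3 : sector.Run z (List.replicate (ord (rot u)) u).flatten z := by
    have h4 := hu.2.1.rep (ord (rot u))
    obtain ⟨y, hy⟩ := run_of_sameItinerary h.symm h4
    rwa [eq_of_run_of_dvd (by rw [rot_replicate]; exact ord_mul_dvd _) h4 hy] at hy
  have h5 := hw.2.2 _ (replicate_flatten_ne_nil hu.1 (ord_pos _)) h3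
  have hupos := List.length_pos_iff.2 hu.1
  have hm0 : 0 < m := by
    rcases Nat.eq_zero_or_pos m with rfl | h0
    · exact absurd hm hw.1
    · exact h0
  rw [hm] at h5
  simp only [List.length_flatten, List.map_replicate, List.sum_replicate, smul_eq_mul] at h5
  have h6 : m = ord (rot u) :=
    (Nat.le_of_mul_le_mul_right h5 hupos).antisymm (Nat.le_of_dvd hm0 h2)
  right
  rw [IsPower, hm, h6]

/-- If neither motion is a translation, w takes x to a point y that has the itinerary of x and also
returns with u. As u has just one fixed point, y = x; so x returns with w and equals z. -/
theorem eq_or_isPower {x z : Pt} {u w : List ℕ} (hu : sector.Prim x u)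
    (hw : sector.Prim z w) (h : sector.SameItinerary x z) :
    u = w ∨ IsPower u w ∨ IsPower w u := by
  by_cases hr : 12 ∣ rot w
  · exact (eq_or_isPower_of_dvd hu hw h hr).imp_right Or.inl
  by_cases hr' : 12 ∣ rot u
  · exact (eq_or_isPower_of_dvd hw hu h.symm hr').elim (fun h => Or.inl h.symm)
      fun h => Or.inr (Or.inr h)
  obtain ⟨y, hy⟩ := run_of_sameItinerary h hw.2.1
  have h1 : sector.SameItinerary y x := (h.run hy hw.2.1).trans h.symm
  have h2 : sector.Run y u y := by
    obtain ⟨u', hp, hu'⟩ := hu.cycle sector_det hy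
    obtain ⟨y', hy'⟩ := run_of_sameItinerary h1 hu.2.1
    obtain ⟨h3, -⟩ := hu'.2.1.eq_of_length sector_det hy' hp.length_eq
    exact h3 ▸ hu'.2.1
  obtain rfl := eq_of_run_of_not_dvd hr' hu.2.1 h2
  obtain rfl := eq_of_run_of_not_dvd hr hw.2.1 hy
  exact Or.inl (hu.unique sector_det hw)

/-! ### Generic neighbours of periodic points -/

theorem continuous_turn_iterate (n : ℕ) : Continuous turn^[n] := by
  refine Continuous.iterate ?_ n
  unfold turn
  fun_prop

theorem continuous_form (i : ℕ) : Continuous (form i) :=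
  continuous_fst.comp (continuous_turn_iterate i)

theorem isOpen_tree_at (T : Tree) (k : ℕ) : IsOpen {x | T.At x k} := by
  induction T with
  | leaf l => exact isOpen_const
  | node i c l r ihl ihr =>
    exact ((isOpen_lt (continuous_form i) continuous_const).inter ihl).union
      ((isOpen_lt continuous_const (continuous_form i)).inter ihr)

theorem isOpen_dom (D : Dom) : IsOpen D.set := by
  induction D with
  | nil => convert isOpen_univ; ext x; simp [Dom.mem_set_nil]
  | cons p D ih =>
    have : Dom.set (p :: D) = {x | form p.1 x < p.2.val} ∩ Dom.set D := by
      ext x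
      exact Dom.mem_set_cons
    rw [this]
    exact (isOpen_lt (continuous_form _) continuous_const).inter ih

theorem continuous_act (m : Move) : Continuous m.act :=
  (continuous_turn_iterate _).add continuous_const

theorem isOpen_run (w : List ℕ) : IsOpen {x | ∃ y, sector.Run x w y} := by
  induction w with
  | nil => convert isOpen_univ; ext x; simp [run_nil]
  | cons k w ih =>
    have : {x | ∃ y, sector.Run x (k :: w) y} =
        (wedge.set ∩ {x | sectorTree.At x k}) ∩
          (moveAt sectorMaps k).act ⁻¹' {x | ∃ y, sector.Run x w y} := by
      ext x
      simp only [run_cons, exists_and_left]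
      rfl
    rw [this]
    exact ((isOpen_dom _).inter (isOpen_tree_at _ _)).inter (ih.preimage (continuous_act _))

/-- A line through x in a direction on which no form vanishes meets each of the countably many
forbidden lines at most once. -/
theorem exists_generic {U : Set Pt} (hU : IsOpen U) {x : Pt} (hx : x ∈ U) :
    ∃ y ∈ U, Generic y ∧ y ≠ x := by
  let d : Pt := (1, 1)
  have hd : ∀ i, form i d ≠ 0 := by
    intro i
    have h3 := Surd.sqrt3_sq
    have hs : 0 ≤ √3 := Real.sqrt_nonneg 3
    have h1 : √3 < 2 := by nlinarith
    have h2 : 1 < √3 := by nlinarith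
    rw [← form_mod]
    have hi := Nat.mod_lt i (show 12 > 0 by norm_num)
    have key : ∀ j < 6, form j d ≠ 0 := by
      intro j hj
      interval_cases j <;>
        simp only [form, Function.iterate_succ_apply, Function.iterate_zero_apply, turn, d] <;>
        intro h <;> nlinarith
    by_cases hi6 : i % 12 < 6
    · exact key _ hi6
    · rw [show i % 12 = (i % 12 - 6) + 6 by omega, form_add_six]
      exact neg_ne_zero.2 (key _ (by omega))
  let bad : Set ℝ := {0} ∪ ⋃ i : ℕ, ⋃ q : ℚ, ⋃ r : ℚ, {s | form i (x + s • d) = q + r * √3}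
  have hbad : bad.Countable := by
    refine (Set.countable_singleton 0).union (Set.countable_iUnion fun i =>
      Set.countable_iUnion fun q => Set.countable_iUnion fun r => ?_)
    refine Set.Subsingleton.countable fun s hs t ht => ?_
    simp only [Set.mem_ofPred_eq, form_add, form_smul] at hs ht
    exact mul_right_cancel₀ (hd i) (by linarith)
  have hopen : IsOpen {s : ℝ | x + s • d ∈ U} := hU.preimage (by fun_prop)
  obtain ⟨s, hs, hsb⟩ := (hbad.dense_compl ℝ).inter_open_nonempty _ hopen ⟨0, by simpa using hx⟩
  refine ⟨x + s • d, hs, fun i q r h => hsb (Or.inr ?_), fun h => hsb (Or.inl ?_)⟩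
  · simp only [Set.mem_iUnion]
    exact ⟨i, q, r, h⟩
  · have h1 : s • d = 0 := by simpa using h
    simpa [d] using h1

/-- The generic neighbour q has the itinerary of x and is periodic, so `sector_reach` leads it to an
island. Moving x along with it gives a point with the same itinerary as the periodic point z of the
island, and `eq_or_isPower` compares the two words. -/
theorem exists_island_of_prim {x : Pt} {w : List ℕ} (hw : sector.Prim x w) (h6 : 6 ∉ w) :
    ∃ u v y z, sector.Prim y u ∧ sector.Prim z v ∧ u.Perm w ∧ IsBase v ∧ (u = v ∨ IsPower u v ∨ IsPower v u) := by
  -- Twelve repetitions cancel any rotation, so they fix every point that has this word.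
  have hrep := hw.2.1.rep 12
  have hne := replicate_flatten_ne_nil hw.1 (m := 12) (by norm_num)
  obtain ⟨q, ⟨q', hq⟩, hgq, -⟩ := exists_generic
    (isOpen_run (List.replicate 12 w).flatten) (x := x) ⟨x, hrep⟩
  obtain rfl := eq_of_run_of_dvd (by rw [rot_replicate]; exact dvd_mul_right _ _) hrep hq
  have h6' : 6 ∉ (List.replicate 12 w).flatten := by
    intro h
    obtain ⟨l, hl, h⟩ := List.mem_flatten.1 h
    exact h6 (List.eq_of_mem_replicate hl ▸ h)
  obtain ⟨v, y, K, z, wz, hv, hy, hK, hb⟩ := sector_reach hgq hne hq h6'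
  have hsame := sameItinerary_of_run sector_det hne hrep hq
  obtain ⟨x', hx'⟩ := (hsame v).2 ⟨y, hv⟩
  obtain ⟨u, hu, hprim⟩ := hw.cycle sector_det hx'
  obtain ⟨u', hu', hy'⟩ := hq.cycle sector_det hne hv
  have hne' : u' ≠ [] := by
    rintro rfl
    exact hne hu'.nil_eq.symm
  have h1 := (hsame.run hx' hv).trans (hK.sameItinerary sector_det hy hy' hne')
  exact ⟨u, wz, x', z, hprim, hK.prim, hu, hb, eq_or_isPower hprim hK.prim h1⟩

/-! ### The translational self-similarity at cell 6 -/

/-- Checks that the conditions `E` for `x` imply that the orbit of `m.act x` has the word `w`. -/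
def follows (T : Tree) (maps : List Move) (D E : Dom) : Move → List ℕ → Bool
  | _, [] => true
  | m, k :: w => (T.paths.any fun p => p.1 == k &&
      ((D ++ p.2).pull m).all fun q => E.implies q.1 q.2) &&
    follows T maps D E ((moveAt maps k).comp m) w

def motion (maps : List Move) (m : Move) (w : List ℕ) : Move :=
  w.foldl (fun m k => (moveAt maps k).comp m) m

theorem follows_sound {T : Tree} {maps : List Move} (hm : ∀ m ∈ maps, m.1 < 12) {D E : Dom}
    {m : Move} {w : List ℕ} (h : follows T maps D E m w = true) {x : Pt} (hx : x ∈ E.set) :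
    (treeMap T maps D.set).Run (m.act x) w ((motion maps m w).act x) := by
  induction w generalizing m with
  | nil => rfl
  | cons k w ih =>
    rw [follows, Bool.and_eq_true, List.any_eq_true] at h
    obtain ⟨⟨⟨l, E'⟩, hp, h1⟩, h2⟩ := h
    rw [Bool.and_eq_true, beq_iff_eq, List.all_eq_true] at h1
    obtain ⟨rfl, h1⟩ := h1
    have h3 : m.act x ∈ Dom.set (D ++ E') :=
      Dom.mem_pull.1 fun q hq => Dom.implies_sound (h1 q hq) hx
    rw [Dom.mem_set_append] at h3
    refine ⟨⟨h3.1, Tree.at_iff_paths.2 ⟨E', hp, h3.2⟩⟩, ?_⟩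
    have h4 := ih h2
    rw [Move.act_comp (moveAt_lt hm _)] at h4
    exact h4

def sixWords : List (List ℕ) :=
  [[], [6, 5, 5, 5, 5, 5], [6, 5, 5, 5, 5], [6, 5, 5, 5], [6, 5, 5], [6, 5], [6]]

def sixWord (k : ℕ) : List ℕ := sixWords.getD k []

/-- The translation of `wedge` to the piece with label 6. -/
def sixShift : Move := (0, (0, 0), (-144, -72))

theorem sixShift_mem {x : Pt} : sector.At (sixShift.act x) 6 ↔ x ∈ wedge.set := by
  constructor
  · intro h
    have h1 := Tree.entails_sound (T := sectorTree) (f := Nat.beq 6) (D := wedge)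
      (D' := [(0, (0, 0)), (5, (-144, -72))]) (by decide +kernel) h.2 rfl h.1
    have h2 := Dom.mem_pull.2 h1
    rwa [show Dom.pull [(0, (0, 0)), (5, (-144, -72))] sixShift = wedge by decide] at h2
  · intro h
    exact (follows_sound (w := [6]) (D := wedge) sectorMaps_lt (by decide +kernel) h).1

theorem exists_sixShift_eq (y : Pt) : ∃ x, sixShift.act x = y :=
  ⟨y - (sixShift.2.1.val, sixShift.2.2.val), sub_add_cancel _ _⟩

/-- Some cells of `sector` are unbounded, so half-plane conditions are pulled back along the word
here, instead of a polygon being traced. -/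
theorem sixWord_run {x : Pt} {k : ℕ} (h : sector.At x k) :
    sector.Run (sixShift.act x) (sixWord k) (sixShift.act (sector.step k x)) := by
  have hc : ∀ p ∈ sectorTree.paths, follows sectorTree sectorMaps wedge (p.2 ++ wedge) sixShift
      (sixWord p.1) = true ∧
      motion sectorMaps sixShift (sixWord p.1) = sixShift.comp (moveAt sectorMaps p.1) := by
    decide +kernel
  obtain ⟨E, hE, hx⟩ := Tree.at_iff_paths.1 h.2
  obtain ⟨h1, h2⟩ := hc _ hE
  have h3 := follows_sound sectorMaps_lt h1 (Dom.mem_set_append.2 ⟨hx, h.1⟩)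
  rw [h2, Move.act_comp (by decide)] at h3
  exact h3

theorem sixWord_eq {k : ℕ} (h1 : 1 ≤ k) (h2 : k ≤ 6) :
    sixWord k = 6 :: List.replicate (6 - k) 5 := by
  interval_cases k <;> rfl

theorem six_induced : Induced sector sector sixShift.act sixWord {y | sector.At y 6} where
  inj := Move.act_injective _
  run _ _ h := sixWord_run h
  ne_nil x k h := by
    rw [sixWord_eq (sector_at_le h).1 (sector_at_le h).2]
    simp
  mem x k h := sixShift_mem.2 h.1
  first x k u v y h he hu hv hr hy := by
    have h1 := sixWord_run h
    rw [he] at h1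
    obtain ⟨z, hz, h2⟩ := run_append.1 h1
    obtain rfl := hr.unique hz
    obtain ⟨a, u, rfl⟩ := List.exists_cons_of_ne_nil hu
    obtain ⟨b, v, rfl⟩ := List.exists_cons_of_ne_nil hv
    -- After its first letter the word contains only 5, so cell 6 is not visited again before its
    -- end.
    rw [sixWord_eq (sector_at_le h).1 (sector_at_le h).2, List.cons_append, List.cons.injEq] at he
    have hb : b ∈ List.replicate (6 - k) 5 := by
      rw [he.2]
      simp
    obtain rfl := List.eq_of_mem_replicate hb
    exact absurd (sector_det _ _ _ h2.1 hy) (by norm_num)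

/-- Conditions for the points near the common side of the cells of the leaves `i` and `i + 1` of
`sectorTree`. -/
def boundaryDom (i : ℕ) : Dom :=
  match i with
  | 1 => (7, (37, 0)) :: wedge
  | 2 => (8, (37, 36)) :: (1, (-36, 0)) :: wedge
  | 3 => (9, (109, 36)) :: (2, (-36, -36)) :: wedge
  | 4 => (10, (109, 72)) :: (3, (-108, -36)) :: wedge
  | _ => (11, (145, 72)) :: (4, (-108, -72)) :: wedge

/-- The value of `form (i + 6)` on the common side of the cells of the leaves `i` and `i + 1`. -/
def boundaryValue (i : ℕ) : Surd :=
  [(0, 0), (36, 0), (36, 36), (108, 36), (108, 72), (144, 72)].getD i (0, 0)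

theorem exists_sector_at_or {x : Pt} (hx : x ∈ wedge.set) :
    (∃ k, sector.At x k) ∨ ∃ i, 1 ≤ i ∧ i ≤ 5 ∧ x ∈ (boundaryDom i).set ∧
      form (i + 6) x = (boundaryValue i).val := by
  -- The first bound in `boundaryDom` exceeds the value on the wall by 1/36, so it holds strictly on
  -- the wall.
  have hlt : ∀ a b : ℤ, Surd.val (a, b) < Surd.val (a + 1, b) := by
    intro a b
    simp only [Surd.val]
    push_cast
    linarith
  have hneg : ∀ (i : ℕ) (a b : ℤ), Surd.val (a, b) < form (i + 6) x →
      form i x < Surd.val (-a, -b) := by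
    intro i a b h
    rw [form_add_six] at h
    have h1 : Surd.val (-a, -b) = -Surd.val (a, b) := Surd.val_neg (a, b)
    rw [h1]
    linarith
  rcases lt_trichotomy (form 7 x) (Surd.val (36, 0)) with h1 | h1 | h1
  · exact Or.inl ⟨1, hx, Or.inl ⟨h1, rfl⟩⟩
  · exact Or.inr ⟨1, by norm_num, by norm_num, Dom.mem_set_cons.2 ⟨h1.trans_lt (hlt 36 0), hx⟩, h1⟩
  rcases lt_trichotomy (form 8 x) (Surd.val (36, 36)) with h2 | h2 | h2
  · exact Or.inl ⟨2, hx, Or.inr ⟨h1, Or.inl ⟨h2, rfl⟩⟩⟩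
  · exact Or.inr ⟨2, by norm_num, by norm_num, Dom.mem_set_cons.2 ⟨h2.trans_lt (hlt 36 36),
      Dom.mem_set_cons.2 ⟨hneg 1 36 0 h1, hx⟩⟩, h2⟩
  rcases lt_trichotomy (form 9 x) (Surd.val (108, 36)) with h3 | h3 | h3
  · exact Or.inl ⟨3, hx, Or.inr ⟨h1, Or.inr ⟨h2, Or.inl ⟨h3, rfl⟩⟩⟩⟩
  · exact Or.inr ⟨3, by norm_num, by norm_num, Dom.mem_set_cons.2 ⟨h3.trans_lt (hlt 108 36),
      Dom.mem_set_cons.2 ⟨hneg 2 36 36 h2, hx⟩⟩, h3⟩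
  rcases lt_trichotomy (form 10 x) (Surd.val (108, 72)) with h4 | h4 | h4
  · exact Or.inl ⟨4, hx, Or.inr ⟨h1, Or.inr ⟨h2, Or.inr ⟨h3, Or.inl ⟨h4, rfl⟩⟩⟩⟩⟩
  · exact Or.inr ⟨4, by norm_num, by norm_num, Dom.mem_set_cons.2 ⟨h4.trans_lt (hlt 108 72),
      Dom.mem_set_cons.2 ⟨hneg 3 108 36 h3, hx⟩⟩, h4⟩
  rcases lt_trichotomy (form 11 x) (Surd.val (144, 72)) with h5 | h5 | h5
  · exact Or.inl ⟨5, hx, Or.inr ⟨h1, Or.inr ⟨h2, Or.inr ⟨h3, Or.inr ⟨h4, Or.inl ⟨h5, rfl⟩⟩⟩⟩⟩⟩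
  · exact Or.inr ⟨5, by norm_num, by norm_num, Dom.mem_set_cons.2 ⟨h5.trans_lt (hlt 144 72),
      Dom.mem_set_cons.2 ⟨hneg 4 108 72 h4, hx⟩⟩, h5⟩
  · exact Or.inl ⟨6, hx, Or.inr ⟨h1, Or.inr ⟨h2, Or.inr ⟨h3, Or.inr ⟨h4, Or.inr ⟨h5, rfl⟩⟩⟩⟩⟩⟩

/-- The word carries the wall between the cells i and i + 1 to the wall between the cells 5 and 6.
The bound on form 4 rules out the cells up to 4; the condition that separates 5 from 6 becomes, when
pulled back, a strict inequality against `he`. -/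
theorem not_at_of_boundary {x : Pt} {i : ℕ} (h1 : 1 ≤ i) (h5 : i ≤ 5)
    (hx : x ∈ (boundaryDom i).set) (he : form (i + 6) x = (boundaryValue i).val) :
    ∃ y, sector.Run (sixShift.act x) (6 :: List.replicate (5 - i) 5) y ∧ ∀ k, ¬sector.At y k := by
  have hc : ∀ i ≤ 5, 1 ≤ i → follows sectorTree sectorMaps wedge (boundaryDom i) sixShift
      (6 :: List.replicate (5 - i) 5) = true := by
    decide +kernel
  have hc2 : ∀ i ≤ 5, 1 ≤ i → ∀ p ∈ Dom.pull [(4, (-108, -72))]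
      (motion sectorMaps sixShift (6 :: List.replicate (5 - i) 5)),
      (boundaryDom i).implies p.1 p.2 = true := by
    decide +kernel
  have hc3 : ∀ i ≤ 5, 1 ≤ i → ∀ p ∈ Dom.pull [(11, (144, 72))]
      (motion sectorMaps sixShift (6 :: List.replicate (5 - i) 5)),
      p.1 % 12 = i + 6 ∧ p.2 = boundaryValue i := by
    decide +kernel
  have hc4 : ∀ i ≤ 5, 1 ≤ i → ∀ p ∈ Dom.pull [(5, (-144, -72))]
      (motion sectorMaps sixShift (6 :: List.replicate (5 - i) 5)),
      p.1 % 12 = i ∧ p.2 = (boundaryValue i).neg := by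
    decide +kernel
  refine ⟨_, follows_sound sectorMaps_lt (hc i h5 h1) hx, fun k hk => ?_⟩
  have h10 := Dom.mem_pull.1 fun p hp => Dom.implies_sound (hc2 i h5 h1 p hp) hx
  by_cases hk4 : Nat.ble k 4 = true
  · have h := Tree.entails_sound (T := sectorTree) (f := fun k => Nat.ble k 4) (D := wedge)
      (D' := [(10, (108, 72))]) (by decide +kernel) hk.2 hk4 hk.1
    have h11 := h _ (List.mem_singleton_self _)
    have h12 := h10 _ (List.mem_singleton_self _)
    have h13 : Surd.val (-108, -72) = -Surd.val (108, 72) := Surd.val_neg (108, 72)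
    dsimp only at h11 h12
    rw [form_add_six 4] at h11
    rw [h13] at h12
    linarith
  · have hk6 := (sector_at_le hk).2
    have hk4' : ¬k ≤ 4 := fun h => hk4 (Nat.ble_eq_true_of_le h)
    obtain rfl | rfl : k = 5 ∨ k = 6 := by omega
    · have h := Tree.entails_sound (T := sectorTree) (f := Nat.beq 5) (D := wedge)
        (D' := [(11, (144, 72))]) (by decide +kernel) hk.2 rfl hk.1
      have h' := Dom.mem_pull.2 h
      have h3 := hc3 i h5 h1 _ (List.mem_singleton_self _)
      have h4 := h' _ (List.mem_singleton_self _)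
      rw [← form_mod, h3.1, h3.2, he] at h4
      exact h4.false
    · have h := Tree.entails_sound (T := sectorTree) (f := Nat.beq 6) (D := wedge)
        (D' := [(5, (-144, -72))]) (by decide +kernel) hk.2 rfl hk.1
      have h' := Dom.mem_pull.2 h
      have h3 := hc4 i h5 h1 _ (List.mem_singleton_self _)
      have h4 := h' _ (List.mem_singleton_self _)
      rw [← form_mod, h3.1, h3.2, Surd.val_neg, ← he, form_add_six, neg_neg] at h4
      exact h4.false

theorem weigh_sixWord (w : List ℕ) :
    weigh sectorWeight (w.flatMap sixWord) = M66 *ᵥ weigh sectorWeight w := by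
  refine weigh_flatMap (fun k => ?_) w
  by_cases hk : k < 7
  · revert k
    decide +kernel
  · have h1 : sixWord k = [] := List.getD_eq_default _ _ (by simpa [sixWords] using hk)
    have h2 : sectorWeight k = 0 := by
      funext j
      have hj := j.2
      have : Nat.beq (j + 1) k = false := by
        rw [Bool.eq_false_iff]
        intro h
        have := Nat.eq_of_beq_eq_true h
        omega
      simp [sectorWeight, this]
    rw [h1, h2, Matrix.mulVec_zero, weigh_nil]

/-- Step 6 is a translation, so an orbit that reads only 6 drifts away and is not periodic. -/
theorem six_decrease {x y : Pt} {w : List ℕ} (hr : sector.Run x w y) (h : ∀ k ∈ w, k = 6) :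
    form 0 y ≤ form 0 x - w.length := by
  induction w generalizing x with
  | nil => rw [run_nil.1 hr]; simp
  | cons k w ih =>
    obtain rfl := h k List.mem_cons_self
    have h1 := ih hr.2 fun l hl => h l (List.mem_cons_of_mem _ hl)
    have h2 : form 0 (sector.step 6 x) = form 0 x + Surd.val (-144, -72) := rfl
    have h3 : Surd.val (-144, -72) ≤ -1 := by
      have : 0 ≤ √3 := Real.sqrt_nonneg 3
      simp only [Surd.val]
      push_cast
      linarith
    push_cast [List.length_cons]
    linarith

theorem length_le_length_flatMap {σ : ℕ → List ℕ} {w : List ℕ}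
    (h : ∀ k ∈ w, 1 ≤ (σ k).length) : w.length ≤ (w.flatMap σ).length := by
  induction w with
  | nil => simp
  | cons k w ih =>
    have h1 := h k List.mem_cons_self
    have := ih fun l hl => h l (List.mem_cons_of_mem _ hl)
    rw [List.flatMap_cons, List.length_append, List.length_cons]
    omega

/-- An orbit through cell 6 is decoded by `six_induced`. The word becomes shorter because a letter k
has a word of 7 - k letters, and not all letters of the decoded word are 6. -/
theorem exists_prim_of_six_mem {p : Pt} {w : List ℕ} (hw : sector.Prim p w) (h6 : 6 ∈ w) :
    ∃ x w', sector.Prim x w' ∧ (w'.flatMap sixWord).Perm w ∧ w'.length < w.length := by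
  obtain ⟨v, y, hv, hy⟩ := exists_at_of_mem hw.2.1 h6
  obtain ⟨u, hu, hprim⟩ := hw.cycle sector_det hv
  obtain ⟨x, rfl⟩ := exists_sixShift_eq y
  have hx := sixShift_mem.1 hy
  -- The shifted point is periodic. If x were on a wall, `not_at_of_boundary` would make its orbit
  -- end, so the induced map is defined at x.
  let Q : Pt → Prop := fun x => x ∈ wedge.set ∧
    ∃ u, u ≠ [] ∧ sector.Run (sixShift.act x) u (sixShift.act x)
  have hQ : ∀ x, Q x → ∃ k, sector.At x k := by
    rintro x ⟨hx, u, hu, hr⟩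
    refine (exists_sector_at_or hx).resolve_right ?_
    rintro ⟨i, h1, h5, hd, he⟩
    obtain ⟨y, hy, hn⟩ := not_at_of_boundary h1 h5 hd he
    obtain ⟨u', hp, hu'⟩ := hr.cycle sector_det hu hy
    cases u' with
    | nil => exact hu hp.nil_eq.symm
    | cons k u' => exact hn k hu'.1
  have hstep : ∀ x k, Q x → sector.At x k → Q (sector.step k x) := by
    rintro x k ⟨hx, u, hu, hr⟩ hk
    obtain ⟨u', hp, hu'⟩ := hr.cycle sector_det hu (sixWord_run hk)
    refine ⟨sector_closed x k hx hk.2, u', ?_, hu'⟩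
    rintro rfl
    exact hu hp.nil_eq.symm
  obtain ⟨w1, x1, hw1, hflat, hx1⟩ := six_induced.decode sector_det hQ hstep
    (x := x) ⟨hx, u, hprim.1, hprim.2.1⟩ hprim.2.1 hy
  obtain rfl := Move.act_injective _ hx1
  have hw0 : w1 ≠ [] := by
    rintro rfl
    exact hprim.1 hflat
  obtain ⟨w', hw'⟩ := exists_prim hw0 hw1
  have h1 := six_induced.prim sector_det sector_det hw'
  obtain rfl := hprim.unique sector_det h1
  refine ⟨x, w', hw', hu, ?_⟩
  rw [← hu.length_eq]
  have hle : ∀ k ∈ w', 1 ≤ k ∧ k ≤ 6 := fun k hk =>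
    let ⟨_, _, _, hz⟩ := exists_at_of_mem hw'.2.1 hk
    sector_at_le hz
  have hlen : ∀ k ∈ w', (sixWord k).length = 7 - k := by
    intro k hk
    obtain ⟨h2, h3⟩ := hle k hk
    rw [sixWord_eq h2 h3, List.length_cons, List.length_replicate]
    omega
  obtain ⟨k, hk, hk6⟩ : ∃ k ∈ w', k ≠ 6 := by
    by_contra! hall
    have h2 := six_decrease hw'.2.1 hall
    have h3 := List.length_pos_iff.2 hw'.1
    have h4 : (0 : ℝ) < w'.length := by exact_mod_cast h3
    linarith
  obtain ⟨a, b, rfl⟩ := List.append_of_mem hk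
  have ha := length_le_length_flatMap (σ := sixWord) (w := a) fun l hl => by
    have hl' : l ∈ a ++ k :: b := by simp [hl]
    rw [hlen l hl']
    have := hle l hl'
    omega
  have hb := length_le_length_flatMap (σ := sixWord) (w := b) fun l hl => by
    have hl' : l ∈ a ++ k :: b := by simp [hl]
    rw [hlen l hl']
    have := hle l hl'
    omega
  have hk' := hlen k hk
  have := hle k hk
  rw [List.flatMap_append, List.flatMap_cons]
  simp only [List.length_append, List.length_cons]
  omega

theorem exists_prim_without_six {p : Pt} {w : List ℕ} (hw : sector.Prim p w) :
    ∃ x w', ∃ k : ℕ, sector.Prim x w' ∧ 6 ∉ w' ∧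
      weigh sectorWeight w = M66 ^ k *ᵥ weigh sectorWeight w' := by
  induction hn : w.length using Nat.strong_induction_on generalizing p w with
  | _ n ih =>
    by_cases h6 : 6 ∈ w
    · obtain ⟨x, w', hw', hp, hlt⟩ := exists_prim_of_six_mem hw h6
      obtain ⟨y, v, k, hv, hv6, he⟩ := ih _ (hn ▸ hlt) hw' rfl
      refine ⟨y, v, k + 1, hv, hv6, ?_⟩
      have h1 : weigh sectorWeight w = weigh sectorWeight (w'.flatMap sixWord) :=
        ((hp.map _).sum_eq).symm
      rw [h1, weigh_sixWord, he, Matrix.mulVec_mulVec, pow_succ']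
    · exact ⟨p, w, 0, hw, h6, by simp⟩

theorem exists_prim_pow {x : Pt} {w : List ℕ} (hw : sector.Prim x w) (k : ℕ) :
    ∃ y v, sector.Prim y v ∧ weigh sectorWeight v = M66 ^ k *ᵥ weigh sectorWeight w := by
  induction k with
  | zero => exact ⟨x, w, hw, by simp⟩
  | succ k ih =>
    obtain ⟨y, v, hv, he⟩ := ih
    refine ⟨_, _, six_induced.prim sector_det sector_det hv, ?_⟩
    rw [weigh_sixWord, he, Matrix.mulVec_mulVec, pow_succ']

/-! ### Geometry of the dodecagon: from the billiard map to `sector` -/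

/-- The vertex 1 of the dodecagon, as a point of `Pt`. -/
noncomputable def apex : Pt := (Surd.val (72, 36), Surd.val (36, 36))

/-- The reflection in the vertex 1, followed by the rotation of the vertex number `i` to the
vertex 1. -/
def mirror (i : ℕ) : Move :=
  ((i + 6) % 12, ((Poly.ofPoint 13 (72, 36) (36, 36)).getD i (0, 0)).add (-72, -36),
    ((Poly.ofPoint 13 (72, 36) (36, 36)).getD (i + 1) (0, 0)).add (-36, -36))

theorem mirror_act {i : ℕ} (hi : i < 12) (y : Pt) :
    (mirror i).act y + apex = turn^[i] (apex - y) := by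
  have h1 : Surd.val (-72, -36) = -Surd.val (72, 36) := Surd.val_neg (72, 36)
  have h2 : Surd.val (-36, -36) = -Surd.val (36, 36) := Surd.val_neg (36, 36)
  have h3 : turn^[i] apex = (form i apex, form (i + 1) apex) := by
    ext
    · rfl
    · simp only [form, Function.iterate_succ_apply', turn]
  rw [sub_eq_add_neg, ← turn_six, turn_iterate_add, ← Function.iterate_add_apply, h3]
  simp only [Move.act, mirror, turn_iterate_mod, Surd.val_add, h1, h2]
  rw [Poly.val_ofPoint (by omega), Poly.val_ofPoint (by omega)]
  change turn^[i + 6] y + (form i apex + -apex.1, form (i + 1) apex + -apex.2) + apex = _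
  ext <;> simp only [Prod.fst_add, Prod.snd_add] <;> ring

theorem sectorMaps_eq_mirror {i : ℕ} (h1 : 1 ≤ i) (h6 : i ≤ 6) :
    moveAt sectorMaps i = mirror i := by
  interval_cases i <;> decide

/-- For each i, either the conditions on y and on its image make two opposite forms negative, which
is absurd, or they imply those of cell i. The first case covers i = 0 and i ≥ 7, which are not
labels of cells. -/
theorem sector_at_of_mirror {i : ℕ} (hi : i < 12) {y : Pt} (hy : y ∈ wedge.set)
    (h : (mirror i).act y ∈ wedge.set) : sector.At y i := by
  have hc : ∀ i < 12,
      (List.range 12).any (fun j => Dom.implies (wedge ++ wedge.pull (mirror i)) j (0, 0) &&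
        Dom.implies (wedge ++ wedge.pull (mirror i)) (j + 6) (0, 0)) = true ∨
      sectorTree.paths.any (fun p => p.1 == i &&
        p.2.all fun q => Dom.implies (wedge ++ wedge.pull (mirror i)) q.1 q.2) = true := by
    decide +kernel
  have hE : y ∈ Dom.set (wedge ++ wedge.pull (mirror i)) :=
    Dom.mem_set_append.2 ⟨hy, Dom.mem_pull.2 h⟩
  have h0 : Surd.val (0, 0) = 0 := by simp [Surd.val]
  rcases hc i hi with h1 | h1
  · rw [List.any_eq_true] at h1
    obtain ⟨j, -, h1⟩ := h1
    rw [Bool.and_eq_true] at h1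
    have h2 := Dom.implies_sound h1.1 hE
    have h3 := Dom.implies_sound h1.2 hE
    rw [form_add_six, h0] at h3
    rw [h0] at h2
    linarith
  · rw [List.any_eq_true] at h1
    obtain ⟨⟨l, E⟩, hp, h1⟩ := h1
    rw [Bool.and_eq_true, beq_iff_eq, List.all_eq_true] at h1
    obtain ⟨rfl, h1⟩ := h1
    exact ⟨hy, Tree.at_iff_paths.2 ⟨E, hp, fun q hq => Dom.implies_sound (h1 q hq) hE⟩⟩

/-- The twelfth root of unity `exp (πi/6)`. -/
noncomputable def root : ℂ := ⟨√3 / 2, 1 / 2⟩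

theorem root_eq_exp : root = Complex.exp (2 * Real.pi * Complex.I / 12) := by
  have h : 2 * (Real.pi : ℂ) * Complex.I / 12 = ((Real.pi / 6 : ℝ) : ℂ) * Complex.I := by
    push_cast
    ring
  rw [h, Complex.exp_mul_I, ← Complex.ofReal_cos, ← Complex.ofReal_sin, Real.cos_pi_div_six,
    Real.sin_pi_div_six]
  apply Complex.ext <;> simp [root]

theorem root_sq : root ^ 2 = ⟨1 / 2, √3 / 2⟩ := by
  have := Surd.sqrt3_sq
  rw [pow_two]
  apply Complex.ext
  · simp only [root, Complex.mul_re]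
    linear_combination this / 4
  · simp only [root, Complex.mul_im]
    ring

theorem root_cube : root ^ 3 = Complex.I := by
  have := Surd.sqrt3_sq
  rw [pow_succ, root_sq]
  apply Complex.ext
  · simp only [root, Complex.mul_re, Complex.I_re]
    ring
  · simp only [root, Complex.mul_im, Complex.I_im]
    linear_combination this / 4

theorem root_pow_six : root ^ 6 = -1 := by
  rw [show 6 = 3 * 2 from rfl, pow_mul, root_cube, Complex.I_sq]

theorem root_pow_twelve : root ^ 12 = 1 := by
  rw [show 12 = 6 * 2 from rfl, pow_mul, root_pow_six]
  norm_num

theorem root_ne_zero : root ≠ 0 := by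
  intro h
  have := root_pow_twelve
  rw [h] at this
  norm_num at this

theorem root_pow_mod (n : ℕ) : root ^ (n % 12) = root ^ n := by
  conv_rhs => rw [← Nat.mod_add_div n 12, pow_add, pow_mul, root_pow_twelve, one_pow, mul_one]

/-- The deviation of a power of `root` from 1 to the side is small. -/
theorem root_pow_estimate {j : ℕ} (h1 : 1 ≤ j) (h2 : j ≤ 11) :
    0 < 1 - (root ^ j).re ∧ |(root ^ j).im| ≤ (2 + √3) * (1 - (root ^ j).re) := by
  have h3 := Surd.sqrt3_sq
  have hs : 0 ≤ √3 := Real.sqrt_nonneg 3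
  have hs1 : 1 < √3 := by nlinarith
  have hs2 : √3 < 2 := by nlinarith
  have e4 : root ^ 4 = ⟨-1 / 2, √3 / 2⟩ := by
    rw [pow_succ, root_cube]
    apply Complex.ext
    · simp [root]
      ring
    · simp [root]
  have e5 : root ^ 5 = ⟨-√3 / 2, 1 / 2⟩ := by
    rw [show 5 = 3 + 2 from rfl, pow_add, root_cube, root_sq]
    apply Complex.ext <;> simp; ring
  have hneg : ∀ j, root ^ (6 + j) = -root ^ j := by
    intro j
    rw [pow_add, root_pow_six]
    ring
  have e7 : root ^ 7 = -root ^ 1 := hneg 1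
  have e8 : root ^ 8 = -root ^ 2 := hneg 2
  have e9 : root ^ 9 = -root ^ 3 := hneg 3
  have e10 : root ^ 10 = -root ^ 4 := hneg 4
  have e11 : root ^ 11 = -root ^ 5 := hneg 5
  -- For the angle θ = 30°j the ratio |sin θ| / (1 - cos θ) is |cot (θ/2)|, which is at most cot 15°
  -- = 2 + √3.
  interval_cases j <;>
    simp only [e4, e5, e7, e8, e9, e10, e11, pow_one, root_sq, root_cube, root_pow_six] <;>
    simp only [root, Complex.neg_re, Complex.neg_im, Complex.I_re, Complex.I_im, Complex.one_re,
      Complex.one_im, abs_le] <;>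
    refine ⟨?_, ?_, ?_⟩ <;> nlinarith

/-- The vector of the plane with the given values of the forms number 0 and 1. -/
noncomputable def toC (y : Pt) : ℂ :=
  ⟨((√3 - 1) * y.1 - (2 - √3) * y.2) / 2, (y.2 - (√3 - 1) * y.1) / 2⟩

theorem toC_add (x y : Pt) : toC (x + y) = toC x + toC y := by
  apply Complex.ext <;> simp [toC] <;> ring

theorem toC_neg (x : Pt) : toC (-x) = -toC x := by
  apply Complex.ext <;> simp [toC] <;> ring

theorem toC_apex : toC apex = 1 := by
  have := Surd.sqrt3_sq
  apply Complex.ext <;> simp only [toC, apex, Surd.val, Complex.one_re, Complex.one_im] <;>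
    push_cast
  · linear_combination this
  · linear_combination -this / 2

theorem root_mul_toC_turn (y : Pt) : root * toC (turn y) = toC y := by
  have := Surd.sqrt3_sq
  apply Complex.ext
  · simp only [toC, root, turn, Complex.mul_re]
    linear_combination (y.2 * √3 - y.1 - y.2) / 4 * this
  · simp only [toC, root, turn, Complex.mul_im]
    linear_combination y.2 / 4 * this

theorem root_pow_mul_toC (i : ℕ) (y : Pt) : root ^ i * toC (turn^[i] y) = toC y := by
  induction i generalizing y with
  | zero => simp
  | succ i ih => rw [Function.iterate_succ_apply, pow_succ', mul_assoc, ih, root_mul_toC_turn]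

theorem toC_surjective : Function.Surjective toC := by
  intro z
  refine ⟨((2 + √3) * z.re + z.im, (1 + √3) * (z.re + z.im)), ?_⟩
  have := Surd.sqrt3_sq
  apply Complex.ext <;> simp only [toC]
  · linear_combination (z.re + z.im / 2) * this
  · linear_combination -z.re / 2 * this

theorem toC_injective : Function.Injective toC := by
  intro x y h
  have h3 := Surd.sqrt3_sq
  have h1 := congrArg Complex.re h
  have h2 := congrArg Complex.im h
  simp only [toC] at h1 h2
  ext
  · linear_combination (2 + √3) * h1 + h2 + ((y.1 - x.1) / 2 + (y.2 - x.2) / 2) * h3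
  · linear_combination (1 + √3) * (h1 + h2) + ((y.2 - x.2) / 2) * h3

theorem form_five (y : Pt) : form 5 y = y.2 - √3 * y.1 := by
  have := Surd.sqrt3_sq
  simp only [form, Function.iterate_succ_apply, Function.iterate_zero_apply, turn]
  linear_combination (√3 * √3 * y.2 - √3 * y.1) * this

theorem mem_wedge {y : Pt} : y ∈ wedge.set ↔ form 0 y < 0 ∧ form 5 y < 0 := by
  have h0 : Surd.val (0, 0) = 0 := by simp [Surd.val]
  simp [wedge, Dom.mem_set_cons, Dom.mem_set_nil, h0]

/-- The forms 0 and 5 tell on which side of the lines through the two adjacent sides a point lies,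
in coordinates relative to the vertex. -/
theorem cross_toC (y : Pt) :
    2 * (2 + √3) * cross (toC y) (root - 1) = form 0 y ∧
      2 * (2 + √3) * cross (toC y) (root ^ 11 - 1) = form 5 y := by
  have h3 := Surd.sqrt3_sq
  have h11 : root ^ 11 = ⟨√3 / 2, -1 / 2⟩ := by
    rw [show 11 = 6 + 3 + 2 from rfl, pow_add, pow_add, root_cube, root_sq, root_pow_six]
    apply Complex.ext <;> simp
    ring
  rw [form_five, h11]
  refine ⟨?_, ?_⟩
  · simp only [cross, toC, root, Complex.sub_re, Complex.sub_im, Complex.one_re, Complex.one_im,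
      form_zero]
    linear_combination (y.1 * √3 / 2) * h3
  · simp only [cross, toC, Complex.sub_re, Complex.sub_im, Complex.one_re, Complex.one_im]
    linear_combination (y.1 * √3 / 2 - y.1 - y.2) * h3

/-- The two adjacent vertices suffice: their conditions say that (2 + √3)|re| < -im, and
`root_pow_estimate` extends this to the other vertices. -/
theorem cross_root_pow_neg {y : Pt} (hy : y ∈ wedge.set) {j : ℕ} (h1 : 1 ≤ j) (h2 : j ≤ 11) :
    cross (toC y) (root ^ j - 1) < 0 := by
  obtain ⟨h3, h4⟩ := mem_wedge.1 hy
  obtain ⟨hc, hs⟩ := root_pow_estimate h1 h2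
  have hq := Surd.sqrt3_sq
  have hp : 0 < 2 + √3 := by positivity
  have e1 : form 0 y = (2 + √3) * (toC y).re + (toC y).im := by
    simp only [toC, form_zero]
    linear_combination -(y.1 + y.2) / 2 * hq
  have e2 : form 5 y = -((2 + √3) * (toC y).re) + (toC y).im := by
    simp only [toC, form_five]
    linear_combination (y.1 + y.2) / 2 * hq
  have h5 : |(2 + √3) * (toC y).re| < -(toC y).im := abs_lt.2 ⟨by linarith, by linarith⟩
  have h6 : (2 + √3) * (toC y).re * (root ^ j).im ≤
      |(2 + √3) * (toC y).re| * ((2 + √3) * (1 - (root ^ j).re)) :=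
    (le_abs_self _).trans (by
      rw [abs_mul]
      exact mul_le_mul_of_nonneg_left hs (abs_nonneg _))
  have h7 := mul_lt_mul_of_pos_right h5 (mul_pos hp hc)
  simp only [cross, Complex.sub_re, Complex.sub_im, Complex.one_re, Complex.one_im]
  refine lt_of_mul_lt_mul_left ?_ hp.le
  linarith

theorem cross_mul (a u w : ℂ) : cross (a * u) (a * w) = Complex.normSq a * cross u w := by
  simp only [cross, Complex.mul_re, Complex.mul_im, Complex.normSq_apply]
  ring

/-- The vertices of the dodecagon. -/
noncomputable def corner (c a : ℂ) (k : ℕ) : ℂ := c + a * root ^ k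

/-- The point with position `y` relative to the vertex number `k`. -/
noncomputable def place (c a : ℂ) (k : ℕ) (y : Pt) : ℂ := c + a * root ^ k * (1 + toC y)

theorem corner_mod (c a : ℂ) (k : ℕ) : corner c a (k % 12) = corner c a k := by
  rw [corner, corner, root_pow_mod]

theorem place_mod (c a : ℂ) (k : ℕ) (y : Pt) : place c a (k % 12) y = place c a k y := by
  rw [place, place, root_pow_mod]

theorem regularPolygon_twelve (c a : ℂ) :
    regularPolygon 12 c a = convexHull ℝ (Set.range (corner c a)) := by
  rw [regularPolygon]
  congr 1
  have h : ∀ k : ℕ, c + a * Complex.exp (2 * Real.pi * Complex.I * (k : ℂ) / ((12 : ℕ) : ℂ)) =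
      corner c a k := by
    intro k
    rw [corner, root_eq_exp, ← Complex.exp_nat_mul]
    congr 3
    push_cast
    ring
  ext z
  constructor
  · rintro ⟨k, rfl⟩
    exact ⟨k, (h k).symm⟩
  · rintro ⟨k, rfl⟩
    exact ⟨⟨k % 12, Nat.mod_lt _ (by norm_num)⟩, by
      simp only [h, corner_mod]⟩

theorem cross_sub_place (c a : ℂ) (k j : ℕ) (y : Pt) :
    cross (corner c a k - place c a k y) (corner c a (k + j) - place c a k y) =
      -(Complex.normSq (a * root ^ k) * cross (toC y) (root ^ j - 1)) := by
  have h1 : corner c a k - place c a k y = a * root ^ k * -toC y := by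
    rw [corner, place]
    ring
  have h2 : corner c a (k + j) - place c a k y = a * root ^ k * (root ^ j - 1 - toC y) := by
    rw [corner, place, pow_add]
    ring
  rw [h1, h2, cross_mul]
  simp only [cross, Complex.sub_re, Complex.sub_im, Complex.neg_re, Complex.neg_im]
  ring

variable {c a : ℂ}

theorem normSq_pos (ha : a ≠ 0) (k : ℕ) : 0 < Complex.normSq (a * root ^ k) :=
  Complex.normSq_pos.2 (mul_ne_zero ha (pow_ne_zero _ root_ne_zero))

theorem exists_place_eq (ha : a ≠ 0) (k : ℕ) (p : ℂ) : ∃ y, place c a k y = p := by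
  obtain ⟨y, hy⟩ := toC_surjective ((p - c) / (a * root ^ k) - 1)
  refine ⟨y, ?_⟩
  have := mul_ne_zero ha (pow_ne_zero k root_ne_zero)
  rw [place, hy, add_sub_cancel, mul_div_cancel₀ _ this, add_sub_cancel]

theorem place_injective (ha : a ≠ 0) (k : ℕ) : Function.Injective (place c a k) := by
  intro x y h
  have := mul_ne_zero ha (pow_ne_zero k root_ne_zero)
  simp only [place, add_right_inj, mul_eq_mul_left_iff, this, or_false] at h
  exact toC_injective h

theorem exists_corner_eq (c a : ℂ) (k m : ℕ) :
    corner c a m = corner c a k ∨ ∃ j, 1 ≤ j ∧ j ≤ 11 ∧ corner c a m = corner c a (k + j) := by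
  have h : corner c a (k + (m + 12 - k % 12) % 12) = corner c a m := by
    rw [← corner_mod c a m, ← corner_mod c a (k + _)]
    congr 1
    omega
  by_cases h0 : (m + 12 - k % 12) % 12 = 0
  · left
    rw [h0, add_zero] at h
    exact h.symm
  · exact Or.inr ⟨_, by omega, by omega, h.symm⟩

theorem corner_mem (c a : ℂ) (k : ℕ) : corner c a k ∈ regularPolygon 12 c a := by
  rw [regularPolygon_twelve]
  exact subset_convexHull ℝ _ ⟨k, rfl⟩

theorem cross_comb (p v : ℂ) (s t : ℝ) (h : s + t = 1) (x y : ℂ) :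
    cross (v - p) (s • x + t • y - p) =
      s * cross (v - p) (x - p) + t * cross (v - p) (y - p) := by
  have : s • x + t • y - p = s • (x - p) + t • (y - p) := by
    have h1 : p = (s + t) • p := by rw [h, one_smul]
    nth_rewrite 1 [h1]
    module
  rw [this]
  simp only [cross, Complex.add_re, Complex.add_im, Complex.real_smul, Complex.mul_re,
    Complex.mul_im, Complex.ofReal_re, Complex.ofReal_im]
  ring

theorem cross_self (u : ℂ) : cross u u = 0 := by
  simp only [cross]
  ring

theorem isRightTangencyPoint_corner (ha : a ≠ 0) {k : ℕ} {y : Pt} (hy : y ∈ wedge.set) :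
    IsRightTangencyPoint (regularPolygon 12 c a) (place c a k y) (corner c a k) := by
  refine ⟨corner_mem c a k, fun w hw hne => ?_⟩
  let L : ℂ → ℝ := fun w => cross (corner c a k - place c a k y) (w - place c a k y)
  -- An open half-plane with one point of its boundary line added is convex, so it is enough to test
  -- the vertices.
  have hconv : Convex ℝ {w | w = corner c a k ∨ 0 < L w} := by
    intro x hx z hz s t hs ht hst
    have h0 : L (corner c a k) = 0 := cross_self _
    have hcomb := cross_comb (place c a k y) (corner c a k) s t hst x z
    change L (s • x + t • z) = s * L x + t * L z at hcomb
    rcases hs.eq_or_lt with rfl | hs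
    · obtain rfl : t = 1 := by linarith
      simpa using hz
    rcases ht.eq_or_lt with rfl | ht
    · obtain rfl : s = 1 := by linarith
      simpa using hx
    rcases hx with rfl | hx <;> rcases hz with rfl | hz
    · left
      rw [← add_smul, hst, one_smul]
    · right
      rw [hcomb, h0]
      have := mul_pos ht hz
      linarith
    · right
      rw [hcomb, h0]
      have := mul_pos hs hx
      linarith
    · right
      rw [hcomb]
      exact add_pos (mul_pos hs hx) (mul_pos ht hz)
  have hsub : convexHull ℝ (Set.range (corner c a)) ⊆ {w | w = corner c a k ∨ 0 < L w} := by
    refine convexHull_min ?_ hconv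
    rintro _ ⟨m, rfl⟩
    rcases exists_corner_eq c a k m with h | ⟨j, h1, h2, h⟩
    · exact Or.inl h
    · right
      change 0 < cross (corner c a k - place c a k y) (corner c a m - place c a k y)
      rw [h, cross_sub_place]
      have := mul_neg_of_pos_of_neg (normSq_pos ha k) (cross_root_pow_neg hy h1 h2)
      linarith
  rw [regularPolygon_twelve] at hw
  exact (hsub hw).resolve_left hne

theorem place_notMem (ha : a ≠ 0) {k : ℕ} {y : Pt} (hy : y ∈ wedge.set) :
    place c a k y ∉ regularPolygon 12 c a := by
  intro h
  by_cases he : place c a k y = corner c a k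
  · have h0 : toC y = 0 := by
      have := mul_ne_zero ha (pow_ne_zero k root_ne_zero)
      rw [place, corner, add_right_inj, mul_right_eq_self₀] at he
      exact (he.resolve_right this) |> fun h => by simpa using h
    have h1 := cross_root_pow_neg hy (j := 1) le_rfl (by norm_num)
    rw [h0] at h1
    simp [cross] at h1
  · have h1 := (isRightTangencyPoint_corner ha hy).2 _ h he
    simp [cross] at h1

theorem exists_place_of_mem (ha : a ≠ 0) {p q : ℂ}
    (h : q ∈ outerBilliard (regularPolygon 12 c a) p) :
    ∃ k y, y ∈ wedge.set ∧ p = place c a k y ∧ q = 2 * corner c a k - p := by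
  obtain ⟨-, v, hv, hq⟩ := mem_outerBilliard.1 h
  -- If the tangency point were not a vertex, all vertices, and by convexity the tangency point
  -- itself, would lie strictly to the left of the tangent line.
  obtain ⟨k, rfl⟩ : ∃ k, corner c a k = v := by
    by_contra! hne
    have hconv : Convex ℝ {w | 0 < cross (v - p) (w - p)} := by
      intro x hx z hz s t hs ht hst
      simp only [Set.mem_ofPred_eq] at hx hz ⊢
      rw [cross_comb p v s t hst]
      rcases hs.eq_or_lt with rfl | hs
      · obtain rfl : t = 1 := by linarith
        simpa using hz
      · exact add_pos_of_pos_of_nonneg (mul_pos hs hx) (mul_nonneg ht hz.le)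
    have hsub : convexHull ℝ (Set.range (corner c a)) ⊆ {w | 0 < cross (v - p) (w - p)} := by
      refine convexHull_min ?_ hconv
      rintro _ ⟨m, rfl⟩
      exact hv.2 _ (corner_mem c a m) (hne m)
    have h1 := hsub (regularPolygon_twelve c a ▸ hv.1)
    simp only [Set.mem_ofPred_eq, cross_self, lt_irrefl] at h1
  obtain ⟨y, rfl⟩ := exists_place_eq (c := c) ha k p
  have hpos : ∀ j, root ^ j ≠ 1 → cross (toC y) (root ^ j - 1) < 0 := by
    intro j hj
    have hne : corner c a (k + j) ≠ corner c a k := by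
      intro h
      rw [corner, corner, add_right_inj, pow_add, ← mul_assoc, mul_eq_left₀
        (mul_ne_zero ha (pow_ne_zero k root_ne_zero))] at h
      exact hj h
    have h1 := hv.2 _ (corner_mem c a (k + j)) hne
    rw [cross_sub_place] at h1
    by_contra! h2
    have := mul_nonneg (normSq_pos ha k).le h2
    linarith
  have hne1 : ∀ j, 1 ≤ j → j ≤ 11 → root ^ j ≠ 1 := by
    intro j h1 h2 h
    have := (root_pow_estimate h1 h2).1
    rw [h] at this
    simp at this
  refine ⟨k, y, mem_wedge.2 ?_, rfl, hq⟩
  rw [← (cross_toC y).1, ← (cross_toC y).2]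
  have hs : 0 < 2 * (2 + √3) := by positivity
  have h1 := hpos 1 (hne1 1 (by norm_num) (by norm_num))
  rw [pow_one] at h1
  exact ⟨mul_neg_of_pos_of_neg hs h1,
    mul_neg_of_pos_of_neg hs (hpos 11 (hne1 11 (by norm_num) (by norm_num)))⟩

theorem corner_inj (ha : a ≠ 0) {k m : ℕ} (h : corner c a k = corner c a m) : k ≡ m [MOD 12] := by
  by_contra hne
  have h1 : ∀ k m, k % 12 < m % 12 → corner c a k = corner c a m → False := by
    intro k m hlt h
    rw [← corner_mod c a k, ← corner_mod c a m, corner, corner, add_right_inj,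
      mul_right_inj' ha, show m % 12 = k % 12 + (m % 12 - k % 12) by omega, pow_add,
      left_eq_mul₀ (pow_ne_zero _ root_ne_zero)] at h
    have := (root_pow_estimate (j := m % 12 - k % 12) (by omega) (by omega)).1
    rw [h] at this
    simp at this
  rcases lt_or_gt_of_ne hne with hlt | hlt
  · exact h1 k m hlt h
  · exact h1 m k hlt h.symm

theorem place_inj (ha : a ≠ 0) {k m : ℕ} {x y : Pt} (hx : x ∈ wedge.set) (hy : y ∈ wedge.set)
    (h : place c a k x = place c a m y) : k ≡ m [MOD 12] ∧ x = y := by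
  have h1 := isRightTangencyPoint_corner (c := c) (k := k) ha hx
  rw [h] at h1
  have h2 := corner_inj ha (h1.unique (isRightTangencyPoint_corner ha hy))
  refine ⟨h2, place_injective (c := c) ha m ?_⟩
  rw [← h, ← place_mod c a k, h2, place_mod]

theorem reflect_place (c a : ℂ) (k : ℕ) {i : ℕ} (hi : i < 12) (y : Pt) :
    2 * corner c a k - place c a k y = place c a (k + i) ((mirror i).act y) := by
  have h1 := root_pow_mul_toC i (apex - y)
  rw [← mirror_act hi, sub_eq_add_neg, toC_add, toC_add, toC_neg, toC_apex] at h1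
  rw [corner, place, place, pow_add]
  linear_combination -(a * root ^ k) * h1

theorem mem_outerBilliard_place (ha : a ≠ 0) {k i : ℕ} {y : Pt} (h : sector.At y i) :
    place c a (k + i) (sector.step i y) ∈ outerBilliard (regularPolygon 12 c a) (place c a k y) := by
  obtain ⟨h1, h6⟩ := sector_at_le h
  refine mem_outerBilliard.2 ⟨place_notMem ha h.1, _, isRightTangencyPoint_corner ha h.1, ?_⟩
  rw [reflect_place c a k (by omega : i < 12), ← sectorMaps_eq_mirror h1 h6]
  rfl

theorem at_of_mem_outerBilliard (ha : a ≠ 0) {k m : ℕ} {x y : Pt} (hx : x ∈ wedge.set)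
    (hy : y ∈ wedge.set)
    (h : place c a m y ∈ outerBilliard (regularPolygon 12 c a) (place c a k x)) :
    ∃ i, sector.At x i ∧ y = sector.step i x ∧ m ≡ k + i [MOD 12] := by
  obtain ⟨-, v, hv, hq⟩ := mem_outerBilliard.1 h
  obtain rfl := hv.unique (isRightTangencyPoint_corner ha hx)
  obtain ⟨i, hi, hmod⟩ : ∃ i < 12, m ≡ k + i [MOD 12] :=
    ⟨(m + 12 - k % 12) % 12, Nat.mod_lt _ (by norm_num), by unfold Nat.ModEq; omega⟩
  rw [reflect_place c a k hi, ← place_mod c a m, hmod, place_mod] at hq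
  obtain rfl := place_injective ha _ hq
  have hat := sector_at_of_mirror hi hx hy
  obtain ⟨h1, h6⟩ := sector_at_le hat
  refine ⟨i, hat, ?_, hmod⟩
  rw [← sectorMaps_eq_mirror h1 h6]
  rfl

theorem run_of_mem_iter (ha : a ≠ 0) {n k m : ℕ} {x y : Pt} (hx : x ∈ wedge.set)
    (hy : y ∈ wedge.set)
    (h : place c a m y ∈ iter (outerBilliard (regularPolygon 12 c a)) n (place c a k x)) :
    ∃ w : List ℕ, w.length = n ∧ sector.Run x w y ∧ m ≡ k + w.sum [MOD 12] := by
  induction n generalizing m y with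
  | zero =>
    obtain ⟨h1, h2⟩ := place_inj ha hy hx (Part.mem_some_iff.1 h)
    exact ⟨[], rfl, h2.symm, by simpa using h1⟩
  | succ n ih =>
    obtain ⟨r, hr, hq⟩ := Part.mem_bind_iff.1 h
    obtain ⟨l, z, hz, rfl, -⟩ := exists_place_of_mem ha hq
    obtain ⟨w, hw, hrun, hmod⟩ := ih hz hr
    obtain ⟨i, hi, rfl, hmod'⟩ := at_of_mem_outerBilliard ha hz hy hq
    refine ⟨w ++ [i], by simp [hw], run_append.2 ⟨z, hrun, hi, rfl⟩, hmod'.trans ?_⟩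
    rw [List.sum_append, List.sum_singleton, ← add_assoc]
    exact hmod.add_right i

theorem mem_iter_of_run (ha : a ≠ 0) {k : ℕ} {x y : Pt} {w : List ℕ} (h : sector.Run x w y) :
    place c a (k + w.sum) y ∈
      iter (outerBilliard (regularPolygon 12 c a)) w.length (place c a k x) := by
  induction w using List.reverseRecOn generalizing y with
  | nil => rw [← run_nil.1 h]; exact Part.mem_some _
  | append_singleton w i ih =>
    obtain ⟨z, hz, hi, rfl⟩ := run_append.1 h
    rw [List.length_append, List.length_singleton, List.sum_append, List.sum_singleton,
      ← add_assoc]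
    exact Part.mem_bind_iff.2 ⟨_, ih hz, mem_outerBilliard_place ha hi⟩

theorem exists_mem_of_mem_iter {α : Type*} {T : α →. α} {p q : α} {n : ℕ}
    (h : q ∈ iter T (n + 1) p) : ∃ r, r ∈ T p := by
  induction n generalizing q with
  | zero =>
    obtain ⟨r, hr, hq⟩ := Part.mem_bind_iff.1 h
    rw [Part.mem_some_iff.1 hr] at hq
    exact ⟨q, hq⟩
  | succ n ih =>
    obtain ⟨r, hr, -⟩ := Part.mem_bind_iff.1 h
    exact ih hr

theorem mem_wedge_of_prim {y : Pt} {w : List ℕ} (hw : sector.Prim y w) : y ∈ wedge.set := by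
  obtain ⟨k, w, rfl⟩ := List.exists_cons_of_ne_nil hw.1
  exact hw.2.1.1.1

/-- A return in the wedge reads w some m times; the vertex also returns exactly if 12 divides m
times the sum of w. -/
theorem place_mem_iter_iff (ha : a ≠ 0) {k n : ℕ} {y : Pt} {w : List ℕ} (hw : sector.Prim y w) :
    place c a k y ∈ iter (outerBilliard (regularPolygon 12 c a)) n (place c a k y) ↔
      w.length * ord w.sum ∣ n := by
  have hy := mem_wedge_of_prim hw
  have hsum : ∀ m, (List.replicate m w).flatten.sum = m * w.sum := by
    intro m
    simp [List.sum_flatten]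
  have hlen : ∀ m, (List.replicate m w).flatten.length = m * w.length := by
    intro m
    simp
  constructor
  · intro h
    obtain ⟨u, rfl, hr, hmod⟩ := run_of_mem_iter ha hy hy h
    obtain ⟨m, rfl⟩ := hw.exists_rep sector_det hr
    rw [hsum] at hmod
    have h1 : 12 ∣ m * w.sum := by
      have := (Nat.modEq_iff_dvd' (Nat.le_add_right k _)).1 hmod
      rwa [Nat.add_sub_cancel_left] at this
    rw [hlen, mul_comm m]
    exact mul_dvd_mul_left _ (dvd_mul_iff_ord_dvd.1 h1)
  · rintro ⟨m, rfl⟩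
    have h1 := mem_iter_of_run (c := c) (k := k) ha (hw.2.1.rep (ord w.sum * m))
    rw [hsum, hlen] at h1
    have h2 : 12 ∣ ord w.sum * m * w.sum := by
      rw [mul_right_comm]
      exact (ord_mul_dvd _).mul_right _
    have h3 : (k + ord w.sum * m * w.sum) % 12 = k % 12 := by omega
    rw [← place_mod c a (k + _), h3, place_mod] at h1
    rwa [show w.length * ord w.sum * m = ord w.sum * m * w.length by ring]

theorem isPeriod_place (ha : a ≠ 0) {k : ℕ} {y : Pt} {w : List ℕ} (hw : sector.Prim y w) :
    IsPeriod (outerBilliard (regularPolygon 12 c a)) (place c a k y) (w.length * ord w.sum) := by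
  refine ⟨⟨Nat.mul_pos (List.length_pos_iff.2 hw.1) (ord_pos _),
    (place_mem_iter_iff ha hw).2 dvd_rfl⟩, fun n hn => ?_⟩
  exact Nat.le_of_dvd hn.1 ((place_mem_iter_iff ha hw).1 hn.2)

theorem mem_periods_iff (ha : a ≠ 0) {n : ℕ} :
    n ∈ periods (regularPolygon 12 c a) ↔
      ∃ y w, sector.Prim y w ∧ n = w.length * ord w.sum := by
  constructor
  · rintro ⟨p, -, hn⟩
    obtain ⟨n, rfl⟩ := Nat.exists_eq_succ_of_ne_zero hn.1.1.ne'
    obtain ⟨r, hr⟩ := exists_mem_of_mem_iter hn.1.2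
    obtain ⟨k, y, hy, rfl, -⟩ := exists_place_of_mem ha hr
    obtain ⟨u, hu, hrun, -⟩ := run_of_mem_iter ha hy hy hn.1.2
    obtain ⟨w, hw⟩ := exists_prim (by rintro rfl; simp at hu) hrun
    exact ⟨y, w, hw, hn.unique (isPeriod_place ha hw)⟩
  · rintro ⟨y, w, hw, rfl⟩
    exact ⟨place c a 0 y, place_notMem ha (mem_wedge_of_prim hw), isPeriod_place ha hw⟩

/-! ### Arithmetic of the periods -/

def size (h : Fin 6 → ℕ) : ℕ := ![1, 1, 1, 1, 1, 1] ⬝ᵥ h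

def moment (h : Fin 6 → ℕ) : ℕ := ![1, 2, 3, 4, 5, 6] ⬝ᵥ h

theorem size_add (g h : Fin 6 → ℕ) : size (g + h) = size g + size h := dotProduct_add _ _ _

theorem moment_add (g h : Fin 6 → ℕ) : moment (g + h) = moment g + moment h :=
  dotProduct_add _ _ _

theorem size_smul (m : ℕ) (h : Fin 6 → ℕ) : size (m • h) = m * size h := dotProduct_smul _ _ _

theorem moment_smul (m : ℕ) (h : Fin 6 → ℕ) : moment (m • h) = m * moment h :=
  dotProduct_smul _ _ _

/-- The period that corresponds to the numbers `h` of the letters of a word. -/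
def value (h : Fin 6 → ℕ) : ℕ := size h * ord (moment h)

theorem mem_B_iff {b : ℕ} : b ∈ B ↔ ∃ h ∈ H, b = value h := by
  have key : ∀ h, 12 * (![1, 1, 1, 1, 1, 1] ⬝ᵥ h) / Nat.gcd 12 (![1, 2, 3, 4, 5, 6] ⬝ᵥ h) =
      value h := by
    intro h
    rw [value, ord, mul_comm 12, Nat.mul_div_assoc _ (Nat.gcd_dvd_left _ _)]
    rfl
  constructor
  · rintro ⟨h, hh, hb⟩
    exact ⟨h, hh, hb.trans (key h)⟩
  · rintro ⟨h, hh, hb⟩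
    exact ⟨h, hh, hb.trans (key h).symm⟩

/-- The congruence for `rot` holds because step k is a half-turn, that is six times 30°, followed by
the rotation by k times 30° (in the sense of `turn`). -/
theorem weigh_letters {w : List ℕ} (h : ∀ k ∈ w, 1 ≤ k ∧ k ≤ 6) :
    size (weigh sectorWeight w) = w.length ∧ moment (weigh sectorWeight w) = w.sum ∧
      rot w ≡ 6 * w.length + w.sum [MOD 12] := by
  induction w with
  | nil => exact ⟨by simp [weigh_nil, size], by simp [weigh_nil, moment], rfl⟩
  | cons k w ih =>
    obtain ⟨h1, h2, h3⟩ := ih fun l hl => h l (List.mem_cons_of_mem _ hl)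
    have hk : size (sectorWeight k) = 1 ∧ moment (sectorWeight k) = k ∧
        (moveAt sectorMaps k).1 ≡ 6 + k [MOD 12] := by
      obtain ⟨h4, h5⟩ := h k List.mem_cons_self
      interval_cases k <;> decide
    obtain ⟨h4, h5, h6⟩ := hk
    rw [weigh_cons, size_add, moment_add, h1, h2, h4, h5, List.length_cons, List.sum_cons]
    refine ⟨add_comm _ _, rfl, ?_⟩
    have h7 := h6.add h3
    rw [show 6 * (w.length + 1) + (k + w.sum) = 6 + k + (6 * w.length + w.sum) by ring]
    exact h7

theorem weigh_prim {x : Pt} {w : List ℕ} (hw : sector.Prim x w) :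
    size (weigh sectorWeight w) = w.length ∧ moment (weigh sectorWeight w) = w.sum ∧
      rot w ≡ 6 * w.length + w.sum [MOD 12] :=
  weigh_letters fun _ hk =>
    let ⟨_, _, _, hz⟩ := exists_at_of_mem hw.2.1 hk
    sector_at_le hz

theorem weigh_replicate (m : ℕ) (w : List ℕ) :
    weigh sectorWeight (List.replicate m w).flatten = m • weigh sectorWeight w := by
  induction m with
  | zero => simp [weigh_nil]
  | succ m ih => rw [List.replicate_succ, List.flatten_cons, weigh_append, ih, succ_nsmul']

theorem ord_congr {r s : ℕ} (h : r ≡ s [MOD 12]) : ord r = ord s := by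
  have key : ∀ r, ord (r % 12) = ord r := by
    intro r
    rw [ord, ord, Nat.gcd_comm, ← Nat.gcd_rec]
  rw [← key r, ← key s, h]

/-- With l the length and s the sum of a word, the left side compares the period of the repeated
word with that of the word itself. Everything depends on l modulo 2 and s modulo 12 only;
`ord_mul_ord_of_odd` is the other case. -/
theorem ord_mul_ord_of_even {l s : ℕ} (h : ¬Odd (l * ord s)) :
    ord (6 * l + s) * ord (ord (6 * l + s) * s) = ord s := by
  have key : ∀ l < 2, ∀ s < 12, ¬Odd (l * ord s) →
      ord (6 * l + s) * ord (ord (6 * l + s) * s) = ord s := by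
    decide +kernel
  have h1 : ord (6 * l + s) = ord (6 * (l % 2) + s % 12) := ord_congr (by
    unfold Nat.ModEq
    omega)
  have h2 : ord (s % 12) = ord s := ord_congr (Nat.mod_modEq s 12)
  have h3 := key (l % 2) (Nat.mod_lt _ (by norm_num)) (s % 12) (Nat.mod_lt _ (by norm_num)) (by
    rw [h2, Nat.odd_mul, Nat.odd_iff, Nat.mod_mod, ← Nat.odd_iff, ← Nat.odd_mul]
    exact h)
  rw [← h1, h2] at h3
  rwa [ord_congr ((Nat.mod_modEq s 12).mul_left (ord (6 * l + s)))] at h3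

theorem ord_mul_ord_of_odd {l s : ℕ} (h : Odd (l * ord s)) :
    ord (6 * l + s) * ord (ord (6 * l + s) * s) = 2 * ord s ∧ l % 2 = 1 ∧ s % 4 = 0 ∧
      ord (6 * l + s) % 4 = 2 := by
  have key : ∀ l < 2, ∀ s < 12, Odd (l * ord s) →
      ord (6 * l + s) * ord (ord (6 * l + s) * s) = 2 * ord s ∧ l % 2 = 1 ∧ s % 4 = 0 ∧
        ord (6 * l + s) % 4 = 2 := by
    decide +kernel
  have h1 : ord (6 * l + s) = ord (6 * (l % 2) + s % 12) := ord_congr (by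
    unfold Nat.ModEq
    omega)
  have h2 : ord (s % 12) = ord s := ord_congr (Nat.mod_modEq s 12)
  have h3 := key (l % 2) (Nat.mod_lt _ (by norm_num)) (s % 12) (Nat.mod_lt _ (by norm_num)) (by
    rw [h2, Nat.odd_mul, Nat.odd_iff, Nat.mod_mod, ← Nat.odd_iff, ← Nat.odd_mul]
    exact h)
  rw [← h1, h2] at h3
  rw [ord_congr ((Nat.mod_modEq s 12).mul_left (ord (6 * l + s)))] at h3
  refine ⟨h3.1, ?_, ?_, h3.2.2.2⟩ <;> omega

theorem odd_of_mod {l s : ℕ} (hl : l % 2 = 1) (hs : s % 4 = 0) : Odd (l * ord s) := by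
  have key : ∀ s < 12, s % 4 = 0 → Odd (ord s) := by decide +kernel
  have h2 : ord (s % 12) = ord s := ord_congr (Nat.mod_modEq s 12)
  exact Nat.odd_mul.2 ⟨Nat.odd_iff.2 hl,
    h2 ▸ key (s % 12) (Nat.mod_lt _ (by norm_num)) (by omega)⟩

/-- The order of the rotation of a word with the numbers `h` of letters. -/
def order (h : Fin 6 → ℕ) : ℕ := ord (6 * size h + moment h)

theorem value_order_smul (h : Fin 6 → ℕ) :
    value (order h • h) = value h ∧ ¬Odd (value h) ∨
      value (order h • h) = 2 * value h ∧ Odd (value h) := by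
  rw [value, size_smul, moment_smul, value, order]
  by_cases ho : Odd (size h * ord (moment h))
  · refine Or.inr ⟨?_, ho⟩
    linear_combination size h * (ord_mul_ord_of_odd ho).1
  · refine Or.inl ⟨?_, ho⟩
    linear_combination size h * ord_mul_ord_of_even ho

theorem size_M66 (h : Fin 6 → ℕ) : size (M66 *ᵥ h) + moment h = 7 * size h := by
  simp [size, moment, M66, Matrix.mulVec, dotProduct, Fin.sum_univ_six, Matrix.of_apply]
  ring

theorem moment_M66 (h : Fin 6 → ℕ) : moment (M66 *ᵥ h) + 5 * moment h = 36 * size h := by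
  simp [size, moment, M66, Matrix.mulVec, dotProduct, Fin.sum_univ_six, Matrix.of_apply]
  ring

/-- `M66` takes (size, moment) to (7 size - moment, 36 size - 5 moment), and 6 size + moment does
not change modulo 12. -/
theorem order_M66_pow (k : ℕ) (h : Fin 6 → ℕ) : order (M66 ^ k *ᵥ h) = order h := by
  induction k with
  | zero => simp
  | succ k ih =>
    rw [pow_succ', ← Matrix.mulVec_mulVec, ← ih]
    have h1 := size_M66 (M66 ^ k *ᵥ h)
    have h2 := moment_M66 (M66 ^ k *ᵥ h)
    refine ord_congr ?_
    unfold Nat.ModEq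
    omega

/-- The condition means that the period `value` is odd, because 12 / gcd(12, s) is odd exactly if 4
∣ s. -/
theorem parity_M66_pow (k : ℕ) (h : Fin 6 → ℕ) :
    (size (M66 ^ k *ᵥ h) % 2 = 1 ∧ moment (M66 ^ k *ᵥ h) % 4 = 0) ↔
      (size h % 2 = 1 ∧ moment h % 4 = 0) := by
  induction k with
  | zero => simp
  | succ k ih =>
    rw [pow_succ', ← Matrix.mulVec_mulVec, ← ih]
    have h1 := size_M66 (M66 ^ k *ᵥ h)
    have h2 := moment_M66 (M66 ^ k *ᵥ h)
    omega

theorem order_weigh {x : Pt} {w : List ℕ} (hw : sector.Prim x w) :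
    order (weigh sectorWeight w) = ord (rot w) := by
  obtain ⟨h1, h2, h3⟩ := weigh_prim hw
  rw [order, h1, h2, ord_congr h3]

theorem value_weigh {x : Pt} {w : List ℕ} (hw : sector.Prim x w) :
    value (weigh sectorWeight w) = w.length * ord w.sum := by
  obtain ⟨h1, h2, -⟩ := weigh_prim hw
  rw [value, h1, h2]

/-- The row on the right is 6 size + moment composed with `M68`, modulo 12. It is fixed by `M88`, in
accordance with the fact that rescaling does not change rotations. -/
theorem rot_M68_mod (n : ℕ) (f : Fin 8 → ℕ) :
    6 * size ((M68 * M88 ^ n) *ᵥ f) + moment ((M68 * M88 ^ n) *ᵥ f) ≡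
      ![7, 8, 9, 10, 6, 5, 8, 7] ⬝ᵥ f [MOD 12] := by
  have h1 : ∀ g : Fin 8 → ℕ, 6 * size (M68 *ᵥ g) + moment (M68 *ᵥ g) ≡
      ![7, 8, 9, 10, 6, 5, 8, 7] ⬝ᵥ g [MOD 12] := by
    intro g
    simp [size, moment, M68, Matrix.mulVec, dotProduct, Fin.sum_univ_six, Fin.sum_univ_eight,
      Matrix.of_apply, Nat.ModEq]
    omega
  have h2 : ∀ g : Fin 8 → ℕ, ![7, 8, 9, 10, 6, 5, 8, 7] ⬝ᵥ (M88 *ᵥ g) ≡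
      ![7, 8, 9, 10, 6, 5, 8, 7] ⬝ᵥ g [MOD 12] := by
    intro g
    simp [M88, Matrix.mulVec, dotProduct, Fin.sum_univ_eight, Matrix.of_apply, Nat.ModEq]
    omega
  rw [← Matrix.mulVec_mulVec]
  refine (h1 _).trans ?_
  induction n with
  | zero => simp [Nat.ModEq.refl]
  | succ n ih =>
    rw [pow_succ', ← Matrix.mulVec_mulVec]
    exact (h2 _).trans ih

/-- The length of the word of `M68 * M88 ^ n`, modulo 4. -/
def sizeRow : ℕ → Fin 8 → ℕ
  | 0 => ![1, 1, 1, 1, 2, 1, 3, 1]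
  | 1 => ![3, 0, 3, 1, 2, 3, 1, 3]
  | _ => ![3, 2, 3, 1, 2, 3, 1, 3]

/-- Modulo 4, repeated multiplication by `M88` makes the row of lengths constant from n = 2 on. -/
theorem size_M68_mod (n : ℕ) (f : Fin 8 → ℕ) :
    size ((M68 * M88 ^ n) *ᵥ f) ≡ sizeRow n ⬝ᵥ f [MOD 4] := by
  have h0 : ∀ g : Fin 8 → ℕ, size (M68 *ᵥ g) ≡ ![1, 1, 1, 1, 2, 1, 3, 1] ⬝ᵥ g [MOD 4] := by
    intro g
    simp [size, M68, Matrix.mulVec, dotProduct, Fin.sum_univ_six, Fin.sum_univ_eight,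
      Matrix.of_apply, Nat.ModEq]
    omega
  have h1 : ∀ g : Fin 8 → ℕ, ![1, 1, 1, 1, 2, 1, 3, 1] ⬝ᵥ (M88 *ᵥ g) ≡
      ![3, 0, 3, 1, 2, 3, 1, 3] ⬝ᵥ g [MOD 4] := by
    intro g
    simp [M88, Matrix.mulVec, dotProduct, Fin.sum_univ_eight, Matrix.of_apply, Nat.ModEq]
    omega
  have h2 : ∀ g : Fin 8 → ℕ, ![3, 0, 3, 1, 2, 3, 1, 3] ⬝ᵥ (M88 *ᵥ g) ≡
      ![3, 2, 3, 1, 2, 3, 1, 3] ⬝ᵥ g [MOD 4] := by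
    intro g
    simp [M88, Matrix.mulVec, dotProduct, Fin.sum_univ_eight, Matrix.of_apply, Nat.ModEq]
    omega
  have h3 : ∀ g : Fin 8 → ℕ, ![3, 2, 3, 1, 2, 3, 1, 3] ⬝ᵥ (M88 *ᵥ g) ≡
      ![3, 2, 3, 1, 2, 3, 1, 3] ⬝ᵥ g [MOD 4] := by
    intro g
    simp [M88, Matrix.mulVec, dotProduct, Fin.sum_univ_eight, Matrix.of_apply, Nat.ModEq]
    omega
  rw [← Matrix.mulVec_mulVec]
  refine (h0 _).trans ?_
  match n with
  | 0 => simp [Nat.ModEq.refl, sizeRow]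
  | 1 => rw [pow_one]; exact h1 f
  | n + 2 =>
    rw [pow_succ', pow_succ', ← Matrix.mulVec_mulVec, ← Matrix.mulVec_mulVec]
    refine ((h1 _).trans (h2 _)).trans ?_
    induction n with
    | zero => simp [Nat.ModEq.refl, sizeRow]
    | succ n ih =>
      rw [pow_succ', ← Matrix.mulVec_mulVec]
      exact (h3 _).trans ih

/-- By the two congruences, three cases of n remain for each f. The assumptions on rotation and
length can hold only for n = 0, and then the letter 1 occurs an odd number of times. -/
theorem not_even_of_rot_eq_zero {f : Fin 8 → ℕ} (hf : f ∈ F) (n : ℕ)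
    (h0 : 12 ∣ 6 * size ((M68 * M88 ^ n) *ᵥ f) + moment ((M68 * M88 ^ n) *ᵥ f))
    (h1 : size ((M68 * M88 ^ n) *ᵥ f) % 4 = 2) (h2 : ∀ i, 2 ∣ ((M68 * M88 ^ n) *ᵥ f) i) :
    False := by
  have key : ∀ m < 3, ![7, 8, 9, 10, 6, 5, 8, 7] ⬝ᵥ f % 12 = 0 → sizeRow m ⬝ᵥ f % 4 = 2 →
      m = 0 ∧ (M68 *ᵥ f) 0 % 2 = 1 := by
    simp only [F, Set.mem_insert_iff, Set.mem_singleton_iff] at hf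
    rcases hf with rfl | rfl | rfl | rfl | rfl | rfl | rfl | rfl | rfl | rfl | rfl | rfl | rfl <;>
      decide +kernel
  have h3 : ![7, 8, 9, 10, 6, 5, 8, 7] ⬝ᵥ f % 12 = 0 :=
    (rot_M68_mod n f).symm.trans (Nat.modEq_zero_iff_dvd.2 h0)
  have h4 : sizeRow n ⬝ᵥ f % 4 = 2 :=
    Eq.trans (size_M68_mod n f).symm h1
  rcases n with _ | _ | n
  · have h5 := h2 0
    rw [pow_zero, Matrix.mul_one] at h5
    have h6 := (key 0 (by norm_num) h3 h4).2
    omega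
  · exact absurd (key 1 (by norm_num) h3 h4).1 (by norm_num)
  · exact absurd (key 2 (by norm_num) h3 h4).1 (by norm_num)

/-- The exponent would be 2 modulo 4 and u of odd length, so v would be a square of length 2 modulo
4 with even letter counts and trivial rotation. For the words from `F` the counts forbid this, for
those from `G` the property `isNotSquare`. -/
theorem isPower_false {u v : List ℕ} (hb : IsBase v) (hp : IsPower u v)
    (hu : size (weigh sectorWeight u) % 2 = 1 ∧ moment (weigh sectorWeight u) % 4 = 0)
    {x z : Pt} (hxu : sector.Prim x u) (hzv : sector.Prim z v) : False := by
  have ho := order_weigh hxu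
  have h4 : ord (rot u) % 4 = 2 := by
    rw [← ho]
    exact (ord_mul_ord_of_odd (odd_of_mod hu.1 hu.2)).2.2.2
  have hvu : weigh sectorWeight v = ord (rot u) • weigh sectorWeight u := by
    conv_lhs => rw [hp]
    exact weigh_replicate _ _
  have hsize : size (weigh sectorWeight v) % 4 = 2 := by
    rw [hvu, size_smul, Nat.mul_mod, h4]
    omega
  rcases hb with ⟨f, hf, n, hw⟩ | ⟨-, hsq⟩
  · refine not_even_of_rot_eq_zero hf n ?_ (hw ▸ hsize) ?_
    · rw [← hw]
      have h5 : 12 ∣ rot v := by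
        rw [hp, rot_replicate]
        exact ord_mul_dvd _
      obtain ⟨h6, h7, h8⟩ := weigh_prim hzv
      rw [h6, h7]
      exact (Nat.modEq_zero_iff_dvd.1 (h8.symm.trans (Nat.modEq_zero_iff_dvd.2 h5)))
    · intro i
      rw [← hw, hvu, Pi.smul_apply, smul_eq_mul]
      exact Dvd.dvd.mul_right (by omega) _
  · obtain ⟨m, hm⟩ : ∃ m, ord (rot u) = m + m := ⟨ord (rot u) / 2, by omega⟩
    have hv : v = (List.replicate m u).flatten ++ (List.replicate m u).flatten := by
      rw [hp, hm, ← List.flatten_append, List.replicate_append_replicate]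
    have hl : v.length / 2 = (List.replicate m u).flatten.length := by
      rw [hv, List.length_append]
      omega
    rw [(weigh_prim hzv).1] at hsize
    rw [isNotSquare, hl, hsize] at hsq
    rw [hv, List.take_left, List.drop_left] at hsq
    simp at hsq

theorem mem_H_of_isBase {v : List ℕ} (hb : IsBase v) (k : ℕ) :
    M66 ^ k *ᵥ weigh sectorWeight v ∈ H := by
  rcases hb with ⟨f, hf, n, hw⟩ | ⟨hg, -⟩
  · exact Or.inl ⟨f, hf, k, n, by rw [hw, Matrix.mulVec_mulVec, Matrix.mul_assoc]⟩
  · exact Or.inr ⟨_, hg, k, rfl⟩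

theorem weigh_of_isPower {u v : List ℕ} (h : IsPower u v) {x : Pt} (hu : sector.Prim x u) (k : ℕ) :
    M66 ^ k *ᵥ weigh sectorWeight v =
      order (M66 ^ k *ᵥ weigh sectorWeight u) • (M66 ^ k *ᵥ weigh sectorWeight u) := by
  rw [order_M66_pow, order_weigh hu]
  conv_lhs => rw [h]
  rw [weigh_replicate, Matrix.mulVec_smul]

/-! ### Realisation of all counts, and the set of periods -/

theorem exists_near_prim {f : Fin 8 → ℕ} (hf : f ∈ F) (n : ℕ) :
    ∃ x w, near.Prim x w ∧ weigh nearWeight w = M88 ^ n *ᵥ f := by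
  induction n with
  | zero =>
    obtain ⟨e, he, rfl⟩ := exists_nearIsland hf
    obtain ⟨w, hw, h⟩ := near_islands he
    exact ⟨_, w, hw.prim, by simp [h]⟩
  | succ n ih =>
    obtain ⟨x, w, hw, h⟩ := ih
    refine ⟨_, _, shrink_induced.prim near_det near_det hw, ?_⟩
    rw [weigh_returnWord, h, Matrix.mulVec_mulVec, pow_succ']

theorem exists_prim_of_mem_H {h : Fin 6 → ℕ} (hh : h ∈ H) :
    ∃ x w, sector.Prim x w ∧ weigh sectorWeight w = h := by
  rcases hh with ⟨f, hf, k, n, rfl⟩ | ⟨g, hg, k, rfl⟩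
  · obtain ⟨x, w, hw, h⟩ := exists_near_prim hf n
    obtain ⟨y, v, hv, h'⟩ := exists_prim_pow (near_induced.prim sector_det near_det hw) k
    refine ⟨y, v, hv, ?_⟩
    rw [h', weigh_nearWord, h, Matrix.mulVec_mulVec, Matrix.mulVec_mulVec]
  · obtain ⟨e, he, rfl⟩ := exists_farIsland hg
    obtain ⟨w, hw, h, -⟩ := far_islands he
    obtain ⟨y, v, hv, h'⟩ := exists_prim_pow hw.prim k
    exact ⟨y, v, hv, by rw [h', h]⟩

/-- The point x is the only fixed point of w, so a neighbour with the same itinerary has a longer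
word, which must be the repeated one. This realises the doubled periods. -/
theorem exists_prim_isPower {x : Pt} {w : List ℕ} (hw : sector.Prim x w) (hr : ¬12 ∣ rot w) :
    ∃ q u, sector.Prim q u ∧ IsPower w u := by
  have hrep := hw.2.1.rep 12
  have hne := replicate_flatten_ne_nil hw.1 (m := 12) (by norm_num)
  obtain ⟨q, ⟨q', hq⟩, -, hqx⟩ := exists_generic
    (isOpen_run (List.replicate 12 w).flatten) (x := x) ⟨x, hrep⟩
  obtain rfl := eq_of_run_of_dvd (by rw [rot_replicate]; exact dvd_mul_right _ _) hrep hq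
  obtain ⟨u, hu⟩ := exists_prim hne hq
  refine ⟨q', u, hu, ?_⟩
  rcases eq_or_isPower hu hw (sameItinerary_of_run sector_det hne hq hrep) with rfl | h | h
  · exact absurd (eq_of_run_of_not_dvd hr hw.2.1 hu.2.1) hqx
  · refine absurd ?_ hr
    rw [h, rot_replicate]
    exact ord_mul_dvd _
  · exact h

theorem exists_prim_iff {n : ℕ} :
    (∃ x w, sector.Prim x w ∧ n = w.length * ord w.sum) ↔
      n ∈ B ∪ {m : ℕ | ∃ b ∈ B, Odd b ∧ m = 2 * b} := by
  constructor
  · rintro ⟨x, w, hw, rfl⟩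
    obtain ⟨y, w', k, hw', h6, hk⟩ := exists_prim_without_six hw
    obtain ⟨u, v, y', z, hu', hv, hp, hb, hrel⟩ := exists_island_of_prim hw' h6
    have hu : weigh sectorWeight w' = weigh sectorWeight u := ((hp.map _).sum_eq).symm
    have hH := mem_H_of_isBase hb k
    rw [← value_weigh hw, hk, hu]
    rcases hrel with rfl | h | h
    · exact Or.inl (mem_B_iff.2 ⟨_, hH, rfl⟩)
    -- The tabulated word v repeats u. This does not change an even period, and an odd one is
    -- impossible.
    · rw [weigh_of_isPower h hu' k] at hH
      rcases value_order_smul (M66 ^ k *ᵥ weigh sectorWeight u) with h1 | h1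
      · exact Or.inl (mem_B_iff.2 ⟨_, hH, h1.1.symm⟩)
      · have h2 := ord_mul_ord_of_odd h1.2
        exact (isPower_false hb h ((parity_M66_pow k _).1 ⟨h2.2.1, h2.2.2.1⟩) hu' hv).elim
    · rw [weigh_of_isPower h hv k]
      rcases value_order_smul (M66 ^ k *ᵥ weigh sectorWeight v) with h1 | h1
      · exact Or.inl (mem_B_iff.2 ⟨_, hH, h1.1⟩)
      · exact Or.inr ⟨_, mem_B_iff.2 ⟨_, hH, rfl⟩, h1.2, h1.1⟩
  · rintro (hn | ⟨b, hb, hodd, rfl⟩)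
    · obtain ⟨h, hh, rfl⟩ := mem_B_iff.1 hn
      obtain ⟨x, w, hw, rfl⟩ := exists_prim_of_mem_H hh
      exact ⟨x, w, hw, value_weigh hw⟩
    · obtain ⟨h, hh, rfl⟩ := mem_B_iff.1 hb
      obtain ⟨x, w, hw, rfl⟩ := exists_prim_of_mem_H hh
      have hord := (ord_mul_ord_of_odd hodd).2.2.2
      -- For an odd period the order of the rotation is 2 modulo 4, so it is not 1.
      have hr : ¬12 ∣ rot w := by
        intro hr
        have h1 := order_weigh hw
        have h2 := Nat.mod_eq_of_lt (show 1 < 4 by norm_num)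
        rw [ord, Nat.gcd_eq_left hr] at h1
        rw [order] at h1
        omega
      obtain ⟨q, u, hu, hpow⟩ := exists_prim_isPower hw hr
      refine ⟨q, u, hu, ?_⟩
      have h1 := weigh_of_isPower hpow hw 0
      simp only [pow_zero, Matrix.one_mulVec] at h1
      rw [← value_weigh hu, h1]
      rcases value_order_smul (weigh sectorWeight w) with h2 | h2
      · exact absurd hodd h2.2
      · exact h2.1.symm

end OuterBilliard

theorem mainTheorem3 (c a : ℂ) (ha : a ≠ 0) :
    OuterBilliard.periods (OuterBilliard.regularPolygon 12 c a) =
      OuterBilliard.B ∪ {m : ℕ | ∃ b ∈ OuterBilliard.B, Odd b ∧ m = 2 * b} := by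
  ext n
  rw [OuterBilliard.mem_periods_iff ha, OuterBilliard.exists_prim_iff]
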